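/- **Conventions.** Let \(X\) be a (Hausdorff) reduced complex space and \(\mathcal O_X[[b]]\) the sheaf \(U\mapsto \mathcal O_X(U)[[b]]\). An \(\mathcal O_X\)-\((a,b)\)-module is a sheaf \(\mathbb E\) of \(\mathcal O_X[[b]]\)-modules, locally free of finite type, with an \(\mathcal O_X\)-linear endomorphism \(a\), continuous for the \(b\)-adic topology, such that \(ab-ba=b^2\). Its fibre at \(x\in X\) is \(E(x)=\mathbb E/\mathcal M_x[[b]]\,\mathbb E\), where \(\mathcal M_x\) is the ideal of functions vanishing at \(x\); it is an \((a,b)\)-module, i.e. a free \(\mathbb C[[b]]\)-module of finite rank with a \(\mathbb C\)-linear \(a\), continuous for the \(b\)-adic topology, such that \(ab-ba=b^2\), equivalently a left module, free of finite rank over \(\mathbb C[[b]]\), over the \(b\)-completion \(\tilde{\mathcal A}\) of \(\mathbb C\langle a,b\rangle/(ab-ba-b^2)\). For a finite set \(\Lambda\subset\,]0,1]\cap\mathbb Q\) put \(\Xi_\Lambda^{(N)}=\bigoplus_{\mu\in\Lambda}\bigoplus_{j=0}^N\mathbb C[[b]]\,e_{\mu,j}\) with \(a\,e_{\mu,0}=\mu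 b\,e_{\mu,0}\) and \(a\,e_{\mu,j}=\mu b\,e_{\mu,j}+b\,e_{\mu,j-1}\) for \(j\ge1\), and let \(\Xi_{X,\Lambda}^{(N)}\) be the analogous sheaf over \(\mathcal O_X[[b]]\), whose sections are the holomorphic maps to \(\Xi_\Lambda^{(N)}\). For \(\lambda\in\,]0,1]\cap\mathbb Q\), a \([\lambda]\)-primitive theme of rank \(k\) is an \((a,b)\)-module of rank \(k\) isomorphic to \(\tilde{\mathcal A}\varphi\subset\Xi_{\{\lambda\}}^{(N)}\) for some \(N\) and some \(\varphi\in\Xi_{\{\lambda\}}^{(N)}\). A submodule \(F\) of \(E\) stable by \(a\) is normal if \(F\cap bE=bF\). A \([\lambda]\)-primitive theme \(E\) of rank \(k\) has for each \(j\in[0,k]\) exactly one normal submodule \(F_j\) of rank \(j\), and \(F_{j-1}\subset F_j\). Its fundamental invariants \(\lambda_1\in\mathbb Q\), \(p_1,\dots,p_{k-1}\in\mathbb N\) are defined by \(F_j/F_{j-1}\simeq E_{\lambda_j}\) for \(1\le j\le k\), where \(\lambda_{j+1}=\lambda_j+p_j-1\) and \(E_\mu=\mathbb C[[b]]e\) with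 \(ae=\mu b e\). If \(k=2\) and \(p_1\ge1\), the parameter of \(E\) is the unique \(\alpha\in\mathbb C^*\) with \(E\simeq\tilde{\mathcal A}/\tilde{\mathcal A}\,(a-\lambda_1b)(1+\alpha b^{p_1})^{-1}(a-(\lambda_1+p_1-1)b)\). A holomorphic map \(\varphi:U\to\Xi_\Lambda^{(N)}\) is \(k\)-thematic if the sheaf \(\mathbb E_\varphi\) of \(\mathcal O_U[[b]]\)-submodules of \(\Xi_{U,\Lambda}^{(N)}\) generated by the \(a^\nu\varphi\), \(\nu\ge0\), is free with basis \(\varphi,a\varphi,\dots,a^{k-1}\varphi\). An \(\mathcal O_X\)-\((a,b)\)-module \(\mathbb E\) is a holomorphic family of rank \(k\) themes if each point of \(X\) has an open neighbourhood \(U\) with a finite set \(\Lambda\subset\,]0,1]\cap\mathbb Q\) and a \(k\)-thematic holomorphic map \(\varphi:U\to\Xi_\Lambda^{(k-1)}\) such that \(\mathbb E|_U\simeq\mathbb E_\varphi\) as sheaves of \(\mathcal O_U\)-\((a,b)\)-modules. **Theorem.** Let \(k\ge2\), let \(\lambda\in\,]0,1]\cap\mathbb Q\), and let \(\mathbb E\)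 be an \(\mathcal O_X\)-\((a,b)\)-module on \(X\) such that all the fibres \(E(x)\), \(x\in X\), are \([\lambda]\)-primitive themes of rank \(k\) with the same fundamental invariants \(\lambda_1,p_1,\dots,p_{k-1}\). Suppose first that \(p_{k-1}\ge1\), and let \(\alpha(x)\in\mathbb C^*\) be the parameter of the rank \(2\) \([\lambda]\)-primitive theme \(E(x)/F_{k-2}(x)\), whose fundamental invariants are \(\lambda_{k-1},p_{k-1}\). (This parameter exists and is unique for each \(x\).) Then \(\mathbb E\) is a holomorphic family of rank \(k\) themes if and only if the following two conditions hold: 1. the family \(F_{k-1}(x)\), \(x\in X\), is holomorphic, i.e. there is an \(\mathcal O_X\)-\((a,b)\)-submodule \(\mathbb F_{k-1}\) of \(\mathbb E\) which is a holomorphic family of rank \(k-1\) themes and takes the value \(F_{k-1}(x)\) at each \(x\in X\) (the natural map from the fibre of \(\mathbb F_{k-1}\) at \(x\) to \(E(x)\) is injective with image \(F_{k-1}(x)\)); 2. the function \(\alpha:X\to\mathbb C^*\) is holomorphic on \(X\). If \(p_{k-1}=0\), where no parameter is defined, \(\mathbb E\) is a holomorphic family of rank \(k\) themes if and only if condition 1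 holds. -/

import Mathlib

open TopologicalSpace PowerSeries

universe u v w

noncomputable section

/-! ### Reduced complex spaces -/

/-- `A` is a (closed) analytic subset of the open set `W ⊆ ℂⁿ`: near each point of `W` it is the
set of common zeros of finitely many holomorphic functions. -/
def IsAnalyticSubset {n : ℕ} (W A : Set (Fin n → ℂ)) : Prop :=
  IsOpen W ∧ A ⊆ W ∧ ∀ z ∈ W, ∃ V : Set (Fin n → ℂ), IsOpen V ∧ z ∈ V ∧ V ⊆ W ∧
    ∃ (m : ℕ) (f : Fin m → (Fin n → ℂ) → ℂ), (∀ i, DifferentiableOn ℂ (f i) V) ∧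
      A ∩ V = {w | w ∈ V ∧ ∀ i, f i w = 0}

/-- The structure of a reduced complex space on a topological space: a sheaf `hol` of
`ℂ`-algebras of complex valued functions (the holomorphic functions) which is locally
isomorphic to an analytic subset `A` of an open set of some `ℂⁿ` with the sheaf of functions
that are locally restrictions of holomorphic functions of the ambient space. -/
class ReducedComplexSpace (X : Type u) [TopologicalSpace X] where
  hol : ∀ U : Opens X, Subalgebra ℂ (U → ℂ)
  hol_res : ∀ {U V : Opens X} (h : V ≤ U) (f : U → ℂ), f ∈ hol U →
    (fun y : V => f ⟨y.1, h y.2⟩) ∈ hol V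
  hol_glue : ∀ (U : Opens X) (f : U → ℂ),
    (∀ x ∈ U, ∃ (V : Opens X) (h : V ≤ U), x ∈ V ∧ (fun y : V => f ⟨y.1, h y.2⟩) ∈ hol V) →
      f ∈ hol U
  local_model : ∀ x : X, ∃ U : Opens X, x ∈ U ∧
    ∃ (n : ℕ) (W A : Set (Fin n → ℂ)), IsAnalyticSubset W A ∧ ∃ e : U ≃ₜ A,
      ∀ (V : Opens X) (h : V ≤ U) (f : V → ℂ), f ∈ hol V ↔
        ∀ y : V, ∃ (B : Set (Fin n → ℂ)) (g : (Fin n → ℂ) → ℂ), IsOpen B ∧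
          (e ⟨y.1, h y.2⟩ : Fin n → ℂ) ∈ B ∧ DifferentiableOn ℂ g B ∧
          ∀ y' : V, (e ⟨y'.1, h y'.2⟩ : Fin n → ℂ) ∈ B → f y' = g (e ⟨y'.1, h y'.2⟩)

section Holomorphic

variable {X : Type u} [TopologicalSpace X] [ReducedComplexSpace X]

/-- The `ℂ`-algebra `𝒪_X(U)` of holomorphic functions on `U`. Since `𝒪_X` is a sheaf, so is
`U ↦ 𝒪_X(U)[[b]]`; the variable `b` is `PowerSeries.X`. -/
abbrev HolFun (U : Opens X) : Type u := ReducedComplexSpace.hol U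

/-- Restriction of holomorphic functions. -/
def HolFun.res {U V : Opens X} (h : V ≤ U) : HolFun U →ₐ[ℂ] HolFun V where
  toFun f := ⟨fun y => f.1 ⟨y.1, h y.2⟩, ReducedComplexSpace.hol_res h f.1 f.2⟩
  map_one' := rfl
  map_mul' _ _ := rfl
  map_zero' := rfl
  map_add' _ _ := rfl
  commutes' _ := rfl

/-- Evaluation of holomorphic functions at a point. -/
def HolFun.eval {U : Opens X} {x : X} (hx : x ∈ U) : HolFun U →ₐ[ℂ] ℂ where
  toFun f := f.1 ⟨x, hx⟩
  map_one' := rfl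
  map_mul' _ _ := rfl
  map_zero' := rfl
  map_add' _ _ := rfl
  commutes' _ := rfl

/-- A function `X → ℂ` is holomorphic on `X`. -/
def IsHolomorphicFun (f : X → ℂ) : Prop :=
  (fun y : (⊤ : Opens X) => f y.1) ∈ ReducedComplexSpace.hol (⊤ : Opens X)

end Holomorphic

/-! ### The operator `a` on `R[[b]]`-modules -/

/-- An additive operator `a` on an `R[[b]]`-module with `a (S m) = S (a m) + b² S' m` for all
`S ∈ R[[b]]`. For an operator which is `R`-linear and continuous for the `b`-adic topology this
is the commutation relation `a b - b a = b²`; conversely the formula contains the `R`-linearity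
(`S` constant), the commutation relation (`S = b`) and the continuity (`S = bⁿ`). -/
class ABAction (R : Type*) [CommRing R] (M : Type*) [AddCommGroup M] [Module R⟦X⟧ M] where
  a : M →+ M
  a_smul : ∀ (S : R⟦X⟧) (m : M), a (S • m) = S • a m + ((X : R⟦X⟧) ^ 2 * derivative R S) • m

/-- The operator `a` of `M`. -/
def aOp (R : Type*) [CommRing R] {M : Type*} [AddCommGroup M] [Module R⟦X⟧ M] [ABAction R M] :
    M →+ M := ABAction.a R

section ABModules

variable {R : Type*} [CommRing R]

theorem aOp_smul {M : Type*} [AddCommGroup M] [Module R⟦X⟧ M] [ABAction R M] (S : R⟦X⟧) (m : M) :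
    aOp R (S • m) = S • aOp R m + ((X : R⟦X⟧) ^ 2 * derivative R S) • m :=
  ABAction.a_smul S m

/-- `R[[b]]`-submodules stable by `a`. -/
structure ABSubmodule (R : Type*) [CommRing R] (M : Type*) [AddCommGroup M] [Module R⟦X⟧ M]
    [ABAction R M] extends Submodule R⟦X⟧ M where
  a_mem : ∀ m ∈ carrier, aOp R m ∈ carrier

variable {M : Type*} [AddCommGroup M] [Module R⟦X⟧ M] [ABAction R M]

instance ABSubmodule.instSub (F : ABSubmodule R M) : ABAction R F.toSubmodule where
  a := { toFun := fun m => ⟨aOp R m.1, F.a_mem m.1 m.2⟩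
         map_zero' := Subtype.ext (map_zero (aOp R))
         map_add' := fun _ _ => Subtype.ext (map_add (aOp R) _ _) }
  a_smul S m := Subtype.ext (aOp_smul S m.1)

instance ABSubmodule.instQuot (F : ABSubmodule R M) : ABAction R (M ⧸ F.toSubmodule) where
  a := QuotientAddGroup.map F.toSubmodule.toAddSubgroup F.toSubmodule.toAddSubgroup (aOp R)
    (fun m hm => F.a_mem m hm)
  a_smul S m := by
    induction m using Submodule.Quotient.induction_on with
    | _ m => exact congrArg (Submodule.Quotient.mk (p := F.toSubmodule)) (aOp_smul S m)

/-- `F ∩ G`, as a submodule of `G`. -/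
def ABSubmodule.inside (F G : ABSubmodule R M) : ABSubmodule R G.toSubmodule where
  toSubmodule := F.toSubmodule.comap G.toSubmodule.subtype
  a_mem m hm := F.a_mem m.1 hm

/-- The submodule generated by `m`, that is the `R[[b]]`-submodule generated by the `aⁿ m`. -/
def ABSubmodule.gen (m : M) : ABSubmodule R M where
  toSubmodule := Submodule.span R⟦X⟧ (Set.range fun n : ℕ => (aOp R)^[n] m)
  a_mem := by
    intro y hy
    change y ∈ Submodule.span R⟦X⟧ _ at hy
    change aOp R y ∈ Submodule.span R⟦X⟧ _
    induction hy using Submodule.span_induction with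
    | mem y hy =>
      obtain ⟨n, rfl⟩ := hy
      refine Submodule.subset_span ⟨n + 1, ?_⟩
      exact Function.iterate_succ_apply' _ _ _
    | zero => rw [map_zero]; exact Submodule.zero_mem _
    | add y z _ _ hy hz => rw [map_add]; exact Submodule.add_mem _ hy hz
    | smul S y hy0 hy =>
      rw [aOp_smul]
      exact Submodule.add_mem _ (Submodule.smul_mem _ _ hy) (Submodule.smul_mem _ _ hy0)

/-- `F` is normal in `M`: `F ∩ b M = b F`, i.e. `M ⧸ F` has no `b`-torsion. -/
def ABSubmodule.IsNormal (F : ABSubmodule R M) : Prop :=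
  ∀ m : M, (X : R⟦X⟧) • m ∈ F.toSubmodule → m ∈ F.toSubmodule

/-- `M` and `M'` are isomorphic: there is an `R[[b]]`-linear bijection which commutes with `a`. -/
def ABIso (R : Type*) [CommRing R] (M M' : Type*) [AddCommGroup M] [Module R⟦X⟧ M] [ABAction R M]
    [AddCommGroup M'] [Module R⟦X⟧ M'] [ABAction R M'] : Prop :=
  ∃ θ : M ≃ₗ[R⟦X⟧] M', ∀ m, θ (aOp R m) = aOp R (θ m)

/-- The rank one (a,b)-module `E_μ = ℂ[[b]] e` with `a e = μ b e`. -/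
def ELam (_μ : ℚ) : Type := ℂ⟦X⟧

instance (μ : ℚ) : AddCommGroup (ELam μ) := inferInstanceAs (AddCommGroup ℂ⟦X⟧)
instance (μ : ℚ) : Module ℂ⟦X⟧ (ELam μ) := inferInstanceAs (Module ℂ⟦X⟧ ℂ⟦X⟧)

/-- `S e ↦ a (S e) = (b² S' + μ b S) e`. -/
def ELam.a (μ : ℚ) : ℂ⟦X⟧ →+ ℂ⟦X⟧ where
  toFun S := (X : ℂ⟦X⟧) ^ 2 * derivative ℂ S + C (μ : ℂ) * X * S
  map_zero' := by simp
  map_add' S T := by rw [map_add]; ring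

theorem ELam.a_mul (μ : ℚ) (S T : ℂ⟦X⟧) :
    ELam.a μ (S * T) = S * ELam.a μ T + ((X : ℂ⟦X⟧) ^ 2 * derivative ℂ S) * T := by
  change (X : ℂ⟦X⟧) ^ 2 * derivative ℂ (S * T) + C (μ : ℂ) * X * (S * T) =
      S * ((X : ℂ⟦X⟧) ^ 2 * derivative ℂ T + C (μ : ℂ) * X * T) +
      ((X : ℂ⟦X⟧) ^ 2 * derivative ℂ S) * T
  rw [Derivation.leibniz, smul_eq_mul, smul_eq_mul]; ring

instance (μ : ℚ) : ABAction ℂ (ELam μ) where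
  a := ELam.a μ
  a_smul S T := ELam.a_mul μ S T

end ABModules

/-! ### The modules `Ξ_Λ^(N)` and themes -/

section Xi

/-- `Ξ_Λ^(N)` with coefficients in `R`: the free `R[[b]]`-module with basis `e_{l,j}`, for `l ∈ Λ`
and `0 ≤ j ≤ N`. -/
def Xi (R : Type w) (Λ : Finset ℚ) (N : ℕ) : Type w := Λ → Fin (N + 1) → R⟦X⟧

variable {R : Type*} [CommRing R] {Λ : Finset ℚ} {N : ℕ}

instance : AddCommGroup (Xi R Λ N) := inferInstanceAs (AddCommGroup (Λ → Fin (N + 1) → R⟦X⟧))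
instance : Module R⟦X⟧ (Xi R Λ N) := inferInstanceAs (Module R⟦X⟧ (Λ → Fin (N + 1) → R⟦X⟧))

/-- The operator `a` of `Ξ_Λ^(N)`: it is determined by `a e_{l,0} = l b e_{l,0}` and
`a e_{l,j} = l b e_{l,j} + b e_{l,j-1}` for `j ≥ 1`. -/
instance [Algebra ℂ R] : ABAction R (Xi R Λ N) where
  a := { toFun := fun s : Λ → Fin (N + 1) → R⟦X⟧ => fun l j =>
           (X : R⟦X⟧) ^ 2 * derivative R (s l j) + C (algebraMap ℂ R ((l : ℚ) : ℂ)) * X * s l j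
            + (if h : j.1 + 1 < N + 1 then X * s l ⟨j.1 + 1, h⟩ else 0)
         map_zero' := by
          funext l j
          change (X : R⟦X⟧) ^ 2 * derivative R (0 : R⟦X⟧) + C (algebraMap ℂ R ((l : ℚ) : ℂ)) * X * 0
            + (if h : j.1 + 1 < N + 1 then X * (0 : R⟦X⟧) else 0) = 0
          simp
         map_add' := fun s t => by
          funext l j
          change (X : R⟦X⟧) ^ 2 * derivative R (s l j + t l j) +
              C (algebraMap ℂ R ((l : ℚ) : ℂ)) * X * (s l j + t l j)
            + (if h : j.1 + 1 < N + 1 then X * (s l ⟨j.1 + 1, h⟩ + t l ⟨j.1 + 1, h⟩) else 0) =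
            ((X : R⟦X⟧) ^ 2 * derivative R (s l j) + C (algebraMap ℂ R ((l : ℚ) : ℂ)) * X * s l j
            + (if h : j.1 + 1 < N + 1 then X * s l ⟨j.1 + 1, h⟩ else 0)) +
            ((X : R⟦X⟧) ^ 2 * derivative R (t l j) + C (algebraMap ℂ R ((l : ℚ) : ℂ)) * X * t l j
            + (if h : j.1 + 1 < N + 1 then X * t l ⟨j.1 + 1, h⟩ else 0))
          rw [map_add]
          split_ifs <;> ring }
  a_smul S s := by
    funext l j
    change (X : R⟦X⟧) ^ 2 * derivative R (S * s l j) +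
        C (algebraMap ℂ R ((l : ℚ) : ℂ)) * X * (S * s l j)
      + (if h : j.1 + 1 < N + 1 then X * (S * s l ⟨j.1 + 1, h⟩) else 0) =
      S * ((X : R⟦X⟧) ^ 2 * derivative R (s l j) + C (algebraMap ℂ R ((l : ℚ) : ℂ)) * X * s l j
      + (if h : j.1 + 1 < N + 1 then X * s l ⟨j.1 + 1, h⟩ else 0)) +
      ((X : R⟦X⟧) ^ 2 * derivative R S) * s l j
    rw [Derivation.leibniz]; simp only [smul_eq_mul]
    split_ifs <;> ring

/-- Extension of scalars in `Ξ_Λ^(N)`. -/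
def Xi.map {R' : Type*} [CommRing R'] [Algebra ℂ R] [Algebra ℂ R'] (f : R →ₐ[ℂ] R')
    (s : Xi R Λ N) : Xi R' Λ N :=
  fun l j => PowerSeries.map f.toRingHom (s l j)

end Xi

section Themes

variable (E : Type*) [AddCommGroup E] [Module ℂ⟦X⟧ E] [ABAction ℂ E]

/-- `E` is a `[lam]`-primitive theme of rank `k`: it has rank `k` and is isomorphic to the
submodule of some `Ξ_lam^(N)` generated by one element. -/
def IsPrimitiveTheme (lam : ℚ) (k : ℕ) : Prop :=
  Module.finrank ℂ⟦X⟧ E = k ∧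
    ∃ (N : ℕ) (φ : Xi ℂ {lam} N), ABIso ℂ E (ABSubmodule.gen (R := ℂ) φ).toSubmodule

/-- `λ_j = λ_1 + (p_1 - 1) + ⋯ + (p_{j-1} - 1)` for `j ≥ 1`, so that
`λ_{j+1} = λ_j + p_j - 1`. -/
def lamInv (lam₁ : ℚ) (p : ℕ → ℕ) (j : ℕ) : ℚ :=
  lam₁ + ∑ i ∈ Finset.Ico 1 j, ((p i : ℚ) - 1)

variable {E} in
/-- `F` is a normal submodule of rank `j` of `E`. (A `[λ]`-primitive theme of rank `k` has exactly
one for each `j ≤ k`; it is denoted by `F_j`.) -/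
def ABSubmodule.IsNormalOfRank (F : ABSubmodule ℂ E) (j : ℕ) : Prop :=
  F.IsNormal ∧ Module.finrank ℂ⟦X⟧ F.toSubmodule = j

/-- `λ_1, p_1, …, p_{k-1}` are the fundamental invariants of the rank `k` `[λ]`-primitive theme
`E`: with the normal submodules `0 = F_0 ⊆ F_1 ⊆ ⋯ ⊆ F_k = E`, `F_j` of rank `j`, the
quotient `F_j / F_{j-1}` is isomorphic to `E_{λ_j}`. -/
def HasInvariants (k : ℕ) (lam₁ : ℚ) (p : ℕ → ℕ) : Prop :=
  ∃ F : ℕ → ABSubmodule ℂ E, (∀ j ≤ k, (F j).IsNormalOfRank j) ∧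
    (F k).toSubmodule = ⊤ ∧
    ∀ j < k, (F j).toSubmodule ≤ (F (j + 1)).toSubmodule ∧
      ABIso ℂ ((F (j + 1)).toSubmodule ⧸ ((F j).inside (F (j + 1))).toSubmodule)
        (ELam (lamInv lam₁ p (j + 1)))

/-- `α ∈ ℂ^*` is the parameter of `E` (for the fundamental invariants `lam₁` and `p ≥ 1`), i.e.
`E` is isomorphic to `𝒜 / 𝒜 P` with `P = (a - λ₁ b) (1 + α b^p)⁻¹ (a - (λ₁ + p - 1) b)` (where `𝒜`
is the `b`-completion of `ℂ⟨a, b⟩ / (a b - b a - b²)`): `E` is free of rank two over `ℂ[[b]]`, as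
`𝒜 / 𝒜 P` is, and has a generator `e` which is annihilated by `P`. -/
def IsParameter (lam₁ : ℚ) (p : ℕ) (α : ℂ) : Prop :=
  α ≠ 0 ∧ Module.Free ℂ⟦X⟧ E ∧ Module.finrank ℂ⟦X⟧ E = 2 ∧
    ∃ e : E, (ABSubmodule.gen (R := ℂ) e).toSubmodule = ⊤ ∧
      ∃ e₁ : E, e₁ = (1 + C α * X ^ p : ℂ⟦X⟧)⁻¹ •
          (aOp ℂ e - (C ((lam₁ + p - 1 : ℚ) : ℂ) * X : ℂ⟦X⟧) • e) ∧
        aOp ℂ e₁ - (C (lam₁ : ℂ) * X : ℂ⟦X⟧) • e₁ = 0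

end Themes

/-! ### Sheaves of `𝒪_X`-(a,b)-modules and their fibres -/

section Sheaves

/-- A sheaf of `𝒪_X`-(a,b)-modules: a sheaf of `𝒪_X[[b]]`-modules with an operator `a`, which is
locally free of finite type over `𝒪_X[[b]]`. -/
structure ABSheaf (X : Type u) [TopologicalSpace X] [ReducedComplexSpace X] where
  /-- the sections over an open set -/
  sec : Opens X → Type v
  [grp : ∀ U, AddCommGroup (sec U)]
  [mod : ∀ U, Module (HolFun U)⟦X⟧ (sec U)]
  [ab : ∀ U, ABAction (HolFun U) (sec U)]
  /-- the restriction maps -/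
  res : ∀ {U V : Opens X}, V ≤ U → sec U →+ sec V
  res_smul : ∀ {U V : Opens X} (h : V ≤ U) (S : (HolFun U)⟦X⟧) (s : sec U),
    res h (S • s) = PowerSeries.map (HolFun.res h).toRingHom S • res h s
  res_a : ∀ {U V : Opens X} (h : V ≤ U) (s : sec U),
    res h (aOp (HolFun U) s) = aOp (HolFun V) (res h s)
  res_self : ∀ {U : Opens X} (s : sec U), res le_rfl s = s
  res_res : ∀ {U V W : Opens X} (h : V ≤ U) (h' : W ≤ V) (s : sec U),
    res h' (res h s) = res (h'.trans h) s
  eq_zero_of_local : ∀ {U : Opens X} (s : sec U),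
    (∀ x ∈ U, ∃ (V : Opens X) (h : V ≤ U), x ∈ V ∧ res h s = 0) → s = 0
  glue : ∀ {ι : Type u} (U : ι → Opens X) (s : ∀ i, sec (U i)),
    (∀ i j, res (inf_le_left : U i ⊓ U j ≤ U i) (s i) = res inf_le_right (s j)) →
      ∃ t : sec (iSup U), ∀ i, res (le_iSup U i) t = s i
  locally_free : ∀ x : X, ∃ U : Opens X, x ∈ U ∧ ∃ (n : ℕ) (e : Fin n → sec U),
    ∀ (V : Opens X) (h : V ≤ U) (s : sec V),
      ∃! c : Fin n → (HolFun V)⟦X⟧, s = ∑ i, c i • res h (e i)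

attribute [instance] ABSheaf.grp ABSheaf.mod ABSheaf.ab

variable {X : Type u} [TopologicalSpace X] [ReducedComplexSpace X]

namespace ABSheaf

variable (E : ABSheaf.{u, v} X)

/-- The constants `ℂ[[b]] → 𝒪_X(U)[[b]]`. -/
def constSeries (U : Opens X) : ℂ⟦X⟧ →+* (HolFun U)⟦X⟧ :=
  PowerSeries.map (algebraMap ℂ (HolFun U))

instance modC (U : Opens X) : Module ℂ⟦X⟧ (E.sec U) := Module.compHom _ (constSeries U)

theorem modC_smul {U : Opens X} (S : ℂ⟦X⟧) (s : E.sec U) : S • s = constSeries U S • s := rfl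

/-- Restriction, as a `ℂ[[b]]`-linear map. -/
def resC {U V : Opens X} (h : V ≤ U) : E.sec U →ₗ[ℂ⟦X⟧] E.sec V where
  toFun := E.res h
  map_add' := map_add _
  map_smul' S s := by
    rw [modC_smul, modC_smul, E.res_smul, RingHom.id_apply]
    congr 1

/-- The open neighbourhoods of `x`, ordered by reverse inclusion. -/
@[ext]
structure Nhd (x : X) where
  U : Opens X
  mem : x ∈ U

instance (x : X) : Preorder (Nhd x) where
  le A B := B.U ≤ A.U
  le_refl A := le_refl A.U
  le_trans _ _ _ h h' := le_trans h' h

instance (x : X) : IsDirectedOrder (Nhd x) :=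
  ⟨fun A B => ⟨⟨A.U ⊓ B.U, A.mem, B.mem⟩, (inf_le_left : A.U ⊓ B.U ≤ A.U),
    (inf_le_right : A.U ⊓ B.U ≤ B.U)⟩⟩

instance (x : X) : Nonempty (Nhd x) := ⟨⟨⊤, trivial⟩⟩

/-- The sections over a neighbourhood of `x`. -/
abbrev nhdSec (x : X) (A : Nhd x) : Type v := E.sec A.U

/-- The transition maps between sections over neighbourhoods of `x`. -/
abbrev nhdRes (x : X) (A B : Nhd x) (h : A ≤ B) : E.nhdSec x A →ₗ[ℂ⟦X⟧] E.nhdSec x B :=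
  E.resC (show B.U ≤ A.U from h)

instance (x : X) : DirectedSystem (E.nhdSec x) (E.nhdRes x · · ·) where
  map_self _ s := E.res_self s
  map_map _ _ _ _ _ s := E.res_res _ _ s

/-- The stalk of `E` at `x`. -/
abbrev Stalk (x : X) : Type (max u v) := DirectLimit (E.nhdSec x) (E.nhdRes x)

/-- The germ at `x` of a section. -/
def germ {x : X} {U : Opens X} (hx : x ∈ U) (s : E.sec U) : E.Stalk x :=
  Quotient.mk _ ⟨⟨U, hx⟩, s⟩

theorem exists_germ {x : X} (z : E.Stalk x) :
    ∃ (U : Opens X) (hx : x ∈ U) (s : E.sec U), z = E.germ hx s := by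
  obtain ⟨i, s, rfl⟩ := DirectLimit.exists_eq_mk _ z
  exact ⟨i.U, i.mem, s, rfl⟩

theorem germ_add {x : X} {U : Opens X} (hx : x ∈ U) (s t : E.sec U) :
    E.germ hx (s + t) = E.germ hx s + E.germ hx t := by
  have h := DirectLimit.add_def (G := E.nhdSec x) (f := E.nhdRes x) (⟨U, hx⟩ : Nhd x) s t
  exact h.symm

theorem germ_smul {x : X} {U : Opens X} (hx : x ∈ U) (S : ℂ⟦X⟧) (s : E.sec U) :
    E.germ hx (S • s) = S • E.germ hx s := rfl

theorem constSeries_derivative (U : Opens X) (S : ℂ⟦X⟧) :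
    constSeries U ((PowerSeries.X : ℂ⟦X⟧) ^ 2 * derivative ℂ S) =
      (PowerSeries.X : (HolFun U)⟦X⟧) ^ 2 * derivative (HolFun U) (constSeries U S) := by
  have hX : constSeries U (PowerSeries.X : ℂ⟦X⟧) = PowerSeries.X := PowerSeries.map_X _
  have hd : constSeries U (derivative ℂ S) = derivative (HolFun U) (constSeries U S) := by
    refine PowerSeries.ext fun n => ?_
    rw [constSeries, coeff_map, coeff_derivative, coeff_derivative, coeff_map, map_mul, map_add,
      map_natCast, map_one]
  rw [map_mul, map_pow, hX, hd]

theorem aOp_const_smul {U : Opens X} (S : ℂ⟦X⟧) (s : E.sec U) :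
    aOp (HolFun U) (S • s) =
      S • aOp (HolFun U) s + ((PowerSeries.X : ℂ⟦X⟧) ^ 2 * derivative ℂ S) • s := by
  rw [modC_smul, aOp_smul, modC_smul, modC_smul, constSeries_derivative]

/-- The operator `a` on the stalk: `a` of a germ is the germ of `a`. -/
def stalkA (x : X) : E.Stalk x → E.Stalk x :=
  DirectLimit.map (E.nhdRes x) (E.nhdRes x) (fun A => aOp (HolFun A.U))
    (fun _ _ _ s => E.res_a _ s)

theorem stalkA_germ {x : X} {U : Opens X} (hx : x ∈ U) (s : E.sec U) :
    E.stalkA x (E.germ hx s) = E.germ hx (aOp (HolFun U) s) := rfl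

theorem exists_germ₂ {x : X} (z z' : E.Stalk x) :
    ∃ (U : Opens X) (hx : x ∈ U) (s s' : E.sec U), z = E.germ hx s ∧ z' = E.germ hx s' := by
  obtain ⟨i, s, s', rfl, rfl⟩ := DirectLimit.exists_eq_mk₂ _ z z'
  exact ⟨i.U, i.mem, s, s', rfl, rfl⟩

theorem stalkA_add {x : X} (z z' : E.Stalk x) :
    E.stalkA x (z + z') = E.stalkA x z + E.stalkA x z' := by
  obtain ⟨U, hx, s, s', rfl, rfl⟩ := E.exists_germ₂ z z'
  rw [← germ_add, stalkA_germ, stalkA_germ, stalkA_germ, map_add, germ_add]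

theorem stalkA_smul {x : X} (S : ℂ⟦X⟧) (z : E.Stalk x) :
    E.stalkA x (S • z) =
      S • E.stalkA x z + ((PowerSeries.X : ℂ⟦X⟧) ^ 2 * derivative ℂ S) • z := by
  obtain ⟨U, hx, s, rfl⟩ := E.exists_germ z
  rw [← germ_smul, stalkA_germ, stalkA_germ, aOp_const_smul, germ_add, germ_smul, germ_smul]

instance stalkAB (x : X) : ABAction ℂ (E.Stalk x) where
  a := AddMonoidHom.mk' (E.stalkA x) E.stalkA_add
  a_smul S z := E.stalkA_smul S z

theorem aOp_germ {x : X} {U : Opens X} (hx : x ∈ U) (s : E.sec U) :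
    aOp ℂ (E.germ hx s) = E.germ hx (aOp (HolFun U) s) := rfl

/-- The submodule `ℳ_x[[b]] E` of the stalk of `E` at `x`, generated by the products `S s` where
all coefficients of the power series `S` vanish at `x`. -/
def maxIdealMul (x : X) : ABSubmodule ℂ (E.Stalk x) where
  toSubmodule := Submodule.span ℂ⟦X⟧ {z | ∃ (U : Opens X) (hx : x ∈ U) (S : (HolFun U)⟦X⟧)
    (s : E.sec U), (∀ n, HolFun.eval hx (coeff n S) = 0) ∧ z = E.germ hx (S • s)}
  a_mem := by
    intro z hz
    change z ∈ Submodule.span ℂ⟦X⟧ _ at hz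
    change aOp ℂ z ∈ Submodule.span ℂ⟦X⟧ _
    induction hz using Submodule.span_induction with
    | mem z hz =>
      obtain ⟨U, hx, S, s, hS, rfl⟩ := hz
      rw [aOp_germ, aOp_smul, germ_add]
      refine Submodule.add_mem _ (Submodule.subset_span ⟨U, hx, S, _, hS, rfl⟩)
        (Submodule.subset_span ⟨U, hx, _, s, fun n => ?_, rfl⟩)
      rw [coeff_X_pow_mul']
      split_ifs
      · rw [coeff_derivative, map_mul, hS, zero_mul]
      · exact map_zero _
    | zero => rw [map_zero]; exact Submodule.zero_mem _
    | add y z _ _ hy hz => rw [map_add]; exact Submodule.add_mem _ hy hz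
    | smul S y hy0 hy =>
      rw [aOp_smul]
      exact Submodule.add_mem _ (Submodule.smul_mem _ _ hy) (Submodule.smul_mem _ _ hy0)

/-- The fibre `E(x) = E / ℳ_x[[b]] E`. -/
abbrev Fibre (x : X) : Type (max u v) := E.Stalk x ⧸ (E.maxIdealMul x).toSubmodule

/-- The value at `x` of a section. -/
def value {x : X} {U : Opens X} (hx : x ∈ U) (s : E.sec U) : E.Fibre x :=
  Submodule.Quotient.mk (E.germ hx s)

/-- An `𝒪_X`-(a,b)-submodule of `E`: a subsheaf of `𝒪_X[[b]]`-submodules which is stable by `a`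
and locally free of finite type. -/
structure Sub where
  carrier : ∀ U : Opens X, ABSubmodule (HolFun U) (E.sec U)
  res_mem : ∀ {U V : Opens X} (h : V ≤ U) (s : E.sec U), s ∈ (carrier U).toSubmodule →
    E.res h s ∈ (carrier V).toSubmodule
  mem_of_local : ∀ {U : Opens X} (s : E.sec U),
    (∀ x ∈ U, ∃ (V : Opens X) (h : V ≤ U), x ∈ V ∧ E.res h s ∈ (carrier V).toSubmodule) →
      s ∈ (carrier U).toSubmodule
  locally_free : ∀ x : X, ∃ U : Opens X, x ∈ U ∧
    ∃ (n : ℕ) (e : Fin n → (carrier U).toSubmodule),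
      ∀ (V : Opens X) (h : V ≤ U), ∀ s ∈ (carrier V).toSubmodule,
        ∃! c : Fin n → (HolFun V)⟦X⟧, s = ∑ i, c i • E.res h (e i)

variable {E}

/-- An `𝒪_X`-(a,b)-submodule, as a sheaf of `𝒪_X`-(a,b)-modules. -/
def Sub.toABSheaf (F : E.Sub) : ABSheaf.{u, v} X where
  sec U := (F.carrier U).toSubmodule
  res {U V} h :=
    { toFun := fun s => ⟨E.res h s.1, F.res_mem h s.1 s.2⟩
      map_zero' := Subtype.ext (map_zero (E.res h))
      map_add' := fun _ _ => Subtype.ext (map_add (E.res h) _ _) }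
  res_smul h S s := Subtype.ext (E.res_smul h S s.1)
  res_a h s := Subtype.ext (E.res_a h s.1)
  res_self s := Subtype.ext (E.res_self s.1)
  res_res h h' s := Subtype.ext (E.res_res h h' s.1)
  eq_zero_of_local s hs := Subtype.ext <| E.eq_zero_of_local s.1 fun x hx => by
    obtain ⟨V, h, hxV, hV⟩ := hs x hx
    exact ⟨V, h, hxV, congrArg Subtype.val hV⟩
  glue U s hs := by
    obtain ⟨t, ht⟩ := E.glue U (fun i => (s i).1) fun i j => congrArg Subtype.val (hs i j)
    refine ⟨⟨t, F.mem_of_local t fun x hx => ?_⟩, fun i => Subtype.ext (ht i)⟩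
    obtain ⟨i, hi⟩ := Opens.mem_iSup.1 hx
    exact ⟨U i, le_iSup U i, hi, by rw [ht i]; exact (s i).2⟩
  locally_free x := by
    obtain ⟨U, hx, n, e, he⟩ := F.locally_free x
    refine ⟨U, hx, n, e, fun V h s => ?_⟩
    obtain ⟨c, hc, huniq⟩ := he V h s.1 s.2
    have key : ∀ c : Fin n → (HolFun V)⟦X⟧,
        ((∑ i, c i • (⟨E.res h (e i).1, F.res_mem h _ (e i).2⟩ : (F.carrier V).toSubmodule) :
          (F.carrier V).toSubmodule) : E.sec V) = ∑ i, c i • E.res h (e i).1 := by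
      intro c
      simp
    exact ⟨c, Subtype.ext (hc.trans (key c).symm),
      fun c' hc' => huniq c' ((congrArg Subtype.val hc').trans (key c'))⟩

/-- The submodule sheaf `F` of `E` takes the value `G ⊆ E(x)` at `x`: the natural map
`F(x) → E(x)` is injective and its image is `G`. -/
def Sub.TakesValue (F : E.Sub) (x : X) (G : ABSubmodule ℂ (E.Fibre x)) : Prop :=
  (∀ (U : Opens X) (hx : x ∈ U) (s : F.toABSheaf.sec U),
    E.value hx s.1 = 0 → F.toABSheaf.value hx s = 0) ∧
  ∀ z : E.Fibre x, z ∈ G.toSubmodule ↔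
    ∃ (U : Opens X) (hx : x ∈ U) (s : F.toABSheaf.sec U), E.value hx s.1 = z

end ABSheaf

/-! ### Thematic maps and holomorphic families -/

variable {Λ : Finset ℚ} {N : ℕ}

/-- Restriction of holomorphic maps with values in `Ξ_Λ^(N)`, i.e. of sections of the sheaf
`Ξ_{X,Λ}^(N)`. -/
def Xi.res {U V : Opens X} (h : V ≤ U) (s : Xi (HolFun U) Λ N) : Xi (HolFun V) Λ N :=
  Xi.map (HolFun.res h) s

theorem Xi.res_add {U V : Opens X} (h : V ≤ U) (s t : Xi (HolFun U) Λ N) :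
    Xi.res h (s + t) = Xi.res h s + Xi.res h t := by
  funext l j
  exact map_add (PowerSeries.map (HolFun.res h).toRingHom) (s l j) (t l j)

theorem Xi.res_zero {U V : Opens X} (h : V ≤ U) :
    Xi.res h (0 : Xi (HolFun U) Λ N) = 0 := by
  funext l j
  exact map_zero (PowerSeries.map (HolFun.res h).toRingHom)

theorem Xi.res_smul {U V : Opens X} (h : V ≤ U) (S : (HolFun U)⟦X⟧) (s : Xi (HolFun U) Λ N) :
    Xi.res h (S • s) = PowerSeries.map (HolFun.res h).toRingHom S • Xi.res h s := by
  funext l j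
  exact map_mul (PowerSeries.map (HolFun.res h).toRingHom) S (s l j)

theorem map_derivative' {R R' : Type*} [CommRing R] [CommRing R'] (f : R →+* R') (S : R⟦X⟧) :
    PowerSeries.map f (derivative R S) = derivative R' (PowerSeries.map f S) := by
  refine PowerSeries.ext fun n => ?_
  rw [coeff_map, coeff_derivative, coeff_derivative, coeff_map, map_mul, map_add,
    map_natCast, map_one]

theorem Xi.res_a {U V : Opens X} (h : V ≤ U) (s : Xi (HolFun U) Λ N) :
    Xi.res h (aOp (HolFun U) s) = aOp (HolFun V) (Xi.res h s) := by
  funext l j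
  change PowerSeries.map (HolFun.res h).toRingHom
      ((PowerSeries.X : (HolFun U)⟦X⟧) ^ 2 * derivative (HolFun U) (s l j)
        + C (algebraMap ℂ (HolFun U) ((l : ℚ) : ℂ)) * PowerSeries.X * s l j
        + (if h : j.1 + 1 < N + 1 then PowerSeries.X * s l ⟨j.1 + 1, h⟩ else 0)) =
    (PowerSeries.X : (HolFun V)⟦X⟧) ^ 2 *
        derivative (HolFun V) (PowerSeries.map (HolFun.res h).toRingHom (s l j))
      + C (algebraMap ℂ (HolFun V) ((l : ℚ) : ℂ)) * PowerSeries.X *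
        PowerSeries.map (HolFun.res h).toRingHom (s l j)
      + (if h' : j.1 + 1 < N + 1 then
          PowerSeries.X * PowerSeries.map (HolFun.res h).toRingHom (s l ⟨j.1 + 1, h'⟩) else 0)
  rw [map_add, map_add, map_mul, map_mul, map_mul, map_pow, map_X, map_C, map_derivative']
  congr 1
  split_ifs
  · rw [map_mul, map_X]
  · exact map_zero _

theorem Xi.res_gen {U V : Opens X} (h : V ≤ U) (φ s : Xi (HolFun U) Λ N)
    (hs : s ∈ (ABSubmodule.gen (R := HolFun U) φ).toSubmodule) :
    Xi.res h s ∈ (ABSubmodule.gen (R := HolFun V) (Xi.res h φ)).toSubmodule := by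
  change s ∈ Submodule.span (HolFun U)⟦X⟧ _ at hs
  change Xi.res h s ∈ Submodule.span (HolFun V)⟦X⟧ _
  induction hs using Submodule.span_induction with
  | mem s hs =>
    obtain ⟨n, rfl⟩ := hs
    refine Submodule.subset_span ⟨n, ?_⟩
    have hcomm : Function.Semiconj (Xi.res (Λ := Λ) (N := N) h)
        (aOp (HolFun U)) (aOp (HolFun V)) := Xi.res_a h
    exact ((hcomm.iterate_right n) φ).symm
  | zero => rw [Xi.res_zero]; exact Submodule.zero_mem _
  | add s t _ _ hs ht => rw [Xi.res_add]; exact Submodule.add_mem _ hs ht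
  | smul S s _ hs => rw [Xi.res_smul]; exact Submodule.smul_mem _ _ hs

theorem Xi.res_res {U V W : Opens X} (h : V ≤ U) (h' : W ≤ V) (s : Xi (HolFun U) Λ N) :
    Xi.res h' (Xi.res h s) = Xi.res (h'.trans h) s := by
  funext l j
  change PowerSeries.map _ (PowerSeries.map _ (s l j)) = PowerSeries.map _ (s l j)
  ext n
  simp only [coeff_map]
  rfl

/-- The sections over `V ≤ U` of the sheaf `𝔼_φ`, the sheaf of `𝒪[[b]]`-submodules of `Ξ_Λ^(N)`
generated on `U` by the `a^ν φ`. -/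
def sheafGen {U : Opens X} (φ : Xi (HolFun U) Λ N) {V : Opens X} (hV : V ≤ U) :
    Submodule (HolFun V)⟦X⟧ (Xi (HolFun V) Λ N) where
  carrier := {s | ∀ x ∈ V, ∃ (W : Opens X) (h : W ≤ V), x ∈ W ∧
    Xi.res h s ∈ (ABSubmodule.gen (R := HolFun W) (Xi.res (h.trans hV) φ)).toSubmodule}
  zero_mem' x hx := ⟨V, le_rfl, hx, by rw [Xi.res_zero]; exact Submodule.zero_mem _⟩
  add_mem' {s t} hs ht x hx := by
    obtain ⟨W₁, h₁, hx₁, hs⟩ := hs x hx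
    obtain ⟨W₂, h₂, hx₂, ht⟩ := ht x hx
    refine ⟨W₁ ⊓ W₂, inf_le_left.trans h₁, ⟨hx₁, hx₂⟩, ?_⟩
    rw [Xi.res_add]
    refine Submodule.add_mem _ ?_ ?_
    · have := Xi.res_gen (inf_le_left : W₁ ⊓ W₂ ≤ W₁) _ _ hs
      rwa [Xi.res_res, Xi.res_res] at this
    · have := Xi.res_gen (inf_le_right : W₁ ⊓ W₂ ≤ W₂) _ _ ht
      rwa [Xi.res_res, Xi.res_res] at this
  smul_mem' S s hs x hx := by
    obtain ⟨W, h, hxW, hs⟩ := hs x hx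
    refine ⟨W, h, hxW, ?_⟩
    rw [Xi.res_smul]
    exact Submodule.smul_mem _ _ hs

/-- The holomorphic map `φ : U → Ξ_Λ^(N)` is `k`-thematic: `𝔼_φ` is free over `𝒪[[b]]` with basis
`φ, a φ, …, a^(k-1) φ`. -/
def IsThematic (k : ℕ) {U : Opens X} (φ : Xi (HolFun U) Λ N) : Prop :=
  ∀ (V : Opens X) (hV : V ≤ U),
    LinearIndependent (HolFun V)⟦X⟧ (fun j : Fin k => (aOp (HolFun V))^[j.1] (Xi.res hV φ)) ∧
    Submodule.span (HolFun V)⟦X⟧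
      (Set.range fun j : Fin k => (aOp (HolFun V))^[j.1] (Xi.res hV φ)) = sheafGen φ hV

/-- The restriction of `E` to `U` is isomorphic to `𝔼_φ` as a sheaf of `𝒪_U`-(a,b)-modules. -/
def IsoSheafGen (E : ABSheaf.{u, v} X) {U : Opens X} (φ : Xi (HolFun U) Λ N) : Prop :=
  ∃ θ : ∀ (V : Opens X) (hV : V ≤ U), E.sec V ≃ₗ[(HolFun V)⟦X⟧] sheafGen φ hV,
    (∀ (V : Opens X) (hV : V ≤ U) (s : E.sec V),
      (θ V hV (aOp (HolFun V) s) : Xi (HolFun V) Λ N) = aOp (HolFun V) (θ V hV s).1) ∧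
    ∀ (V W : Opens X) (hV : V ≤ U) (h : W ≤ V) (s : E.sec V),
      (θ W (h.trans hV) (E.res h s) : Xi (HolFun W) Λ N) = Xi.res h (θ V hV s).1

/-- `E` is a holomorphic family of rank `k` themes (`k ≥ 1`). -/
def IsHolomorphicFamily (E : ABSheaf.{u, v} X) (k : ℕ) : Prop :=
  ∀ x : X, ∃ U : Opens X, x ∈ U ∧ ∃ Λ : Finset ℚ, (∀ l ∈ Λ, 0 < l ∧ l ≤ 1) ∧
    ∃ φ : Xi (HolFun U) Λ (k - 1), IsThematic k φ ∧ IsoSheafGen E φ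

/-- The family of the normal submodules `F_j(x) ⊆ E(x)` of rank `j` is holomorphic: there is an
`𝒪_X`-(a,b)-submodule `F` of `E` which is a holomorphic family of rank `j` themes and takes for
every `x` the value `F_j(x)`. -/
def HolomorphicNormalSub (E : ABSheaf.{u, v} X) (j : ℕ) : Prop :=
  ∃ F : E.Sub, IsHolomorphicFamily F.toABSheaf j ∧
    ∀ x : X, ∃ G : ABSubmodule ℂ (E.Fibre x), G.IsNormalOfRank j ∧ F.TakesValue x G

end Sheaves

end

set_option linter.unusedSectionVars false

/-! The hypotheses already force both sides of each equivalence: a family of [λ]-primitive themes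
with constant fundamental invariants is a holomorphic family, its normal submodules vary
holomorphically, and so does the parameter. All three facts come from one local object, a
holomorphic frame e_1, …, e_k with e_0 = 0 and a e_{j+1} = λ_{j+1} b e_{j+1} + S_j e_j, in which S_j
and its coefficient of b^{p_j} are invertible for 1 ≤ j < k, and which induces a frame of the same
kind in each fibre (`ABSheaf.exists_local_frame`).

In a single fibre, cyclicity and the quotients F_{j+1}/F_j ≃ E_{λ_{j+1}} give such a frame with S_j
invertible (`exists_frame_of_chain`). The embedding in Ξ, read one log degree at a time, makes the
coefficient of b^{p_j} nonzero and gives λ_1 - λ ∈ ℕ, at least k - 1 (`LogEmbedding.coeff_ne_zero`,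
`LogEmbedding.exists_shift`). These coefficients also force every normal submodule to be some span
of e_1, …, e_j.

Holomorphic dependence is the heart of the matter. A local section u with value w(x) e_j(x) at x,
w(x) a unit, satisfies a^j u = ∑_{l<j} d_l a^l u with holomorphic d_l. Hence w(x) is a solution of
A^j T = ∑ d_l A^l T, where A = b² ∂_b + λ_j b. The corresponding operator factors into first order
ones (`IsFrame.recOp_eq`), so it raises the b-adic order by j, and its leading coefficient on b^n is
nonzero for n ≥ 1 because λ_j - λ_i + (j - i) is a natural number. Thus w(x)/w(x)(0) is computed by
a recursion whose coefficients are holomorphic and whose divisors are invertible: it is holomorphic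
in x (`IsFibreFamily.exists_normalisation`). Dividing u by it gives e_j, and (a - λ_j b) e_j is the
section to treat next. The descent starts with a section whose values generate the fibres, which
exists near each point.

Given the frame, F_j is the sheaf spanned by e_1, …, e_j, and the parameter is the quotient of the
coefficients of b^{p_{k-1}} and b^0 in S_{k-1}. To see a thematic map, the same relations are solved
inside Ξ; the invertible coefficients of b^{p_j} make the solution triangular with respect to log
degree (`exists_xi_frame`), hence independent at every point, and the frame is sent to it. -/

noncomputable section

/-! ### The first order operator b² ∂_b + c b on power series. -/

section Euler

variable {R : Type*} [CommRing R]

/-- The operator `T ↦ b² T' + c b T` on `R[[b]]`. -/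
def euler (c : R) : R⟦X⟧ →ₗ[R] R⟦X⟧ where
  toFun T := (X : R⟦X⟧) ^ 2 * derivative R T + C c * X * T
  map_add' S T := by rw [map_add]; ring
  map_smul' r T := by
    rw [(derivative R).map_smul, RingHom.id_apply, smul_eq_C_mul, smul_eq_C_mul, smul_eq_C_mul]
    ring

theorem euler_apply (c : R) (T : R⟦X⟧) :
    euler c T = (X : R⟦X⟧) ^ 2 * derivative R T + C c * X * T := rfl

theorem coeff_zero_euler (c : R) (T : R⟦X⟧) : coeff 0 (euler c T) = 0 := by
  simp [euler_apply]

/-- The operator maps b^n to (n + c) b^{n+1}. The only obstruction to inverting it, apart from the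
constant term, is the resonant exponent n = -c; all later arguments compare coefficients there. -/
theorem coeff_succ_euler (c : R) (T : R⟦X⟧) (n : ℕ) :
    coeff (n + 1) (euler c T) = (n + c) * coeff n T := by
  have h : euler c T = X * (X * derivative R T + C c * T) := by rw [euler_apply]; ring
  rw [h, coeff_succ_X_mul, map_add, coeff_C_mul]
  cases n with
  | zero => simp
  | succ n => rw [coeff_succ_X_mul, coeff_derivative]; push_cast; ring

theorem euler_mul (c : R) (S T : R⟦X⟧) :
    euler c (S * T) = S * euler c T + ((X : R⟦X⟧) ^ 2 * derivative R S) * T := by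
  simp only [euler_apply]
  rw [Derivation.leibniz, smul_eq_mul, smul_eq_mul]; ring

theorem euler_sub (c d : R) (T : R⟦X⟧) : euler c T - C d * X * T = euler (c - d) T := by
  simp only [euler_apply, map_sub]; ring

theorem euler_zero_C (r : R) : euler 0 (C r) = 0 := by
  rw [euler_apply]
  simp

theorem map_euler {R' : Type*} [CommRing R'] (f : R →+* R') (c : R) (T : R⟦X⟧) :
    PowerSeries.map f (euler c T) = euler (f c) (PowerSeries.map f T) := by
  simp only [euler_apply, map_add, map_mul, map_pow, map_X, map_C, map_derivative']

theorem X_pow_dvd_euler (c : R) {n : ℕ} {T : R⟦X⟧} (h : X ^ n ∣ T) : X ^ (n + 1) ∣ euler c T := by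
  rw [X_pow_dvd_iff] at h ⊢
  intro m hm
  cases m with
  | zero => exact coeff_zero_euler c T
  | succ m => rw [coeff_succ_euler, h m (by omega), mul_zero]

theorem isUnit_series_iff {T : R⟦X⟧} : IsUnit T ↔ IsUnit (coeff 0 T) := by
  rw [PowerSeries.isUnit_iff_constantCoeff, coeff_zero_eq_constantCoeff_apply]

end Euler

/-! ### Spans of the last vectors of a sequence. -/

section TopSpan

variable {R : Type*} [CommRing R] {M : Type*} [AddCommGroup M] [Module R⟦X⟧ M]

variable (R) in
/-- The span of `e j, e (j-1), …, e (j-n+1)`. -/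
def topSpan (e : ℕ → M) (j n : ℕ) : Submodule R⟦X⟧ M :=
  Submodule.span R⟦X⟧ ((fun l : ℕ => e (j - l)) '' Set.Iio n)

theorem image_Iio_mono {α : Type*} (f : ℕ → α) {m n : ℕ} (h : m ≤ n) :
    f '' Set.Iio m ⊆ f '' Set.Iio n := Set.image_mono (Set.Iio_subset_Iio h)

theorem topSpan_mono (e : ℕ → M) (j : ℕ) {m n : ℕ} (h : m ≤ n) :
    topSpan R e j m ≤ topSpan R e j n := Submodule.span_mono (image_Iio_mono _ h)

theorem mem_topSpan (e : ℕ → M) (j : ℕ) {l n : ℕ} (h : l < n) : e (j - l) ∈ topSpan R e j n :=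
  Submodule.subset_span ⟨l, h, rfl⟩

theorem topSpan_self (e : ℕ → M) (j : ℕ) :
    topSpan R e j j = Submodule.span R⟦X⟧ (Set.range fun i : Fin j => e (i.1 + 1)) := by
  unfold topSpan
  congr 1
  ext m
  constructor
  · rintro ⟨l, hl, rfl⟩
    simp only [Set.mem_Iio] at hl
    refine ⟨⟨j - l - 1, by omega⟩, ?_⟩
    simp only
    congr 1; omega
  · rintro ⟨i, rfl⟩
    refine ⟨j - (i.1 + 1), by simp only [Set.mem_Iio]; omega, ?_⟩
    simp only
    congr 1; omega

variable {e : ℕ → M}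

theorem mem_topSpan_succ {j : ℕ} {m : M} :
    m ∈ topSpan R e (j + 1) (j + 1) ↔
      ∃ (T : R⟦X⟧), ∃ v ∈ topSpan R e j j, m = T • e (j + 1) + v := by
  have h : topSpan R e (j + 1) (j + 1) = Submodule.span R⟦X⟧ {e (j + 1)} ⊔ topSpan R e j j := by
    rw [topSpan_self, topSpan_self, ← Submodule.span_union]
    congr 1
    ext m
    constructor
    · rintro ⟨l, rfl⟩
      rcases Nat.lt_succ_iff_lt_or_eq.1 l.2 with hl | hl
      · exact Or.inr ⟨⟨l.1, hl⟩, rfl⟩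
      · left; simp only [Set.mem_singleton_iff]; rw [hl]
    · rintro (h | ⟨l, rfl⟩)
      · exact ⟨⟨j, by omega⟩, h.symm⟩
      · exact ⟨⟨l.1, by omega⟩, rfl⟩
  rw [h, Submodule.mem_sup]
  constructor
  · rintro ⟨y, hy, z, hz, rfl⟩
    obtain ⟨T, rfl⟩ := Submodule.mem_span_singleton.1 hy
    exact ⟨T, z, hz, rfl⟩
  · rintro ⟨T, v, hv, rfl⟩
    exact ⟨_, Submodule.smul_mem _ _ (Submodule.mem_span_singleton_self _), v, hv, rfl⟩

theorem mem_topSpan_self {i j : ℕ} (h1 : 1 ≤ i) (h : i ≤ j) : e i ∈ topSpan R e j j := by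
  rw [topSpan_self]
  exact Submodule.subset_span ⟨⟨i - 1, by omega⟩, by simp only; congr 1; omega⟩

theorem topSpan_zero : topSpan R e 0 0 = ⊥ := by
  rw [topSpan_self]; simp

end TopSpan

/-! ### Frames adapted to a flag, and the iterates of `a` on the top vector. -/

section Frames

variable {R : Type*} [CommRing R] [Algebra ℂ R]
  {M : Type*} [AddCommGroup M] [Module R⟦X⟧ M] [ABAction R M]

/-- `e 1, …, e k` satisfy `a e_{j+1} = λ_{j+1} b e_{j+1} + S_j e_j`, with `e 0 = 0`. -/
structure IsFrame (lam : ℕ → ℂ) (S : ℕ → R⟦X⟧) (k : ℕ) (e : ℕ → M) : Prop where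
  zero : e 0 = 0
  step : ∀ i < k, aOp R (e (i + 1)) =
    (C (algebraMap ℂ R (lam (i + 1))) * X : R⟦X⟧) • e (i + 1) + S i • e i

variable {lam : ℕ → ℂ} {S : ℕ → R⟦X⟧} {k : ℕ} {e : ℕ → M}

theorem IsFrame.mono (h : IsFrame lam S k e) {j : ℕ} (hj : j ≤ k) : IsFrame lam S j e :=
  ⟨h.zero, fun i hi => h.step i (hi.trans_le hj)⟩

variable (R) in
/-- The span of `u, a u, …, a^(n-1) u`. -/
def orbitSpan (u : M) (n : ℕ) : Submodule R⟦X⟧ M :=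
  Submodule.span R⟦X⟧ ((fun l : ℕ => (aOp R)^[l] u) '' Set.Iio n)

theorem orbitSpan_mono (u : M) {m n : ℕ} (h : m ≤ n) :
    orbitSpan R u m ≤ orbitSpan R u n := Submodule.span_mono (image_Iio_mono _ h)

theorem mem_orbitSpan (u : M) {l n : ℕ} (h : l < n) : (aOp R)^[l] u ∈ orbitSpan R u n :=
  Submodule.subset_span ⟨l, h, rfl⟩

theorem aOp_mem_of_span {s : Set M} {P : Submodule R⟦X⟧ M} (hs : s ⊆ P)
    (h : ∀ m ∈ s, aOp R m ∈ P) : ∀ m ∈ Submodule.span R⟦X⟧ s, aOp R m ∈ P := by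
  intro m hm
  induction hm using Submodule.span_induction with
  | mem m hm => exact h m hm
  | zero => rw [map_zero]; exact P.zero_mem
  | add x y _ _ hx hy => rw [map_add]; exact P.add_mem hx hy
  | smul T x hx0 hx =>
    rw [aOp_smul]
    exact P.add_mem (P.smul_mem _ hx) (P.smul_mem _ (Submodule.span_le.2 hs hx0))

theorem IsFrame.aOp_topSpan (h : IsFrame lam S k e) {j n : ℕ} (hj : j ≤ k) (m : M)
    (hm : m ∈ topSpan R e j n) : aOp R m ∈ topSpan R e j (n + 1) := by
  refine aOp_mem_of_span (P := topSpan R e j (n + 1)) ?_ ?_ m hm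
  · exact Submodule.subset_span.trans (topSpan_mono e j (Nat.le_succ n))
  · rintro _ ⟨l, hl, rfl⟩
    simp only [Set.mem_Iio] at hl
    by_cases hlj : l < j
    · obtain ⟨i, hi⟩ : ∃ i, j - l = i + 1 := ⟨j - l - 1, by omega⟩
      simp only [hi]
      rw [h.step i (by omega)]
      have h1 : e (i + 1) ∈ topSpan R e j (n + 1) := hi ▸ mem_topSpan e j (by omega)
      have h2 : e i ∈ topSpan R e j (n + 1) := by
        have := mem_topSpan (R := R) e j (show l + 1 < n + 1 by omega)
        rwa [show j - (l + 1) = i by omega] at this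
      exact Submodule.add_mem _ (Submodule.smul_mem _ _ h1) (Submodule.smul_mem _ _ h2)
    · have : j - l = 0 := by omega
      simp only [this, h.zero, map_zero, Submodule.zero_mem]

/-- Each application of `a` moves the leading vector one step down the flag and multiplies its
coefficient by the unit S_i; everything else stays in the span of the vectors already met. -/
theorem IsFrame.iterate_smul (h : IsFrame lam S k e) {j : ℕ} (hj : j ≤ k)
    (hS : ∀ i, 1 ≤ i → i < j → IsUnit (S i)) {w : R⟦X⟧} (hw : IsUnit w) (l : ℕ) (hl : l < j) :
    ∃ s : R⟦X⟧, IsUnit s ∧ ∃ v ∈ topSpan R e j l, (aOp R)^[l] (w • e j) = s • e (j - l) + v := by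
  induction l with
  | zero => exact ⟨w, hw, 0, Submodule.zero_mem _, by simp⟩
  | succ l ih =>
    obtain ⟨s, hs, v, hv, heq⟩ := ih (by omega)
    obtain ⟨i, hi⟩ : ∃ i, j - l = i + 1 := ⟨j - l - 1, by omega⟩
    refine ⟨s * S i, hs.mul (hS i (by omega) (by omega)), ?_⟩
    rw [Function.iterate_succ_apply', heq, map_add, aOp_smul, hi, h.step i (by omega),
      show j - (l + 1) = i by omega]
    have h1 : e (i + 1) ∈ topSpan R e j (l + 1) := hi ▸ mem_topSpan e j (by omega)
    refine ⟨s • (C (algebraMap ℂ R (lam (i + 1))) * X : R⟦X⟧) • e (i + 1) +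
      ((X : R⟦X⟧) ^ 2 * derivative R s) • e (i + 1) + aOp R v, ?_, ?_⟩
    · exact Submodule.add_mem _ (Submodule.add_mem _ (Submodule.smul_mem _ _
        (Submodule.smul_mem _ _ h1)) (Submodule.smul_mem _ _ h1)) (h.aOp_topSpan hj v hv)
    · rw [smul_add, smul_smul s (S i)]; abel

theorem IsFrame.iterate_mem (h : IsFrame lam S k e) {j : ℕ} (hj : j ≤ k)
    (w : R⟦X⟧) (l : ℕ) : (aOp R)^[l] (w • e j) ∈ topSpan R e j (l + 1) := by
  induction l with
  | zero => exact Submodule.smul_mem _ _ (mem_topSpan e j (show 0 < 1 by omega))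
  | succ l ih =>
    rw [Function.iterate_succ_apply']
    exact h.aOp_topSpan hj _ ih

theorem IsFrame.topSpan_le (h : IsFrame lam S k e) (j n : ℕ) :
    topSpan R e j n ≤ topSpan R e j j := by
  refine Submodule.span_le.2 ?_
  rintro _ ⟨l, -, rfl⟩
  by_cases hl : l < j
  · exact mem_topSpan e j hl
  · have : j - l = 0 := by omega
    simp only [this, h.zero, SetLike.mem_coe, Submodule.zero_mem]

/-- The iterates of w e_j are obtained from e_j, e_{j-1}, … by a triangular matrix with unit
diagonal entries. -/
theorem IsFrame.orbitSpan_eq (h : IsFrame lam S k e) {j : ℕ} (hj : j ≤ k)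
    (hS : ∀ i, 1 ≤ i → i < j → IsUnit (S i)) {w : R⟦X⟧} (hw : IsUnit w) (n : ℕ) (hn : n ≤ j) :
    orbitSpan R (w • e j) n = topSpan R e j n := by
  apply le_antisymm
  · refine Submodule.span_le.2 ?_
    rintro _ ⟨l, hl, rfl⟩
    exact topSpan_mono e j (Nat.succ_le_of_lt hl) (h.iterate_mem hj w l)
  · induction n with
    | zero => refine Submodule.span_le.2 ?_; rintro _ ⟨l, hl, rfl⟩; simp at hl
    | succ n ih =>
      refine Submodule.span_le.2 ?_
      rintro _ ⟨l, hl, rfl⟩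
      simp only [Set.mem_Iio] at hl
      have ih' := (ih (by omega)).trans (orbitSpan_mono (w • e j) (Nat.le_succ n))
      rcases Nat.lt_succ_iff_lt_or_eq.1 hl with hl | rfl
      · exact ih' (mem_topSpan e j hl)
      · obtain ⟨s, hs, v, hv, heq⟩ := h.iterate_smul hj hS hw l (by omega)
        obtain ⟨s, rfl⟩ := hs
        have : e (j - l) = (↑s⁻¹ : R⟦X⟧) • ((aOp R)^[l] (w • e j) - v) := by
          rw [heq, add_sub_cancel_right, smul_smul, Units.inv_mul, one_smul]
        simp only [this]
        exact Submodule.smul_mem _ _ (Submodule.sub_mem _ (mem_orbitSpan _ (by omega)) (ih' hv))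

theorem orbitSpan_eq_span (u : M) (j : ℕ) :
    orbitSpan R u j = Submodule.span R⟦X⟧ (Set.range fun i : Fin j => (aOp R)^[i.1] u) := by
  unfold orbitSpan
  congr 1
  ext m
  constructor
  · rintro ⟨l, hl, rfl⟩
    exact ⟨⟨l, hl⟩, rfl⟩
  · rintro ⟨i, rfl⟩
    exact ⟨i.1, i.2, rfl⟩

theorem IsFrame.gen_eq (h : IsFrame lam S k e)
    (hS : ∀ i, 1 ≤ i → i < k → IsUnit (S i)) {w : R⟦X⟧} (hw : IsUnit w) :
    (ABSubmodule.gen (R := R) (w • e k)).toSubmodule = topSpan R e k k := by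
  apply le_antisymm
  · refine Submodule.span_le.2 ?_
    rintro _ ⟨l, rfl⟩
    exact h.topSpan_le k _ (h.iterate_mem le_rfl w l)
  · rw [← h.orbitSpan_eq le_rfl hS hw k le_rfl]
    refine Submodule.span_le.2 ?_
    rintro _ ⟨l, -, rfl⟩
    exact Submodule.subset_span ⟨l, rfl⟩

/-- A spanning family of `k` vectors is independent if some independent family of `k` vectors has
the same span. -/
theorem linearIndependent_of_span_eq {A : Type*} [CommRing A] {M : Type*} [AddCommGroup M]
    [Module A M] {n : ℕ} {f g : Fin n → M} (hf : LinearIndependent A f)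
    (h : Submodule.span A (Set.range g) = Submodule.span A (Set.range f)) :
    LinearIndependent A g := by
  let b := Module.Basis.span hf
  let g' : Fin n → Submodule.span A (Set.range f) := fun i =>
    ⟨g i, h ▸ Submodule.subset_span ⟨i, rfl⟩⟩
  let T : Submodule.span A (Set.range f) →ₗ[A] Submodule.span A (Set.range f) := b.constr A g'
  have hT : Function.Surjective T := by
    rw [← LinearMap.range_eq_top, eq_top_iff]
    rw [b.constr_range]
    rintro ⟨x, hx⟩ -
    rw [← h] at hx
    have : Submodule.map (Submodule.subtype _) (Submodule.span A (Set.range g')) =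
        Submodule.span A (Set.range g) := by
      rw [Submodule.map_span, ← Set.range_comp]; rfl
    rw [← this] at hx
    obtain ⟨y, hy, hyx⟩ := hx
    have : y = ⟨x, by rw [h] at *; assumption⟩ := Subtype.ext hyx
    rwa [← this]
  have : Module.Finite A (Submodule.span A (Set.range f)) := Module.Finite.of_basis b
  -- A surjective endomorphism of a finite module over a commutative ring is injective; no property
  -- of A beyond commutativity is needed.
  have hTi : Function.Injective T := OrzechProperty.injective_of_surjective_endomorphism T hT
  have hb : LinearIndependent A (T ∘ b) := b.linearIndependent.map' T (LinearMap.ker_eq_bot.2 hTi)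
  have : (Submodule.subtype _) ∘ (T ∘ b) = g := by
    funext i
    simp [T, g']
  rw [← this]
  exact hb.map' _ (Submodule.ker_subtype _)

theorem IsFrame.linearIndependent_iterate (h : IsFrame lam S k e)
    (hS : ∀ i, 1 ≤ i → i < k → IsUnit (S i)) {w : R⟦X⟧} (hw : IsUnit w)
    (he : LinearIndependent R⟦X⟧ fun i : Fin k => e (i.1 + 1)) :
    LinearIndependent R⟦X⟧ fun i : Fin k => (aOp R)^[i.1] (w • e k) := by
  refine linearIndependent_of_span_eq he ?_
  rw [← orbitSpan_eq_span, ← topSpan_self, h.orbitSpan_eq le_rfl hS hw k le_rfl]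

end Frames

theorem linearIndependent_iff_sum_range {A M : Type*} [CommRing A] [AddCommGroup M] [Module A M]
    {k : ℕ} {f : ℕ → M} : (LinearIndependent A fun i : Fin k => f i.1) ↔
      ∀ c : ℕ → A, ∑ i ∈ Finset.range k, c i • f i = 0 → ∀ i < k, c i = 0 := by
  rw [Fintype.linearIndependent_iff]
  constructor
  · intro h c hc i hi
    refine h (fun i => c i.1) ?_ ⟨i, hi⟩
    rw [← hc, Finset.sum_range]
  · intro h g hg i
    have := h (fun i => if hi : i < k then g ⟨i, hi⟩ else 0) (by
      rw [Finset.sum_range, ← hg]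
      refine Finset.sum_congr rfl fun i _ => ?_
      simp) i.1 i.2
    simpa using this

/-! ### From a chain with rank one quotients to a frame. -/

section Chain

variable {E : Type*} [AddCommGroup E] [Module ℂ⟦X⟧ E] [ABAction ℂ E]

theorem ABSubmodule.self_mem_gen (g : E) : g ∈ (ABSubmodule.gen (R := ℂ) g).toSubmodule :=
  Submodule.subset_span ⟨0, rfl⟩

theorem ABSubmodule.gen_le {g : E} {P : Submodule ℂ⟦X⟧ E} (hP : ∀ m ∈ P, aOp ℂ m ∈ P)
    (hg : g ∈ P) : (ABSubmodule.gen (R := ℂ) g).toSubmodule ≤ P := by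
  refine Submodule.span_le.2 ?_
  rintro _ ⟨l, rfl⟩
  induction l with
  | zero => exact hg
  | succ l ih =>
    simp only [Function.iterate_succ_apply']
    exact hP _ ih

/-- `P ⊆ Q` and the quotient is `E_μ`. -/
def QuotientIsELam (mu : ℂ) (P Q : ABSubmodule ℂ E) : Prop :=
  P.toSubmodule ≤ Q.toSubmodule ∧ ∃ π : Q.toSubmodule →ₗ[ℂ⟦X⟧] ℂ⟦X⟧, Function.Surjective π ∧
    (∀ m, π m = 0 ↔ m.1 ∈ P.toSubmodule) ∧ ∀ m, π (aOp ℂ m) = euler mu (π m)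

theorem QuotientIsELam.of_abIso {mu : ℚ} {P Q : ABSubmodule ℂ E}
    (hle : P.toSubmodule ≤ Q.toSubmodule)
    (h : ABIso ℂ (Q.toSubmodule ⧸ (P.inside Q).toSubmodule) (ELam mu)) :
    QuotientIsELam (mu : ℂ) P Q := by
  obtain ⟨θ, hθ⟩ := h
  let θ' : (Q.toSubmodule ⧸ (P.inside Q).toSubmodule) →ₗ[ℂ⟦X⟧] ℂ⟦X⟧ := θ.toLinearMap
  refine ⟨hle, θ'.comp (Submodule.mkQ _), ?_, ?_, ?_⟩
  · exact θ.surjective.comp (Submodule.mkQ_surjective _)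
  · intro m
    have : θ' (Submodule.mkQ _ m) = 0 ↔ (Submodule.mkQ (P.inside Q).toSubmodule m) = 0 :=
      LinearEquiv.map_eq_zero_iff θ
    rw [LinearMap.comp_apply, this, Submodule.mkQ_apply, Submodule.Quotient.mk_eq_zero]
    rfl
  · intro m
    exact hθ (Submodule.Quotient.mk m)

/-- Induction from the top: normalise the generator G so that its image in the top quotient is 1.
Then (a - λ b) maps the result to a generator of the previous term of the chain, to which the
induction applies. -/
theorem exists_frame_of_chain (lam : ℕ → ℂ) (F : ℕ → ABSubmodule ℂ E)
    (h0 : (F 0).toSubmodule = ⊥) (k : ℕ)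
    (hF : ∀ j < k, QuotientIsELam (lam (j + 1)) (F j) (F (j + 1)))
    (G : E) (hG : (ABSubmodule.gen (R := ℂ) G).toSubmodule = (F k).toSubmodule) :
    ∃ (e : ℕ → E) (S : ℕ → ℂ⟦X⟧), IsFrame lam S k e ∧ (∀ i, 1 ≤ i → i < k → IsUnit (S i)) ∧
      (∃ w : ℂ⟦X⟧, IsUnit w ∧ G = w • e k) ∧
      (∀ i ≤ k, topSpan ℂ e i i = (F i).toSubmodule) ∧
      LinearIndependent ℂ⟦X⟧ fun i : Fin k => e (i.1 + 1) := by
  induction k generalizing G with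
  | zero =>
    have hG0 : G = 0 := by
      have := ABSubmodule.self_mem_gen G
      rw [hG, h0] at this
      exact (Submodule.mem_bot _).1 this
    refine ⟨fun _ => 0, fun _ => 1, ⟨rfl, by simp⟩, by simp, ⟨1, isUnit_one, by simp [hG0]⟩, ?_,
      linearIndependent_empty_type⟩
    intro i hi
    obtain rfl : i = 0 := by omega
    rw [h0, topSpan_self]
    simp
  | succ j ih =>
    obtain ⟨hle, π, hsurj, hker, ha⟩ := hF j (by omega)
    have hGm : G ∈ (F (j + 1)).toSubmodule := hG ▸ ABSubmodule.self_mem_gen G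
    have hmem : ∀ m : (F (j + 1)).toSubmodule, m.1 ∈ (ABSubmodule.gen (R := ℂ) G).toSubmodule :=
      fun m => by rw [hG]; exact m.2
    -- Otherwise π G lies in b ℂ[[b]], which is stable under the Euler operator, so π would map
    -- everything generated by G there and could not be surjective.
    have hT : IsUnit (π ⟨G, hGm⟩) := by
      by_contra hT
      have hI : ∀ m ∈ (ABSubmodule.gen (R := ℂ) G).toSubmodule,
          ∀ hm : m ∈ (F (j + 1)).toSubmodule, coeff 0 (π ⟨m, hm⟩) = 0 := by
        intro m hmG
        have hle' : (ABSubmodule.gen (R := ℂ) G).toSubmodule ≤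
            (Submodule.comap π (Ideal.span {(X : ℂ⟦X⟧)})).map (F (j + 1)).toSubmodule.subtype := by
          refine ABSubmodule.gen_le ?_ ?_
          · rintro _ ⟨m, hm, rfl⟩
            refine ⟨aOp ℂ m, ?_, rfl⟩
            rw [SetLike.mem_coe, Submodule.mem_comap, Ideal.mem_span_singleton, ha, X_dvd_iff,
              ← coeff_zero_eq_constantCoeff_apply, coeff_zero_euler]
          · refine ⟨⟨G, hGm⟩, ?_, rfl⟩
            rw [SetLike.mem_coe, Submodule.mem_comap, Ideal.mem_span_singleton, X_dvd_iff]
            rw [isUnit_series_iff, isUnit_iff_ne_zero, not_not] at hT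
            rw [← coeff_zero_eq_constantCoeff_apply, hT]
        obtain ⟨m', hm', rfl⟩ := hle' hmG
        intro hm
        rw [SetLike.mem_coe, Submodule.mem_comap, Ideal.mem_span_singleton, X_dvd_iff] at hm'
        rw [coeff_zero_eq_constantCoeff_apply]
        exact hm'
      obtain ⟨m, hm⟩ := hsurj 1
      have := hI m.1 (hmem m) m.2
      rw [show (⟨m.1, m.2⟩ : (F (j + 1)).toSubmodule) = m from rfl, hm] at this
      simp at this
    obtain ⟨T, hTe⟩ := hT
    let f' : (F (j + 1)).toSubmodule := (↑T⁻¹ : ℂ⟦X⟧) • ⟨G, hGm⟩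
    have hπf : π f' = 1 := by
      simp only [f', map_smul, ← hTe, smul_eq_mul, Units.inv_mul]
    have hGf : G = (T : ℂ⟦X⟧) • (f' : E) := by
      simp [f', smul_smul]
    let u' : (F (j + 1)).toSubmodule := aOp ℂ f' - (C (lam (j + 1)) * X : ℂ⟦X⟧) • f'
    have hu'F : u'.1 ∈ (F j).toSubmodule := by
      rw [← hker]
      simp only [u', map_sub, ha, map_smul, hπf, smul_eq_mul, euler_apply]
      simp
    have haf : aOp ℂ f'.1 = (C (lam (j + 1)) * X : ℂ⟦X⟧) • f'.1 + u'.1 := by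
      have : u'.1 = aOp ℂ f'.1 - (C (lam (j + 1)) * X : ℂ⟦X⟧) • f'.1 := rfl
      rw [this]; abel
    -- What G generates lies in ℂ[[b]] f' + gen u'. An element of F_j has zero f'-component, since π
    -- f' = 1 while π kills F_j; so it belongs to gen u'.
    have hgu : (ABSubmodule.gen (R := ℂ) u'.1).toSubmodule = (F j).toSubmodule := by
      apply le_antisymm
      · exact ABSubmodule.gen_le (F j).a_mem hu'F
      · intro m hm
        have hH : (ABSubmodule.gen (R := ℂ) G).toSubmodule ≤
            Submodule.span ℂ⟦X⟧ {f'.1} ⊔ (ABSubmodule.gen (R := ℂ) u'.1).toSubmodule := by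
          refine ABSubmodule.gen_le ?_ ?_
          · intro y hy
            obtain ⟨y1, hy1, y2, hy2, rfl⟩ := Submodule.mem_sup.1 hy
            obtain ⟨c, rfl⟩ := Submodule.mem_span_singleton.1 hy1
            have hf1 := Submodule.mem_span_singleton_self (R := ℂ⟦X⟧) f'.1
            rw [map_add, aOp_smul, haf]
            refine Submodule.add_mem _ (Submodule.add_mem _ (Submodule.smul_mem _ _
              (Submodule.add_mem _ (Submodule.smul_mem _ _ (Submodule.mem_sup_left hf1))
                (Submodule.mem_sup_right (ABSubmodule.self_mem_gen u'.1))))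
              (Submodule.smul_mem _ _ (Submodule.mem_sup_left hf1)))
              (Submodule.mem_sup_right ((ABSubmodule.gen (R := ℂ) u'.1).a_mem _ hy2))
          · rw [hGf]
            exact Submodule.mem_sup_left (Submodule.smul_mem _ _
              (Submodule.mem_span_singleton_self _))
        have hm1 := hH (hmem ⟨m, hle hm⟩)
        obtain ⟨y1, hy1, y2, hy2, hy⟩ := Submodule.mem_sup.1 hm1
        obtain ⟨c, rfl⟩ := Submodule.mem_span_singleton.1 hy1
        have hy2F : y2 ∈ (F j).toSubmodule := ABSubmodule.gen_le (F j).a_mem hu'F hy2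
        have hc : c = 0 := by
          have h1 : π ⟨m, hle hm⟩ = 0 := (hker _).2 hm
          have h2 : (⟨m, hle hm⟩ : (F (j + 1)).toSubmodule) = c • f' + ⟨y2, hle hy2F⟩ :=
            Subtype.ext hy.symm
          have h3 : π ⟨y2, hle hy2F⟩ = 0 := (hker _).2 hy2F
          rw [h2, map_add, h3, map_smul, hπf] at h1
          simpa using h1
        rw [hc, zero_smul, zero_add] at hy
        simp only at hy
        rw [← hy]
        exact hy2
    obtain ⟨e, S, hfr, hS, ⟨w, hw, hwe⟩, hspan, hind⟩ := ih (fun i hi => hF i (by omega)) u'.1 hgu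
    have hlt : ∀ i ≤ j, (if i = j + 1 then f'.1 else e i) = e i := by
      intro i hi
      rw [if_neg (by omega)]
    have htop : ∀ i ≤ j, topSpan ℂ (fun i => if i = j + 1 then f'.1 else e i) i i =
        topSpan ℂ e i i := by
      intro i hi
      rw [topSpan_self, topSpan_self]
      congr 2
      funext l
      exact hlt _ (by omega)
    -- The series S_j is the unit w with u' = w e_j. For j = 0 its value is irrelevant, because e_0
    -- = 0.
    refine ⟨fun i => if i = j + 1 then f'.1 else e i, fun i => if i = j then w else S i,
      ⟨?_, ?_⟩, ?_, ⟨T, T.isUnit, ?_⟩, ?_, ?_⟩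
    · rw [hlt 0 (by omega)]; exact hfr.zero
    · intro i hi
      rcases Nat.lt_succ_iff_lt_or_eq.1 hi with hi | rfl
      · rw [hlt (i + 1) (by omega), hlt i (by omega), if_neg (by omega)]
        exact hfr.step i hi
      · rw [hlt i le_rfl]
        simp only [if_true]
        rw [haf, ← hwe]; rfl
    · intro i hi1 hi2
      simp only
      split_ifs with h
      · exact hw
      · exact hS i hi1 (by omega)
    · simp only [if_true]; exact hGf
    · intro i hi
      rcases Nat.le_succ_iff.1 hi with hi | rfl
      · rw [htop i hi, hspan i hi]
      · apply le_antisymm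
        · rw [topSpan_self]
          refine Submodule.span_le.2 ?_
          rintro _ ⟨l, rfl⟩
          simp only
          split_ifs with h
          · exact f'.2
          · apply hle
            rw [← hspan j le_rfl, topSpan_self]
            exact Submodule.subset_span ⟨⟨l.1, by omega⟩, rfl⟩
        · intro m hm
          have h1 : (⟨m, hm⟩ : (F (j + 1)).toSubmodule) - π ⟨m, hm⟩ • f' ∈
              LinearMap.ker π := by
            rw [LinearMap.mem_ker, map_sub, map_smul, hπf]; simp
          have h2 := (hker _).1 (LinearMap.mem_ker.1 h1)
          rw [← hspan j le_rfl, ← htop j le_rfl] at h2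
          have h3 : topSpan ℂ (fun i => if i = j + 1 then f'.1 else e i) j j ≤
              topSpan ℂ (fun i => if i = j + 1 then f'.1 else e i) (j + 1) (j + 1) := by
            rw [topSpan_self, topSpan_self]
            refine Submodule.span_mono ?_
            rintro _ ⟨l, rfl⟩
            exact ⟨⟨l.1, by omega⟩, rfl⟩
          have h4 : f'.1 ∈ topSpan ℂ (fun i => if i = j + 1 then f'.1 else e i)
              (j + 1) (j + 1) := by
            have := mem_topSpan (R := ℂ) (fun i => if i = j + 1 then f'.1 else e i) (j + 1)
              (show 0 < j + 1 by omega)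
            simpa using this
          have h5 := Submodule.add_mem _ (h3 h2) (Submodule.smul_mem _ (π ⟨m, hm⟩) h4)
          simpa using h5
    · have hind' := (linearIndependent_iff_sum_range (f := fun i => e (i + 1))).1 hind
      refine (linearIndependent_iff_sum_range
        (f := fun i => if i + 1 = j + 1 then f'.1 else e (i + 1))).2 ?_
      intro c hc
      rw [Finset.sum_range_succ] at hc
      have hsum : ∑ i ∈ Finset.range j, c i • (if i + 1 = j + 1 then f'.1 else e (i + 1)) =
          ∑ i ∈ Finset.range j, c i • e (i + 1) := by
        refine Finset.sum_congr rfl fun i hi => ?_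
        rw [if_neg (by have := Finset.mem_range.1 hi; omega)]
      rw [hsum, if_pos rfl] at hc
      have hmemF : ∑ i ∈ Finset.range j, c i • e (i + 1) ∈ (F j).toSubmodule := by
        refine Submodule.sum_mem _ fun i hi => Submodule.smul_mem _ _ ?_
        rw [← hspan j le_rfl, topSpan_self]
        exact Submodule.subset_span ⟨⟨i, Finset.mem_range.1 hi⟩, rfl⟩
      have hcj : c j = 0 := by
        have h3 : π ⟨_, hle hmemF⟩ = 0 := (hker _).2 hmemF
        have h2 : (⟨_, hle hmemF⟩ : (F (j + 1)).toSubmodule) + c j • f' = 0 := Subtype.ext hc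
        have := congrArg π h2
        rw [map_add, h3, map_smul, hπf, map_zero] at this
        simpa using this
      rw [hcj, zero_smul, add_zero] at hc
      intro i hi
      rcases Nat.lt_succ_iff_lt_or_eq.1 hi with hi | rfl
      · exact hind' c hc i hi
      · exact hcj

end Chain

theorem exists_unit_mul_X_pow {T : ℂ⟦X⟧} (hT : T ≠ 0) :
    ∃ (n : ℕ) (s : ℂ⟦X⟧ˣ), T = (s : ℂ⟦X⟧) * X ^ n :=
  IsDiscreteValuationRing.eq_unit_mul_pow_irreducible hT PowerSeries.X_prime.irreducible

/-! ### Themes at a point: log components, resonances and normal submodules. -/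

section Fibres

variable {E : Type*} [AddCommGroup E] [Module ℂ⟦X⟧ E] [ABAction ℂ E]

/-- `E` embeds into a module `⊕_i ℂ[[b]] ε_i` with `a ε_i = λ b ε_i + b ε_{i-1}`; `ψ i` is the
component along `ε_i`. -/
structure LogEmbedding (lam : ℂ) (ψ : ℕ → E →ₗ[ℂ⟦X⟧] ℂ⟦X⟧) : Prop where
  finite : ∃ N, ∀ i ≥ N, ψ i = 0
  map_a : ∀ i m, ψ i (aOp ℂ m) = euler lam (ψ i m) + X * ψ (i + 1) m
  inj : ∀ m, (∀ i, ψ i m = 0) → m = 0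

/-- The components of an element of `Ξ_lam^(N)`. -/
def Xi.comp {R : Type*} [CommRing R] {lam : ℚ} {N : ℕ} (i : ℕ) : Xi R {lam} N →ₗ[R⟦X⟧] R⟦X⟧ where
  toFun s := if h : i < N + 1 then s ⟨lam, Finset.mem_singleton_self lam⟩ ⟨i, h⟩ else 0
  map_add' s t := by
    split_ifs
    · rfl
    · simp
  map_smul' S s := by
    split_ifs
    · rfl
    · simp

theorem Xi.comp_ext {R : Type*} [CommRing R] {lam : ℚ} {N : ℕ} {s t : Xi R {lam} N}
    (h : ∀ i, i < N + 1 → Xi.comp i s = Xi.comp i t) : s = t := by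
  funext l i
  obtain ⟨l, hl⟩ := l
  obtain rfl := Finset.mem_singleton.1 hl
  have := h i.1 i.2
  simp only [Xi.comp, LinearMap.coe_mk, AddHom.coe_mk, dif_pos i.2] at this
  exact this

theorem Xi.comp_eq_zero {R : Type*} [CommRing R] {lam : ℚ} {N : ℕ} (s : Xi R {lam} N) {i : ℕ}
    (h : N + 1 ≤ i) : Xi.comp i s = 0 := dif_neg (by omega)

theorem Xi.aOp_apply {R : Type*} [CommRing R] [Algebra ℂ R] {Λ : Finset ℚ} {N : ℕ}
    (s : Xi R Λ N) (l : Λ) (j : Fin (N + 1)) :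
    aOp R s l j = (X : R⟦X⟧) ^ 2 * derivative R (s l j) +
      C (algebraMap ℂ R ((l : ℚ) : ℂ)) * X * s l j +
      (if h : j.1 + 1 < N + 1 then X * s l ⟨j.1 + 1, h⟩ else 0) := rfl

theorem Xi.comp_a {R : Type*} [CommRing R] [Algebra ℂ R] {lam : ℚ} {N : ℕ} (s : Xi R {lam} N)
    (i : ℕ) : Xi.comp i (aOp R s) =
      euler (algebraMap ℂ R ((lam : ℚ) : ℂ)) (Xi.comp i s) + X * Xi.comp (i + 1) s := by
  by_cases h : i < N + 1
  · have h1 : Xi.comp i (aOp R s) = (aOp R s) ⟨lam, Finset.mem_singleton_self lam⟩ ⟨i, h⟩ :=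
      dif_pos h
    have h2 : Xi.comp i s = s ⟨lam, Finset.mem_singleton_self lam⟩ ⟨i, h⟩ := dif_pos h
    rw [h1, h2, euler_apply, Xi.aOp_apply]
    by_cases h' : i + 1 < N + 1
    · have h3 : Xi.comp (i + 1) s = s ⟨lam, Finset.mem_singleton_self lam⟩ ⟨i + 1, h'⟩ := dif_pos h'
      rw [h3, dif_pos h']
    · rw [Xi.comp_eq_zero s (i := i + 1) (by omega)]
      rw [dif_neg h', mul_zero]
  · rw [Xi.comp_eq_zero _ (by omega), Xi.comp_eq_zero _ (by omega), Xi.comp_eq_zero _ (by omega)]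
    simp

theorem IsPrimitiveTheme.exists_generator {lam : ℚ} {k : ℕ} (h : IsPrimitiveTheme E lam k) :
    ∃ g : E, (ABSubmodule.gen (R := ℂ) g).toSubmodule = ⊤ := by
  obtain ⟨-, N, φ, θ, hθ⟩ := h
  refine ⟨θ.symm ⟨φ, ABSubmodule.self_mem_gen φ⟩, ?_⟩
  set g := θ.symm ⟨φ, ABSubmodule.self_mem_gen φ⟩ with hg
  rw [eq_top_iff]
  rintro m -
  have h1 : (θ m).1 ∈ (ABSubmodule.gen (R := ℂ) g).toSubmodule.map
      ((Submodule.subtype _).comp θ.toLinearMap) := by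
    have : (ABSubmodule.gen (R := ℂ) φ).toSubmodule ≤ (ABSubmodule.gen (R := ℂ) g).toSubmodule.map
      ((Submodule.subtype _).comp θ.toLinearMap) := by
      refine ABSubmodule.gen_le ?_ ?_
      · rintro _ ⟨y, hy, rfl⟩
        refine ⟨aOp ℂ y, (ABSubmodule.gen (R := ℂ) g).a_mem y hy, ?_⟩
        exact congrArg Subtype.val (hθ y)
      · refine ⟨g, ABSubmodule.self_mem_gen g, ?_⟩
        simp [hg]
    exact this (θ m).2
  obtain ⟨y, hy, hym⟩ := h1
  have : y = m := θ.injective (Subtype.ext hym)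
  exact this ▸ hy

theorem IsPrimitiveTheme.exists_logEmbedding {lam : ℚ} {k : ℕ} (h : IsPrimitiveTheme E lam k) :
    ∃ ψ : ℕ → E →ₗ[ℂ⟦X⟧] ℂ⟦X⟧, LogEmbedding ((lam : ℚ) : ℂ) ψ := by
  obtain ⟨-, N, φ, θ, hθ⟩ := h
  refine ⟨fun i => (Xi.comp i).comp ((Submodule.subtype _).comp θ.toLinearMap), ⟨N + 1, ?_⟩, ?_, ?_⟩
  · intro i hi
    ext m
    simp [Xi.comp_eq_zero _ hi]
  · intro i m
    have h1 : (θ (aOp ℂ m)).1 = aOp ℂ (θ m).1 := congrArg Subtype.val (hθ m)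
    simp only [LinearMap.comp_apply, LinearEquiv.coe_coe, Submodule.coe_subtype, h1]
    exact Xi.comp_a _ i
  · intro m hm
    have : (θ m).1 = 0 := Xi.comp_ext fun i _ => by rw [map_zero]; exact hm i
    exact (LinearEquiv.map_eq_zero_iff θ).1 (Subtype.ext this)

/-- The first equation leaves only the coefficient of w at the resonant exponent, and b times that
monomial is exactly what the image of `euler c` misses. -/
theorem eq_zero_of_euler {c : ℂ} {w w' : ℂ⟦X⟧} (h : euler c w = 0) (h' : euler c w' + X * w = 0) :
    w = 0 := by
  ext n
  have h1 := congrArg (coeff (n + 1)) h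
  have h2 := congrArg (coeff (n + 1)) h'
  rw [coeff_succ_euler, map_zero] at h1
  rw [map_add, coeff_succ_euler, coeff_succ_X_mul, map_zero] at h2
  by_cases hn : (n + c : ℂ) = 0
  · simpa [hn] using h2
  · simpa [hn] using h1

theorem eq_monomial_of_euler {c : ℂ} {w : ℂ⟦X⟧} (h : euler c w = 0) (hw : w ≠ 0) :
    ∃ (m : ℕ) (d : ℂ), d ≠ 0 ∧ (m + c : ℂ) = 0 ∧ w = C d * X ^ m := by
  obtain ⟨m, hm⟩ : ∃ m, coeff m w ≠ 0 := by
    by_contra! h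
    exact hw (PowerSeries.ext fun n => by simpa using h n)
  have h0 : ∀ n : ℕ, (n + c : ℂ) * coeff n w = 0 := fun n => by
    rw [← coeff_succ_euler, h, map_zero]
  have hmc : (m + c : ℂ) = 0 := (mul_eq_zero.1 (h0 m)).resolve_right hm
  refine ⟨m, coeff m w, hm, hmc, PowerSeries.ext fun n => ?_⟩
  rw [coeff_C_mul, coeff_X_pow]
  split_ifs with hn
  · rw [hn, mul_one]
  · rw [mul_zero]
    refine (mul_eq_zero.1 (h0 n)).resolve_left fun hnc => hn ?_
    have : (n : ℂ) = m := by linear_combination hnc - hmc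
    exact_mod_cast this

variable {lam : ℂ} {ψ : ℕ → E →ₗ[ℂ⟦X⟧] ℂ⟦X⟧} {mu : ℕ → ℂ} {S : ℕ → ℂ⟦X⟧} {k : ℕ} {e : ℕ → E}
  {p : ℕ → ℕ}

theorem LogEmbedding.euler_eq (hψ : LogEmbedding lam ψ) (h : IsFrame mu S k e) {j : ℕ} (hj : j < k)
    (i : ℕ) : euler (lam - mu (j + 1)) (ψ i (e (j + 1))) + X * ψ (i + 1) (e (j + 1)) =
      S j * ψ i (e j) := by
  have h1 := hψ.map_a i (e (j + 1))
  rw [h.step j hj, map_add, map_smul, map_smul, smul_eq_mul, smul_eq_mul] at h1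
  rw [← euler_sub]
  simp only [Algebra.algebraMap_self, RingHom.id_apply] at h1
  linear_combination -h1

/-- The vector e_j has log degree less than j. Descend on i from the bound N: once component i + 1
vanishes, component i is in the kernel of the Euler operator, while the equation for component i - 1
puts b times it in the image, so `eq_zero_of_euler` applies. -/
theorem LogEmbedding.apply_eq_zero (hψ : LogEmbedding lam ψ) (h : IsFrame mu S k e) (j : ℕ)
    (hj : j ≤ k) : ∀ i ≥ j, ψ i (e j) = 0 := by
  induction j with
  | zero => intro i _; rw [h.zero, map_zero]
  | succ j ih =>
    have ih := ih (by omega)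
    obtain ⟨N, hN⟩ := hψ.finite
    have key : ∀ l i, i + l ≥ N → i ≥ j + 1 → ψ i (e (j + 1)) = 0 := by
      intro l
      induction l with
      | zero => intro i hi _; rw [hN i hi]; rfl
      | succ l ihl =>
        intro i hi hij
        have h1 := hψ.euler_eq h (show j < k by omega) i
        rw [ihl (i + 1) (by omega) (by omega), ih i (by omega), mul_zero, mul_zero, add_zero] at h1
        obtain ⟨i, rfl⟩ : ∃ i', i = i' + 1 := ⟨i - 1, by omega⟩
        have h2 := hψ.euler_eq h (show j < k by omega) i
        rw [ih i (by omega), mul_zero] at h2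
        exact eq_zero_of_euler h1 h2
    intro i hi
    exact key N i (by omega) hi

/-- The component of top log degree is killed by the Euler operator, hence zero or a resonant
monomial. It cannot be zero: then the j + 1 independent vectors e_1, …, e_{j+1} would have only j
nonzero components. -/
theorem LogEmbedding.top_eq (hψ : LogEmbedding lam ψ) (h : IsFrame mu S k e)
    (hind : LinearIndependent ℂ⟦X⟧ fun i : Fin k => e (i.1 + 1)) (j : ℕ) (hj : j < k) :
    ∃ (m : ℕ) (d : ℂ), d ≠ 0 ∧ mu (j + 1) = lam + m ∧ ψ j (e (j + 1)) = C d * X ^ m := by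
  have h1 := hψ.euler_eq h hj j
  rw [hψ.apply_eq_zero h (j + 1) (by omega) (j + 1) le_rfl,
    hψ.apply_eq_zero h j (by omega) j le_rfl, mul_zero, mul_zero, add_zero] at h1
  by_cases hw : ψ j (e (j + 1)) = 0
  · exfalso
    have hz : ∀ l ≤ j, ∀ i ≥ j, ψ i (e (l + 1)) = 0 := by
      intro l hl i hi
      rcases hi.eq_or_lt with rfl | hi
      · rcases hl.eq_or_lt with rfl | hl
        · exact hw
        · exact hψ.apply_eq_zero h (l + 1) (by omega) _ (by omega)
      · exact hψ.apply_eq_zero h (l + 1) (by omega) _ (by omega)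
    have hli : LinearIndependent ℂ⟦X⟧
        (fun l : Fin (j + 1) => (fun i : Fin j => ψ i.1 (e (l.1 + 1)) : Fin j → ℂ⟦X⟧)) := by
      refine (linearIndependent_iff_sum_range
        (f := fun l => (fun i : Fin j => ψ i.1 (e (l + 1)) : Fin j → ℂ⟦X⟧))).2 ?_
      intro c hc
      have hsum : ∑ l ∈ Finset.range (j + 1), c l • e (l + 1) = 0 := by
        refine hψ.inj _ fun i => ?_
        rw [map_sum]
        simp only [map_smul]
        by_cases hi : i < j
        · have := congrFun hc ⟨i, hi⟩
          simpa using this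
        · refine Finset.sum_eq_zero fun l hl => ?_
          rw [hz l (by have := Finset.mem_range.1 hl; omega) i (by omega), smul_zero]
      have hind' := (linearIndependent_iff_sum_range (f := fun i => e (i + 1))).1 hind
      intro l hl
      have := hind' (fun l => if l < j + 1 then c l else 0) (by
        rw [← hsum, ← Finset.sum_subset (Finset.range_mono (show j + 1 ≤ k by omega))]
        · refine Finset.sum_congr rfl fun l hl => ?_
          rw [if_pos (Finset.mem_range.1 hl)]
        · intro l _ hl
          rw [if_neg (by simpa using hl), zero_smul]) l (by omega)
      simpa [hl] using this
    have := hli.fintype_card_le_finrank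
    simp at this
  · obtain ⟨m, d, hd, hm, hmd⟩ := eq_monomial_of_euler h1 hw
    exact ⟨m, d, hd, by linear_combination -hm, hmd⟩

/-- Let d b^m and d' b^{m'} be the top components of e_j and e_{j+1}, so that m' + 1 = m + p_j. In
the relation for component j - 1 of e_{j+1}, the Euler term has no coefficient at b^{m'+1}, which
leaves d' = d times the coefficient of b^{p_j} in S_j. -/
theorem LogEmbedding.coeff_ne_zero (hψ : LogEmbedding lam ψ) (h : IsFrame mu S k e)
    (hind : LinearIndependent ℂ⟦X⟧ fun i : Fin k => e (i.1 + 1)) {j : ℕ} (hj1 : 1 ≤ j) (hj : j < k)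
    (hmu : mu (j + 1) = mu j + p j - 1) : coeff (p j) (S j) ≠ 0 := by
  obtain ⟨i, rfl⟩ : ∃ i, j = i + 1 := ⟨j - 1, by omega⟩
  obtain ⟨m, d, hd, hm, hmd⟩ := hψ.top_eq h hind i (by omega)
  obtain ⟨m', d', hd', hm', hmd'⟩ := hψ.top_eq h hind (i + 1) hj
  have h1 := congrArg (coeff (m' + 1)) (hψ.euler_eq h hj i)
  have hmm : m' + 1 = m + p (i + 1) := by
    rw [hm, hm'] at hmu
    have : (m' + 1 : ℂ) = m + p (i + 1) := by linear_combination hmu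
    exact_mod_cast this
  rw [map_add, coeff_succ_euler, coeff_succ_X_mul, hmd, hmd', hm'] at h1
  rw [show (m' + (lam - (lam + m')) : ℂ) = 0 by ring, zero_mul, zero_add, coeff_C_mul,
    coeff_X_pow_self, mul_one, mul_left_comm, coeff_C_mul, hmm, add_comm m, coeff_mul_X_pow] at h1
  intro h0
  rw [h0, mul_zero] at h1
  exact hd' h1

/-- Up to the unit S_j, the components of e_j arise from those of e_{j+1} by operators raising the
b-adic order by at least one; descend from e_k. -/
theorem LogEmbedding.X_pow_dvd (hψ : LogEmbedding lam ψ) (h : IsFrame mu S k e)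
    (hS : ∀ i, 1 ≤ i → i < k → IsUnit (S i)) (l : ℕ) : ∀ j, 1 ≤ j → j + l = k →
      ∀ i, X ^ l ∣ ψ i (e j) := by
  induction l with
  | zero => intro j _ _ i; simp
  | succ l ih =>
    intro j hj hjl i
    have ih := ih (j + 1) (by omega) (by omega)
    have h1 := hψ.euler_eq h (show j < k by omega) i
    have h2 : X ^ (l + 1) ∣ S j * ψ i (e j) := by
      rw [← h1]
      refine dvd_add (X_pow_dvd_euler _ (ih i)) ?_
      rw [pow_succ']
      exact mul_dvd_mul_left _ (ih (i + 1))
    exact (hS j hj (by omega)).dvd_mul_left.1 h2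

/-- The degree 0 component of e_1 is a nonzero multiple of b^m with m = λ_1 - λ, and it is divisible
by b^{k-1}. -/
theorem LogEmbedding.exists_shift (hψ : LogEmbedding lam ψ) (h : IsFrame mu S k e)
    (hind : LinearIndependent ℂ⟦X⟧ fun i : Fin k => e (i.1 + 1))
    (hS : ∀ i, 1 ≤ i → i < k → IsUnit (S i)) (hk : 1 ≤ k) :
    ∃ m : ℕ, mu 1 = lam + m ∧ k - 1 ≤ m := by
  obtain ⟨m, d, hd, hm, hmd⟩ := hψ.top_eq h hind 0 (by omega)
  refine ⟨m, hm, ?_⟩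
  have h1 := hψ.X_pow_dvd h hS (k - 1) 1 le_rfl (by omega) 0
  rw [X_pow_dvd_iff] at h1
  by_contra! hlt
  have := h1 m hlt
  rw [zero_add] at hmd
  rw [hmd, coeff_C_mul, coeff_X_pow_self, mul_one] at this
  exact hd this

/-- The normal submodules are the members of the flag of the frame. -/
theorem IsFrame.eq_topSpan_of_isNormal (h : IsFrame mu S k e) (htop : topSpan ℂ e k k = ⊤)
    (hmu : ∀ j, 1 ≤ j → j < k → mu (j + 1) = mu j + p j - 1)
    (hp : ∀ j, 1 ≤ j → j < k → coeff (p j) (S j) ≠ 0) (G : ABSubmodule ℂ E) (hG : G.IsNormal) :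
    ∃ i ≤ k, G.toSubmodule = topSpan ℂ e i i := by
  classical
  have hpow : ∀ (n : ℕ) (m : E), (X ^ n : ℂ⟦X⟧) • m ∈ G.toSubmodule → m ∈ G.toSubmodule := by
    intro n
    induction n with
    | zero => intro m hm; simpa using hm
    | succ n ih =>
      intro m hm
      rw [pow_succ, mul_smul] at hm
      exact hG m (ih _ hm)
  have hnorm : ∀ (T : ℂ⟦X⟧) (m : E), T ≠ 0 → T • m ∈ G.toSubmodule → m ∈ G.toSubmodule := by
    intro T m hT hm
    obtain ⟨n, s, rfl⟩ := exists_unit_mul_X_pow hT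
    apply hpow n
    have := Submodule.smul_mem _ (↑s⁻¹ : ℂ⟦X⟧) hm
    rwa [smul_smul, ← mul_assoc, Units.inv_mul, one_mul] at this
  have hex : ∃ i, G.toSubmodule ≤ topSpan ℂ e i i := ⟨k, by rw [htop]; exact le_top⟩
  set i := Nat.find hex with hi
  have hik : i ≤ k := Nat.find_min' hex (by rw [htop]; exact le_top)
  have hGi : G.toSubmodule ≤ topSpan ℂ e i i := Nat.find_spec hex
  refine ⟨i, hik, le_antisymm hGi ?_⟩
  -- The submodule meets every lower level of the flag with a nonzero leading coefficient. Given b^n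
  -- e_{l+2} + T' e_{l+1} + v' in it, apply a - (λ_{l+2} + n) b, which removes the e_{l+2} term.
  have hdown : ∀ d l, l + d + 1 = i → ∃ g ∈ G.toSubmodule, ∃ T : ℂ⟦X⟧, T ≠ 0 ∧
      ∃ v ∈ topSpan ℂ e l l, g = T • e (l + 1) + v := by
    intro d
    induction d with
    | zero =>
      intro l hl
      have hl' : i = l + 1 := by omega
      have := Nat.find_min hex (m := l) (by omega)
      obtain ⟨g, hg, hgl⟩ := SetLike.not_le_iff_exists.1 this
      have hg' := hGi hg
      rw [hl', mem_topSpan_succ] at hg'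
      obtain ⟨T, v, hv, rfl⟩ := hg'
      refine ⟨_, hg, T, ?_, v, hv, rfl⟩
      rintro rfl
      rw [zero_smul, zero_add] at hgl
      exact hgl hv
    | succ d ih =>
      intro l hl
      obtain ⟨g, hg, T, hT, v, hv, rfl⟩ := ih (l + 1) (by omega)
      obtain ⟨n, s, rfl⟩ := exists_unit_mul_X_pow hT
      have hg1 := Submodule.smul_mem _ (↑s⁻¹ : ℂ⟦X⟧) hg
      rw [smul_add, smul_smul, ← mul_assoc, Units.inv_mul, one_mul] at hg1
      have hv1 := Submodule.smul_mem _ (↑s⁻¹ : ℂ⟦X⟧) hv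
      obtain ⟨T', v', hv', hv1e⟩ := mem_topSpan_succ.1 hv1
      rw [hv1e] at hg1
      have hlk : l + 1 < k := by omega
      refine ⟨_, Submodule.sub_mem _ (G.a_mem _ hg1)
        (Submodule.smul_mem _ (C (mu (l + 2) + n) * X : ℂ⟦X⟧) hg1),
        X ^ n * S (l + 1) + euler (mu (l + 1) - mu (l + 2) - n) T', ?_,
        T' • S l • e l + aOp ℂ v' - (C (mu (l + 2) + n) * X : ℂ⟦X⟧) • v', ?_, ?_⟩
      · intro h0
        have h1 := congrArg (coeff (p (l + 1) + n)) h0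
        rw [map_add, mul_comm, coeff_mul_X_pow, map_zero] at h1
        -- The exponent p_{l+1} + n is resonant, whatever T' is, because λ_{l+2} - λ_{l+1} = p_{l+1}
        -- - 1. So the nonzero coefficient of b^{p_{l+1}} in S_{l+1} cannot be cancelled.
        have h2 : coeff (p (l + 1) + n) (euler (mu (l + 1) - mu (l + 2) - n) T') = 0 := by
          cases hc : p (l + 1) + n with
          | zero => exact coeff_zero_euler _ _
          | succ c =>
            rw [coeff_succ_euler]
            have h3 := hmu (l + 1) (by omega) hlk
            have h4 : (p (l + 1) + n : ℂ) = c + 1 := by exact_mod_cast hc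
            rw [show (c + (mu (l + 1) - mu (l + 2) - n) : ℂ) = 0 by
              linear_combination -h3 - h4, zero_mul]
        rw [h2, add_zero] at h1
        exact hp (l + 1) (by omega) hlk h1
      · have hav' : aOp ℂ v' ∈ topSpan ℂ e l l :=
          h.topSpan_le l _ (h.aOp_topSpan (show l ≤ k by omega) v' hv')
        have hel : e l ∈ topSpan ℂ e l l := by
          cases l with
          | zero => rw [h.zero]; exact Submodule.zero_mem _
          | succ l => exact mem_topSpan_self (by omega) le_rfl
        exact Submodule.sub_mem _ (Submodule.add_mem _ (Submodule.smul_mem _ _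
          (Submodule.smul_mem _ _ hel)) hav') (Submodule.smul_mem _ _ hv')
      · rw [map_add, map_add, aOp_smul, aOp_smul, h.step (l + 1) hlk, h.step l (by omega)]
        simp only [smul_add, smul_smul, euler_apply, Algebra.algebraMap_self, RingHom.id_apply]
        have hd : (X : ℂ⟦X⟧) ^ 2 * derivative ℂ ((X : ℂ⟦X⟧) ^ n) = C (n : ℂ) * X * X ^ n := by
          ext c
          cases n with
          | zero => simp
          | succ n =>
            rw [Derivation.leibniz_pow]
            simp
            ring_nf
        rw [hd]
        simp only [map_add, map_sub]
        generalize (C (n : ℂ) : ℂ⟦X⟧) = cn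
        generalize (X ^ n : ℂ⟦X⟧) = xn
        simp only [add_smul, sub_smul, add_mul, sub_mul, mul_assoc, mul_comm T', mul_comm xn]
        abel
  -- Climb the flag: the lower terms of g already lie in the submodule, and normality allows
  -- division by the nonzero leading coefficient.
  have hup : ∀ l ≤ i, topSpan ℂ e l l ≤ G.toSubmodule := by
    intro l
    induction l with
    | zero => intro _; rw [topSpan_zero]; exact bot_le
    | succ l ih =>
      intro hl m hm
      have ih := ih (by omega)
      obtain ⟨g, hg, T, hT, v, hv, rfl⟩ := hdown (i - l - 1) l (by omega)
      have hel : e (l + 1) ∈ G.toSubmodule := by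
        apply hnorm T _ hT
        have := Submodule.sub_mem _ hg (ih hv)
        rwa [add_sub_cancel_right] at this
      obtain ⟨T', v', hv', rfl⟩ := mem_topSpan_succ.1 hm
      exact Submodule.add_mem _ (Submodule.smul_mem _ _ hel) (ih hv')
  exact hup i le_rfl

theorem finrank_topSpan (hind : LinearIndependent ℂ⟦X⟧ fun i : Fin k => e (i.1 + 1)) {i : ℕ}
    (hi : i ≤ k) : Module.finrank ℂ⟦X⟧ (topSpan ℂ e i i) = i := by
  rw [topSpan_self]
  have h := hind.comp (Fin.castLE hi) (Fin.castLE_injective hi)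
  rw [show (fun j : Fin i => e (j.1 + 1)) = (fun i : Fin k => e (i.1 + 1)) ∘ Fin.castLE hi from rfl,
    finrank_span_eq_card h, Fintype.card_fin]

end Fibres

/-! ### The parameter of a rank two theme as a ratio of coefficients. -/

section Parameter

variable {E : Type*} [AddCommGroup E] [Module ℂ⟦X⟧ E] [ABAction ℂ E]

theorem isUnit_one_add_C_mul_X_pow (β : ℂ) {p : ℕ} (hp : 1 ≤ p) :
    constantCoeff (1 + C β * X ^ p : ℂ⟦X⟧) ≠ 0 := by
  simp [show p ≠ 0 by omega]

/-- The parameter of a rank two module is read off from any frame. -/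
theorem isParameter_iff {lam₁ : ℚ} {p : ℕ} (hp : 1 ≤ p) {e₁ e₂ : E} {S : ℂ⟦X⟧}
    (hind : ∀ c₁ c₂ : ℂ⟦X⟧, c₁ • e₁ + c₂ • e₂ = 0 → c₁ = 0 ∧ c₂ = 0)
    (hspan : ∀ m : E, ∃ c₁ c₂ : ℂ⟦X⟧, m = c₁ • e₁ + c₂ • e₂)
    (h₁ : aOp ℂ e₁ = (C (lam₁ : ℂ) * X : ℂ⟦X⟧) • e₁)
    (h₂ : aOp ℂ e₂ = (C ((lam₁ + p - 1 : ℚ) : ℂ) * X : ℂ⟦X⟧) • e₂ + S • e₁)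
    (hS : coeff 0 S ≠ 0) (hSp : coeff p S ≠ 0) (β : ℂ) :
    IsParameter E lam₁ p β ↔ β = coeff p S / coeff 0 S := by
  have hcoef : ∀ A T : ℂ⟦X⟧, aOp ℂ (A • e₂ + T • e₁) -
      (C ((lam₁ + p - 1 : ℚ) : ℂ) * X : ℂ⟦X⟧) • (A • e₂ + T • e₁) =
      (euler 0 A) • e₂ + (A * S + euler (1 - p : ℂ) T) • e₁ := by
    intro A T
    have h3 : euler (1 - p : ℂ) T = (X : ℂ⟦X⟧) ^ 2 * derivative ℂ T + C (lam₁ : ℂ) * X * T -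
        C ((lam₁ + p - 1 : ℚ) : ℂ) * X * T := by
      rw [← euler_apply, euler_sub]
      congr 2
      push_cast; ring
    have h4 : euler (0 : ℂ) A = (X : ℂ⟦X⟧) ^ 2 * derivative ℂ A := by simp [euler_apply]
    rw [map_add, aOp_smul, aOp_smul, h₁, h₂, h3, h4]
    generalize (C ((lam₁ + p - 1 : ℚ) : ℂ) : ℂ⟦X⟧) = c
    simp only [smul_add, smul_smul, add_smul, sub_smul, mul_comm]
    abel
  have hcoef₁ : ∀ B D : ℂ⟦X⟧, aOp ℂ (B • e₂ + D • e₁) -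
      (C (lam₁ : ℂ) * X : ℂ⟦X⟧) • (B • e₂ + D • e₁) =
      (euler (p - 1 : ℂ) B) • e₂ + (B * S + euler 0 D) • e₁ := by
    intro B D
    have h3 : euler (p - 1 : ℂ) B = (X : ℂ⟦X⟧) ^ 2 * derivative ℂ B +
        C ((lam₁ + p - 1 : ℚ) : ℂ) * X * B - C (lam₁ : ℂ) * X * B := by
      rw [← euler_apply, euler_sub]
      congr 2
      push_cast; ring
    have h4 : euler (0 : ℂ) D = (X : ℂ⟦X⟧) ^ 2 * derivative ℂ D := by simp [euler_apply]
    rw [map_add, aOp_smul, aOp_smul, h₁, h₂, h3, h4]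
    generalize (C ((lam₁ + p - 1 : ℚ) : ℂ) : ℂ⟦X⟧) = c
    simp only [smul_add, smul_smul, add_smul, sub_smul, mul_comm]
    abel
  have heuler0 : ∀ D : ℂ⟦X⟧, euler 0 D = 0 → D = C (coeff 0 D) := by
    intro D hD
    ext n
    rw [coeff_C]
    split_ifs with hn
    · rw [hn]
    · have := congrArg (coeff (n + 1)) hD
      rw [coeff_succ_euler, add_zero, map_zero] at this
      exact (mul_eq_zero.1 this).resolve_left (by exact_mod_cast hn)
  constructor
  · rintro ⟨-, -, -, e, hgen, e', he', hae'⟩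
    obtain ⟨T, A, rfl⟩ := hspan e
    rw [add_comm (T • e₁), hcoef] at he'
    set Q : ℂ⟦X⟧ := 1 + C β * X ^ p with hQdef
    have hQ : Q * Q⁻¹ = 1 := PowerSeries.mul_inv_cancel _ (isUnit_one_add_C_mul_X_pow β hp)
    rw [smul_add, smul_smul, smul_smul] at he'
    rw [he', hcoef₁, add_comm] at hae'
    obtain ⟨hD, hB⟩ := hind _ _ hae'
    -- The factor n + p - 1 vanishes only for n = 0, p = 1, and there the constant term is zero
    -- because an Euler operator has image in b ℂ[[b]].
    have hB0 : Q⁻¹ * euler 0 A = 0 := by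
      ext n
      have h1 := congrArg (coeff (n + 1)) hB
      rw [coeff_succ_euler, map_zero] at h1
      rcases mul_eq_zero.1 h1 with h1 | h1
      · have : n + p = 1 := by
          have : (n + p : ℂ) = 1 := by linear_combination h1
          exact_mod_cast this
        have hn : n = 0 := by omega
        rw [hn, coeff_zero_eq_constantCoeff_apply, map_mul, ← coeff_zero_eq_constantCoeff_apply (euler 0 A),
          coeff_zero_euler, mul_zero, map_zero]
      · rw [h1, map_zero]
    rw [hB0, zero_mul, zero_add] at hD
    have hA := heuler0 A (by
      calc euler 0 A = Q * (Q⁻¹ * euler 0 A) := by rw [← mul_assoc, hQ, one_mul]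
        _ = 0 := by rw [hB0, mul_zero])
    set c := coeff 0 A
    have hD := heuler0 _ hD
    set d := coeff 0 (Q⁻¹ * (A * S + euler (1 - p : ℂ) T))
    -- The term with T contributes neither to the coefficient of b^0 nor to the resonant one of b^p,
    -- so these two coefficients give c S_0 = d and c S_p = β d.
    have hmain : C c * S + euler (1 - p : ℂ) T = Q * C d := by
      rw [← hD, ← mul_assoc, hQ, one_mul, ← hA]
    have h0 : c * coeff 0 S = d := by
      have := congrArg (coeff 0) hmain
      rw [map_add, coeff_C_mul, coeff_zero_euler, add_zero, coeff_mul_C] at this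
      rw [this, hQdef, coeff_zero_eq_constantCoeff_apply]
      simp [show p ≠ 0 by omega]
    have hpp : c * coeff p S = β * d := by
      have := congrArg (coeff p) hmain
      rw [map_add, coeff_C_mul, coeff_mul_C] at this
      obtain ⟨q, rfl⟩ : ∃ q, p = q + 1 := ⟨p - 1, by omega⟩
      rw [coeff_succ_euler, show (q + (1 - (q + 1 : ℕ)) : ℂ) = 0 by push_cast; ring, zero_mul,
        add_zero] at this
      rw [this, hQdef, map_add, coeff_C_mul, coeff_X_pow_self, coeff_one, if_neg (by omega)]
      ring
    -- If c = 0, the generator lies in ℂ[[b]] e_1, which is stable by `a` and does not contain e_2.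
    have hc : c ≠ 0 := by
      intro hc
      rw [hc, map_zero] at hA
      have h1 : (ABSubmodule.gen (R := ℂ) (T • e₁ + A • e₂)).toSubmodule ≤
          Submodule.span ℂ⟦X⟧ {e₁} := by
        refine ABSubmodule.gen_le ?_ ?_
        · intro m hm
          obtain ⟨s, rfl⟩ := Submodule.mem_span_singleton.1 hm
          rw [aOp_smul, h₁]
          have hs := Submodule.mem_span_singleton_self (R := ℂ⟦X⟧) e₁
          exact Submodule.add_mem _ (Submodule.smul_mem _ _ (Submodule.smul_mem _ _ hs))
            (Submodule.smul_mem _ _ hs)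
        · rw [hA, zero_smul, add_zero]
          exact Submodule.smul_mem _ _ (Submodule.mem_span_singleton_self _)
      rw [hgen] at h1
      obtain ⟨s, hs⟩ := Submodule.mem_span_singleton.1 (h1 (Submodule.mem_top (x := e₂)))
      have := (hind s (-1) (by rw [hs]; simp)).2
      simp at this
    rw [eq_div_iff hS]
    refine mul_left_cancel₀ hc ?_
    rw [hpp, ← h0]; ring
  · intro hβ
    have hβ0 : β ≠ 0 := by rw [hβ]; exact div_ne_zero hSp hS
    set Q : ℂ⟦X⟧ := 1 + C β * X ^ p with hQdef
    have hQ : Q⁻¹ * Q = 1 := PowerSeries.inv_mul_cancel _ (isUnit_one_add_C_mul_X_pow β hp)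
    let b : Module.Basis (Fin 2) ℂ⟦X⟧ E := Module.Basis.mk (v := ![e₁, e₂])
      (LinearIndependent.pair_iff.2 hind) (by
        rintro m -
        obtain ⟨c₁, c₂, rfl⟩ := hspan m
        exact Submodule.add_mem _ (Submodule.smul_mem _ _ (Submodule.subset_span ⟨0, rfl⟩))
          (Submodule.smul_mem _ _ (Submodule.subset_span ⟨1, rfl⟩)))
    -- This T removes every coefficient of S except those of b^0 and b^p. At n + 1 = p the
    -- denominator is zero and the default value 0 is harmless: the Euler term vanishes there, and
    -- the choice of β gives the required coefficient.
    let T : ℂ⟦X⟧ := PowerSeries.mk fun n => - coeff (n + 1) S / ((n : ℂ) + (1 - p))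
    have hT : S + euler (1 - p : ℂ) T = C (coeff 0 S) * Q := by
      ext n
      rw [map_add, coeff_C_mul, hQdef, map_add, coeff_C_mul, coeff_X_pow, coeff_one]
      cases n with
      | zero =>
        rw [coeff_zero_euler, if_pos rfl, if_neg (by omega)]; ring
      | succ n =>
        rw [coeff_succ_euler, if_neg (by omega), coeff_mk]
        split_ifs with hn
        · rw [show ((n : ℂ) + (1 - p)) = 0 by rw [← hn]; push_cast; ring, hβ, hn]
          field_simp
          ring
        · have : ((n : ℂ) + (1 - p)) ≠ 0 := by
            intro h0
            apply hn
            have : ((n + 1 : ℕ) : ℂ) = p := by push_cast; linear_combination h0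
            exact_mod_cast this
          field_simp
          ring
    have hae : aOp ℂ (e₂ + T • e₁) - (C ((lam₁ + p - 1 : ℚ) : ℂ) * X : ℂ⟦X⟧) • (e₂ + T • e₁) =
        (C (coeff 0 S) * Q) • e₁ := by
      have := hcoef 1 T
      rw [one_smul, one_mul, hT] at this
      rw [this, show euler (0 : ℂ) 1 = 0 by rw [← map_one C]; exact euler_zero_C 1, zero_smul,
        zero_add]
    refine ⟨hβ0, Module.Free.of_basis b, by rw [Module.finrank_eq_card_basis b, Fintype.card_fin],
      e₂ + T • e₁, ?_, C (coeff 0 S) • e₁, ?_, ?_⟩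
    · set G := ABSubmodule.gen (R := ℂ) (e₂ + T • e₁)
      have hg := ABSubmodule.self_mem_gen (e₂ + T • e₁)
      have h1 : (C (coeff 0 S) * Q) • e₁ ∈ G.toSubmodule := by
        rw [← hae]
        exact Submodule.sub_mem _ (G.a_mem _ hg) (Submodule.smul_mem _ _ hg)
      have h2 : e₁ ∈ G.toSubmodule := by
        have := Submodule.smul_mem _ (C (coeff 0 S)⁻¹ * Q⁻¹) h1
        rw [smul_smul, show C (coeff 0 S)⁻¹ * Q⁻¹ * (C (coeff 0 S) * Q) =
          (C (coeff 0 S)⁻¹ * C (coeff 0 S)) * (Q⁻¹ * Q) by ring, hQ, ← map_mul,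
          inv_mul_cancel₀ hS, map_one, one_mul, one_smul] at this
        exact this
      have h3 : e₂ ∈ G.toSubmodule := by
        have := Submodule.sub_mem _ hg (Submodule.smul_mem _ T h2)
        rwa [add_sub_cancel_right] at this
      rw [eq_top_iff]
      rintro m -
      obtain ⟨c₁, c₂, rfl⟩ := hspan m
      exact Submodule.add_mem _ (Submodule.smul_mem _ _ h2) (Submodule.smul_mem _ _ h3)
    · rw [hae, smul_smul, show Q⁻¹ * (C (coeff 0 S) * Q) = C (coeff 0 S) * (Q⁻¹ * Q) by ring, hQ,
        mul_one]
    · have := hcoef₁ 0 (C (coeff 0 S))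
      rw [zero_smul, zero_add, euler_zero_C, map_zero] at this
      rw [this]; simp

/-- Modulo the span of e_1, …, e_k the last two frame vectors form a frame of rank two, with the
same series S_{k+1}. -/
theorem IsFrame.isParameter_iff {mu : ℕ → ℂ} {S : ℕ → ℂ⟦X⟧} {k : ℕ} {e : ℕ → E}
    (h : IsFrame mu S (k + 2) e) (htop : topSpan ℂ e (k + 2) (k + 2) = ⊤)
    (hind : LinearIndependent ℂ⟦X⟧ fun i : Fin (k + 2) => e (i.1 + 1))
    {F : ABSubmodule ℂ E} (hF : F.toSubmodule = topSpan ℂ e k k)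
    {lam₁ : ℚ} {p : ℕ} (hp : 1 ≤ p) (h₁ : mu (k + 1) = (lam₁ : ℂ))
    (h₂ : mu (k + 2) = ((lam₁ + p - 1 : ℚ) : ℂ))
    (hS : coeff 0 (S (k + 1)) ≠ 0) (hSp : coeff p (S (k + 1)) ≠ 0) (β : ℂ) :
    IsParameter (E ⧸ F.toSubmodule) lam₁ p β ↔ β = coeff p (S (k + 1)) / coeff 0 (S (k + 1)) := by
  have hmem : ∀ c₁ c₂ : ℂ⟦X⟧, c₁ • e (k + 1) + c₂ • e (k + 2) ∈ topSpan ℂ e k k →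
      c₁ = 0 ∧ c₂ = 0 := by
    intro c₁ c₂ hc
    rw [topSpan_self, Submodule.mem_span_range_iff_exists_fun] at hc
    obtain ⟨c, hc⟩ := hc
    have h' := (linearIndependent_iff_sum_range (f := fun i => e (i + 1))).1 hind
      (fun i => if hi : i < k then c ⟨i, hi⟩ else if i = k then -c₁ else -c₂) (by
        rw [Finset.sum_range_succ, Finset.sum_range_succ, Finset.sum_range]
        simp only [Fin.is_lt, dite_true, lt_irrefl, dite_false, if_true]
        rw [hc, dif_neg (by omega), if_neg (by omega)]
        simp only [neg_smul]
        abel)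
    have hk0 := h' k (by omega)
    have hk1 := h' (k + 1) (by omega)
    rw [dif_neg (by omega), if_pos rfl, neg_eq_zero] at hk0
    rw [dif_neg (by omega), if_neg (by omega), neg_eq_zero] at hk1
    exact ⟨hk0, hk1⟩
  have hek : e k ∈ F.toSubmodule := by
    rw [hF]
    cases k with
    | zero => rw [h.zero]; exact Submodule.zero_mem _
    | succ l => exact mem_topSpan_self (by omega) le_rfl
  refine _root_.isParameter_iff (E := E ⧸ F.toSubmodule)
    (e₁ := Submodule.Quotient.mk (e (k + 1))) (e₂ := Submodule.Quotient.mk (e (k + 2))) hp ?_ ?_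
    ?_ ?_ hS hSp β
  · intro c₁ c₂ hc
    apply hmem
    rw [← hF]
    exact (Submodule.Quotient.mk_eq_zero F.toSubmodule).1 hc
  · intro m
    obtain ⟨m, rfl⟩ := Submodule.Quotient.mk_surjective _ m
    have hm : m ∈ topSpan ℂ e (k + 2) (k + 2) := by rw [htop]; trivial
    obtain ⟨c₂, v, hv, rfl⟩ := mem_topSpan_succ.1 hm
    obtain ⟨c₁, v, hv', rfl⟩ := mem_topSpan_succ.1 hv
    refine ⟨c₁, c₂, ?_⟩
    rw [← hF] at hv'
    have hv0 := (Submodule.Quotient.mk_eq_zero F.toSubmodule).2 hv'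
    rw [Submodule.Quotient.mk_add, Submodule.Quotient.mk_add, hv0, add_zero,
      Submodule.Quotient.mk_smul, Submodule.Quotient.mk_smul, add_comm]
  · have h3 : aOp ℂ (Submodule.Quotient.mk (p := F.toSubmodule) (e (k + 1))) =
        Submodule.Quotient.mk (aOp ℂ (e (k + 1))) := rfl
    have hek0 := (Submodule.Quotient.mk_eq_zero F.toSubmodule).2 hek
    rw [h3, h.step k (by omega), Submodule.Quotient.mk_add, Submodule.Quotient.mk_smul,
      Submodule.Quotient.mk_smul, hek0, smul_zero, add_zero, h₁]
    rfl
  · have h3 : aOp ℂ (Submodule.Quotient.mk (p := F.toSubmodule) (e (k + 2))) =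
        Submodule.Quotient.mk (aOp ℂ (e (k + 2))) := rfl
    rw [h3, h.step (k + 1) (by omega), Submodule.Quotient.mk_add, Submodule.Quotient.mk_smul,
      Submodule.Quotient.mk_smul, h₂]
    rfl

end Parameter

/-! ### The adapted frame of a primitive theme. -/

section ThemeFrame

variable {E : Type*} [AddCommGroup E] [Module ℂ⟦X⟧ E] [ABAction ℂ E]

theorem lamInv_succ (lam₁ : ℚ) (p : ℕ → ℕ) {j : ℕ} (hj : 1 ≤ j) :
    lamInv lam₁ p (j + 1) = lamInv lam₁ p j + p j - 1 := by
  unfold lamInv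
  rw [Finset.sum_Ico_succ_top hj]; ring

theorem lamInv_one (lam₁ : ℚ) (p : ℕ → ℕ) : lamInv lam₁ p 1 = lam₁ := by
  simp [lamInv]

/-- `e` is a basis adapted to the flag of normal submodules of a (family of) themes. -/
structure IsThemeFrame {R : Type*} [CommRing R] [Algebra ℂ R] {M : Type*} [AddCommGroup M]
    [Module R⟦X⟧ M] [ABAction R M] (lam₁ : ℚ) (p : ℕ → ℕ) (k : ℕ) (S : ℕ → R⟦X⟧) (e : ℕ → M) :
    Prop where
  frame : IsFrame (fun j => ((lamInv lam₁ p j : ℚ) : ℂ)) S k e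
  isUnit : ∀ i, 1 ≤ i → i < k → IsUnit (S i)
  isUnit_coeff : ∀ i, 1 ≤ i → i < k → IsUnit (coeff (p i) (S i))
  span : topSpan R e k k = ⊤
  ind : LinearIndependent R⟦X⟧ fun i : Fin k => e (i.1 + 1)

theorem exists_themeFrame {lam lam₁ : ℚ} {p : ℕ → ℕ} {k : ℕ} (hk : 1 ≤ k)
    (h : IsPrimitiveTheme E lam k) (hinv : HasInvariants E k lam₁ p)
    {g : E} (hg : (ABSubmodule.gen (R := ℂ) g).toSubmodule = ⊤) :
    (∃ m : ℕ, lam₁ = lam + m ∧ k - 1 ≤ m) ∧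
    ∃ (S : ℕ → ℂ⟦X⟧) (e : ℕ → E), IsThemeFrame lam₁ p k S e ∧
      ∃ w : ℂ⟦X⟧, IsUnit w ∧ g = w • e k := by
  have ⟨hrank, N, φ, θ, _⟩ := h
  obtain ⟨ψ, hψ⟩ := h.exists_logEmbedding
  obtain ⟨F, hF, hFk, hstep⟩ := hinv
  -- Ξ is finite free over the principal ideal domain ℂ[[b]], and this passes to E. It is needed to
  -- conclude F_0 = 0 from its rank being 0.
  have : Module.Finite ℂ⟦X⟧ (Xi ℂ {lam} N) :=
    inferInstanceAs (Module.Finite ℂ⟦X⟧ (({lam} : Finset ℚ) → Fin (N + 1) → ℂ⟦X⟧))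
  have : Module.Free ℂ⟦X⟧ (Xi ℂ {lam} N) :=
    inferInstanceAs (Module.Free ℂ⟦X⟧ (({lam} : Finset ℚ) → Fin (N + 1) → ℂ⟦X⟧))
  have : Module.Finite ℂ⟦X⟧ E := Module.Finite.equiv θ.symm
  have : Module.Free ℂ⟦X⟧ E := Module.Free.of_equiv θ.symm
  have h0 : (F 0).toSubmodule = ⊥ := Submodule.finrank_eq_zero.1 (hF 0 (by omega)).2
  obtain ⟨e, S, hfr, hS, hw, hspan, hind⟩ := exists_frame_of_chain
    (fun j => ((lamInv lam₁ p j : ℚ) : ℂ)) F h0 k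
    (fun j hj => QuotientIsELam.of_abIso (hstep j hj).1 (hstep j hj).2) g (by rw [hg, hFk])
  obtain ⟨m, hm, hkm⟩ := hψ.exists_shift hfr hind hS hk
  refine ⟨⟨m, ?_, hkm⟩, S, e, ⟨hfr, hS, ?_, ?_, hind⟩, hw⟩
  · rw [lamInv_one] at hm
    exact_mod_cast hm
  · intro i hi1 hi
    refine isUnit_iff_ne_zero.2 (hψ.coeff_ne_zero hfr hind hi1 hi ?_)
    simp only [lamInv_succ lam₁ p hi1]
    push_cast; ring
  · rw [hspan k le_rfl, hFk]

/-- A normal submodule is a member of the flag, and its rank tells which one. -/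
theorem IsThemeFrame.eq_topSpan {lam₁ : ℚ} {p : ℕ → ℕ} {k : ℕ} {S : ℕ → ℂ⟦X⟧} {e : ℕ → E}
    (h : IsThemeFrame lam₁ p k S e) {G : ABSubmodule ℂ E} {j : ℕ} (hG : G.IsNormalOfRank j) :
    G.toSubmodule = topSpan ℂ e j j := by
  obtain ⟨i, hi, hGi⟩ := h.frame.eq_topSpan_of_isNormal (p := p) h.span
    (fun j hj _ => by simp only [lamInv_succ lam₁ p hj]; push_cast; ring)
    (fun j hj1 hj => (h.isUnit_coeff j hj1 hj).ne_zero) G hG.1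
  have := finrank_topSpan h.ind hi
  rw [← hGi, hG.2] at this
  rw [hGi, this]

end ThemeFrame

/-! ### The differential operator attached to a relation among iterates of `a`. -/

section RecOp

variable {R : Type*} [CommRing R]

/-- The operator `T ↦ A^j T - ∑_{l<j} d_l A^l T`, where `A = euler c`. -/
def recOp (c : R) (j : ℕ) (d : ℕ → R⟦X⟧) : R⟦X⟧ →ₗ[R] R⟦X⟧ :=
  (euler c) ^ j - ∑ l ∈ Finset.range j, (LinearMap.mulLeft R (d l)) ∘ₗ (euler c) ^ l

theorem recOp_apply (c : R) (j : ℕ) (d : ℕ → R⟦X⟧) (T : R⟦X⟧) :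
    recOp c j d T = (euler c)^[j] T - ∑ l ∈ Finset.range j, d l * (euler c)^[l] T := by
  simp [recOp, Module.End.pow_apply]

theorem map_euler_iterate {R' : Type*} [CommRing R'] (f : R →+* R') (c : R) (T : R⟦X⟧) (l : ℕ) :
    PowerSeries.map f ((euler c)^[l] T) = (euler (f c))^[l] (PowerSeries.map f T) := by
  have h : Function.Semiconj (PowerSeries.map f) (euler c) (euler (f c)) := map_euler f c
  exact h.iterate_right l T

theorem map_recOp {R' : Type*} [CommRing R'] (f : R →+* R') (c : R) (j : ℕ) (d : ℕ → R⟦X⟧)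
    (T : R⟦X⟧) : PowerSeries.map f (recOp c j d T) =
      recOp (f c) j (fun l => PowerSeries.map f (d l)) (PowerSeries.map f T) := by
  simp only [recOp_apply, map_sub, map_sum, map_mul, map_euler_iterate]

end RecOp

/-! ### Factorisation of this operator in one fibre. -/

section PointRec

variable {N : Type*} [AddCommGroup N] [Module ℂ⟦X⟧ N] [ABAction ℂ N]
  {mu : ℕ → ℂ} {S : ℕ → ℂ⟦X⟧} {e : ℕ → N} {j : ℕ}

/-- The defect of a linear form `π` to be compatible with the operators `a`. -/
def aDefect (c : ℂ) (π : N →ₗ[ℂ⟦X⟧] ℂ⟦X⟧) : N →ₗ[ℂ⟦X⟧] ℂ⟦X⟧ where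
  toFun m := euler c (π m) - π (aOp ℂ m)
  map_add' m n := by simp only [map_add]; ring
  map_smul' T m := by
    rw [aOp_smul, map_add, π.map_smul, π.map_smul, π.map_smul]
    simp only [smul_eq_mul, euler_mul, RingHom.id_apply]
    ring

theorem aDefect_apply (c : ℂ) (π : N →ₗ[ℂ⟦X⟧] ℂ⟦X⟧) (m : N) :
    aDefect c π m = euler c (π m) - π (aOp ℂ m) := rfl

/-- Put u = w e_j and A = `euler (mu j)`, and choose a linear form π with π(a^l u) = A^l T for l <
j. Its defect A π - π a is ℂ[[b]]-linear and vanishes on a^l u for l < j - 1, hence on e_2, …, e_j: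
these are the first order relations between the q_i = π(e_i). On a^{j-1} u, whose e_1-component is a
unit, the defect is `recOp` applied to T. So `recOp` is, up to units, a product of first order
operators. -/
theorem IsFrame.recOp_eq (h : IsFrame mu S j e) (hj : 1 ≤ j)
    (hS : ∀ i, 1 ≤ i → i < j → IsUnit (S i)) {w : ℂ⟦X⟧} (hw : IsUnit w) {d : ℕ → ℂ⟦X⟧}
    (hd : (aOp ℂ)^[j] (w • e j) = ∑ l ∈ Finset.range j, d l • (aOp ℂ)^[l] (w • e j))
    (hext : ∀ t : ℕ → ℂ⟦X⟧, ∃ π : N →ₗ[ℂ⟦X⟧] ℂ⟦X⟧, ∀ l < j, π ((aOp ℂ)^[l] (w • e j)) = t l)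
    (T : ℂ⟦X⟧) : ∃ q : ℕ → ℂ⟦X⟧, T = w * q j ∧
      (∀ i, 1 ≤ i → i < j → S i * q i = euler (mu j - mu (i + 1)) (q (i + 1))) ∧
      ∃ s : ℂ⟦X⟧, IsUnit s ∧ recOp (mu j) j d T = s * euler (mu j - mu 1) (q 1) := by
  obtain ⟨π, hπ⟩ := hext fun l => (euler (mu j))^[l] T
  have h0 : ∀ l, l + 1 < j → aDefect (mu j) π ((aOp ℂ)^[l] (w • e j)) = 0 := by
    intro l hl
    rw [aDefect_apply, ← Function.iterate_succ_apply' (aOp ℂ), hπ l (by omega), hπ (l + 1) hl,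
      Function.iterate_succ_apply', sub_self]
  have hker : topSpan ℂ e j (j - 1) ≤ LinearMap.ker (aDefect (mu j) π) := by
    rw [← h.orbitSpan_eq le_rfl hS hw (j - 1) (by omega)]
    refine Submodule.span_le.2 ?_
    rintro _ ⟨l, hl, rfl⟩
    simp only [Set.mem_Iio] at hl
    exact h0 l (by omega)
  have hstep : ∀ i < j, aDefect (mu j) π (e (i + 1)) =
      euler (mu j - mu (i + 1)) (π (e (i + 1))) - S i * π (e i) := by
    intro i hi
    rw [aDefect_apply, h.step i hi, map_add, map_smul, map_smul, ← euler_sub]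
    simp only [smul_eq_mul, Algebra.algebraMap_self, RingHom.id_apply]
    ring
  refine ⟨fun i => π (e i), ?_, ?_, ?_⟩
  · have := hπ 0 (by omega)
    simp only [Function.iterate_zero, id_eq, map_smul, smul_eq_mul] at this
    exact this.symm
  · intro i hi1 hi
    have h1 : e (i + 1) ∈ topSpan ℂ e j (j - 1) := by
      have := mem_topSpan (R := ℂ) e j (show j - (i + 1) < j - 1 by omega)
      rwa [show j - (j - (i + 1)) = i + 1 by omega] at this
    have h2 := LinearMap.mem_ker.1 (hker h1)
    rw [hstep i hi, sub_eq_zero] at h2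
    exact h2.symm
  · obtain ⟨s, hs, v, hv, heq⟩ := h.iterate_smul le_rfl hS hw (j - 1) (by omega)
    refine ⟨s, hs, ?_⟩
    have h1 : aDefect (mu j) π ((aOp ℂ)^[j - 1] (w • e j)) = recOp (mu j) j d T := by
      rw [aDefect_apply, ← Function.iterate_succ_apply' (aOp ℂ), hπ (j - 1) (by omega),
        ← Function.iterate_succ_apply' (euler (mu j)), show (j - 1).succ = j by omega, hd, map_sum,
        recOp_apply]
      congr 1
      refine Finset.sum_congr rfl fun l hl => ?_
      rw [map_smul, hπ l (Finset.mem_range.1 hl), smul_eq_mul]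
    rw [← h1, heq, map_add, LinearMap.mem_ker.1 (hker hv), add_zero, map_smul,
      show j - (j - 1) = 0 + 1 by omega, hstep 0 (by omega), h.zero, map_zero, mul_zero, sub_zero,
      smul_eq_mul]

variable {p : ℕ → ℕ}

/-- The difference is p_i + ⋯ + p_{j-1}: each step from i to i + 1 compensates one -1. -/
theorem exists_nat_of_step (hmu : ∀ i, 1 ≤ i → i < j → mu (i + 1) = mu i + p i - 1) (l : ℕ) :
    ∀ i, 1 ≤ i → i + l = j → ∃ n : ℕ, mu j + l = mu i + n := by
  induction l with
  | zero => intro i _ hi; exact ⟨0, by rw [← hi]; simp⟩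
  | succ l ih =>
    intro i hi1 hi
    obtain ⟨n, hn⟩ := ih (i + 1) (by omega) (by omega)
    refine ⟨n + p i, ?_⟩
    rw [hmu i hi1 (by omega)] at hn
    push_cast
    linear_combination hn

/-- All three properties are read off the factorisation. For T = w one has q_j = 1, killed by the
first factor. In general each factor adds one to the order, j in all. On b^n the successive leading
coefficients are multiplied by n + l + λ_j - λ_{j-l}, which is n plus a natural number and so
nonzero once n ≥ 1. -/
theorem IsFrame.recOp_props (h : IsFrame mu S j e) (hj : 1 ≤ j)
    (hS : ∀ i, 1 ≤ i → i < j → IsUnit (S i)) {w : ℂ⟦X⟧} (hw : IsUnit w) {d : ℕ → ℂ⟦X⟧}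
    (hd : (aOp ℂ)^[j] (w • e j) = ∑ l ∈ Finset.range j, d l • (aOp ℂ)^[l] (w • e j))
    (hext : ∀ t : ℕ → ℂ⟦X⟧, ∃ π : N →ₗ[ℂ⟦X⟧] ℂ⟦X⟧, ∀ l < j, π ((aOp ℂ)^[l] (w • e j)) = t l)
    (hmu : ∀ i, 1 ≤ i → i < j → mu (i + 1) = mu i + p i - 1) :
    recOp (mu j) j d w = 0 ∧
    (∀ (n : ℕ) (T : ℂ⟦X⟧), X ^ n ∣ T → X ^ (n + j) ∣ recOp (mu j) j d T) ∧
    ∀ n, 1 ≤ n → coeff (n + j) (recOp (mu j) j d (X ^ n)) ≠ 0 := by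
  refine ⟨?_, ?_, ?_⟩
  · obtain ⟨q, hq, hstep, s, -, hs⟩ := h.recOp_eq hj hS hw hd hext w
    have hqj : q j = 1 := by
      obtain ⟨w, rfl⟩ := hw
      have := congrArg (fun z => (↑w⁻¹ : ℂ⟦X⟧) * z) hq
      simp only [Units.inv_mul, ← mul_assoc, one_mul] at this
      exact this.symm
    have he1 : ∀ i, 1 ≤ i → i ≤ j → euler (mu j - mu i) (q i) = 0 := by
      have : ∀ l i, 1 ≤ i → i + l = j → euler (mu j - mu i) (q i) = 0 := by
        intro l
        induction l with
        | zero =>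
          intro i _ hi
          obtain rfl : i = j := by omega
          rw [hqj, sub_self, ← map_one C, euler_zero_C]
        | succ l ih =>
          intro i hi1 hi
          have h1 := hstep i hi1 (by omega)
          rw [ih (i + 1) (by omega) (by omega)] at h1
          rw [(hS i hi1 (by omega)).mul_right_eq_zero.1 h1, map_zero]
      intro i hi1 hi
      exact this (j - i) i hi1 (by omega)
    rw [hs, he1 1 le_rfl hj, mul_zero]
  · intro n T hT
    obtain ⟨q, hq, hstep, s, -, hs⟩ := h.recOp_eq hj hS hw hd hext T
    have : ∀ l i, 1 ≤ i → i + l = j → X ^ (n + l) ∣ q i := by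
      intro l
      induction l with
      | zero =>
        intro i _ hi
        obtain rfl : i = j := by omega
        rw [hq] at hT
        exact hw.dvd_mul_left.1 hT
      | succ l ih =>
        intro i hi1 hi
        have h1 := X_pow_dvd_euler (mu j - mu (i + 1)) (ih (i + 1) (by omega) (by omega))
        rw [← hstep i hi1 (by omega)] at h1
        exact (hS i hi1 (by omega)).dvd_mul_left.1 h1
    rw [hs]
    refine Dvd.dvd.mul_left ?_ _
    have := X_pow_dvd_euler (mu j - mu 1) (this (j - 1) 1 le_rfl (by omega))
    rwa [show n + (j - 1) + 1 = n + j by omega] at this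
  · intro n hn
    obtain ⟨q, hq, hstep, s, hsu, hs⟩ := h.recOp_eq hj hS hw hd hext (X ^ n)
    have hne : ∀ l i, 1 ≤ i → i + l = j → ((n + l : ℕ) + (mu j - mu i) : ℂ) ≠ 0 := by
      intro l i hi1 hi h0
      obtain ⟨m, hm⟩ := exists_nat_of_step hmu l i hi1 hi
      have : ((n + m : ℕ) : ℂ) = 0 := by push_cast at h0 ⊢; linear_combination h0 - hm
      have := Nat.cast_eq_zero.1 this
      omega
    have hunit : ∀ (s T : ℂ⟦X⟧) (l : ℕ), IsUnit s → X ^ l ∣ T →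
        coeff l (s * T) = coeff 0 s * coeff l T := by
      rintro s _ l - ⟨T, rfl⟩
      have := coeff_X_pow_mul T l 0
      have h2 := coeff_X_pow_mul (s * T) l 0
      rw [zero_add] at this h2
      rw [mul_left_comm, this, h2]
      simp [coeff_zero_eq_constantCoeff_apply]
    have : ∀ l i, 1 ≤ i → i + l = j → X ^ (n + l) ∣ q i ∧ coeff (n + l) (q i) ≠ 0 := by
      intro l
      induction l with
      | zero =>
        intro i _ hi
        obtain rfl : i = j := by omega
        have hd1 : X ^ n ∣ q i := hw.dvd_mul_left.1 (hq ▸ dvd_rfl)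
        refine ⟨hd1, fun h0 => ?_⟩
        have h1 := congrArg (coeff n) hq
        rw [add_zero] at h0
        rw [hunit _ _ _ hw hd1, h0, coeff_X_pow_self, mul_zero] at h1
        exact one_ne_zero h1
      | succ l ih =>
        intro i hi1 hi
        obtain ⟨ih1, ih2⟩ := ih (i + 1) (by omega) (by omega)
        have h1 := X_pow_dvd_euler (mu j - mu (i + 1)) ih1
        have hSi := hS i hi1 (by omega)
        rw [← hstep i hi1 (by omega)] at h1
        have h2 := hSi.dvd_mul_left.1 h1
        refine ⟨h2, fun h0 => ?_⟩
        have h3 := congrArg (coeff (n + l + 1)) (hstep i hi1 (by omega))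
        rw [hunit _ _ _ hSi h2, show n + l + 1 = n + (l + 1) by ring, h0, mul_zero,
          show n + (l + 1) = n + l + 1 by ring, coeff_succ_euler] at h3
        exact mul_ne_zero (hne l (i + 1) (by omega) (by omega)) ih2 h3.symm
    obtain ⟨h1, h2⟩ := this (j - 1) 1 le_rfl (by omega)
    have h3 := X_pow_dvd_euler (mu j - mu 1) h1
    rw [hs, show n + j = n + (j - 1) + 1 by omega, hunit _ _ _ hsu h3, coeff_succ_euler]
    exact mul_ne_zero (isUnit_series_iff.1 hsu).ne_zero
      (mul_ne_zero (hne (j - 1) 1 le_rfl (by omega)) h2)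

end PointRec

/-! ### Holomorphic dependence of the frame on the point. -/

section Family

variable {R : Type*} [CommRing R] [Algebra ℂ R] {Pt : Type*} (ev : Pt → R →ₐ[ℂ] ℂ)
  {M : Type*} [AddCommGroup M] [Module R⟦X⟧ M] [ABAction R M]
  {N : Pt → Type*} [∀ x, AddCommGroup (N x)] [∀ x, Module ℂ⟦X⟧ (N x)] [∀ x, ABAction ℂ (N x)]

/-- `M` is a free `R[[b]]`-module with basis `f`, `R` is a ring of functions on `Pt` in which the
nowhere vanishing functions are invertible, and `N x` is the fibre of `M` at `x`. -/
structure IsFibreFamily (val : ∀ x, M →+ N x) {k : ℕ} (f : Module.Basis (Fin k) R⟦X⟧ M) :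
    Prop where
  sep : ∀ r, (∀ x, ev x r = 0) → r = 0
  unit : ∀ r, (∀ x, ev x r ≠ 0) → IsUnit r
  val_smul : ∀ x (S : R⟦X⟧) m, val x (S • m) = PowerSeries.map (ev x).toRingHom S • val x m
  val_a : ∀ x m, val x (aOp R m) = aOp ℂ (val x m)
  ind : ∀ x, LinearIndependent ℂ⟦X⟧ (val x ∘ f)
  span : ∀ x, Submodule.span ℂ⟦X⟧ (Set.range (val x ∘ f)) = ⊤

variable {ev}

/-- Solution of a recursion with holomorphic coefficients. -/
theorem exists_series_of_recursion (hunit : ∀ r, (∀ x, ev x r ≠ 0) → IsUnit r) (L : ℕ → R⟦X⟧)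
    (T : Pt → ℂ⟦X⟧) (d : ℕ) (h0 : ∀ x, coeff 0 (T x) = 1)
    (hne : ∀ x n, 1 ≤ n → ev x (coeff (n + d) (L n)) ≠ 0)
    (heq : ∀ x n, ∑ i ∈ Finset.range (n + 1), coeff i (T x) * ev x (coeff (n + d) (L i)) = 0) :
    ∃ T' : R⟦X⟧, ∀ x, PowerSeries.map (ev x).toRingHom T' = T x := by
  have key : ∀ n, ∃ r : R, ∀ x, ev x r = coeff n (T x) := by
    intro n
    induction n using Nat.strong_induction_on with
    | _ n ih =>
      rcases Nat.eq_zero_or_pos n with rfl | hn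
      · exact ⟨1, fun x => by rw [map_one, h0]⟩
      · choose! r hr using ih
        obtain ⟨c, hc⟩ := hunit (coeff (n + d) (L n)) fun x => hne x n hn
        refine ⟨-(↑c⁻¹ * ∑ i ∈ Finset.range n, r i * coeff (n + d) (L i)), fun x => ?_⟩
        have h1 := heq x n
        rw [Finset.sum_range_succ, ← hc] at h1
        have h2 : ∑ i ∈ Finset.range n, coeff i (T x) * ev x (coeff (n + d) (L i)) =
            ev x (∑ i ∈ Finset.range n, r i * coeff (n + d) (L i)) := by
          rw [map_sum]
          refine Finset.sum_congr rfl fun i hi => ?_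
          rw [map_mul, hr i (Finset.mem_range.1 hi)]
        have h3 : ev x ↑c⁻¹ * ev x ↑c = 1 := by rw [← map_mul, Units.inv_mul, map_one]
        rw [h2] at h1
        rw [map_neg, map_mul]
        linear_combination -(ev x ↑c⁻¹) * h1 + coeff n (T x) * h3
  choose r hr using key
  refine ⟨PowerSeries.mk r, fun x => PowerSeries.ext fun n => ?_⟩
  rw [coeff_map, coeff_mk]
  exact hr n x

variable {val : ∀ x, M →+ N x} {k : ℕ} {f : Module.Basis (Fin k) R⟦X⟧ M}

theorem IsFibreFamily.series_ext (hf : IsFibreFamily ev val f) {S T : R⟦X⟧}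
    (h : ∀ x, PowerSeries.map (ev x).toRingHom S = PowerSeries.map (ev x).toRingHom T) : S = T := by
  refine PowerSeries.ext fun n => sub_eq_zero.1 (hf.sep _ fun x => ?_)
  have := congrArg (coeff n) (h x)
  rw [coeff_map, coeff_map] at this
  rw [map_sub]
  exact sub_eq_zero.2 this

theorem IsFibreFamily.val_sum (hf : IsFibreFamily ev val f) (x : Pt) {ι : Type*} (s : Finset ι)
    (c : ι → R⟦X⟧) (m : ι → M) : val x (∑ i ∈ s, c i • m i) =
      ∑ i ∈ s, PowerSeries.map (ev x).toRingHom (c i) • val x (m i) := by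
  rw [map_sum]
  simp only [hf.val_smul]

/-- The basis of values in a fibre. -/
def IsFibreFamily.basis (hf : IsFibreFamily ev val f) (x : Pt) :
    Module.Basis (Fin k) ℂ⟦X⟧ (N x) := Module.Basis.mk (hf.ind x) (hf.span x).ge

theorem IsFibreFamily.basis_repr (hf : IsFibreFamily ev val f) (x : Pt) (m : M) (i : Fin k) :
    (hf.basis x).repr (val x m) i = PowerSeries.map (ev x).toRingHom (f.repr m i) := by
  have h : val x m = ∑ i, PowerSeries.map (ev x).toRingHom (f.repr m i) • hf.basis x i := by
    conv_lhs => rw [← f.sum_repr m]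
    rw [hf.val_sum]
    refine Finset.sum_congr rfl fun i _ => ?_
    rw [IsFibreFamily.basis, Module.Basis.mk_apply]; rfl
  rw [h, Module.Basis.repr_sum_self]

theorem IsFibreFamily.ext (hf : IsFibreFamily ev val f) {m m' : M} (h : ∀ x, val x m = val x m') :
    m = m' := by
  refine f.ext_elem fun i => hf.series_ext fun x => ?_
  rw [← hf.basis_repr, ← hf.basis_repr, h]

theorem IsFibreFamily.isUnit_series (hf : IsFibreFamily ev val f) {S : R⟦X⟧}
    (h : ∀ x, IsUnit (PowerSeries.map (ev x).toRingHom S)) : IsUnit S := by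
  rw [isUnit_series_iff]
  refine hf.unit _ fun x => ?_
  have := (isUnit_series_iff.1 (h x)).ne_zero
  rwa [coeff_map] at this

theorem IsFibreFamily.map_det (hf : IsFibreFamily ev val f) (m : Fin k → M) (x : Pt) :
    PowerSeries.map (ev x).toRingHom (f.det m) = (hf.basis x).det (val x ∘ m) := by
  rw [Module.Basis.det_apply, Module.Basis.det_apply, RingHom.map_det]
  congr 1
  ext1 i j
  rw [RingHom.mapMatrix_apply, Matrix.map_apply, Module.Basis.toMatrix_apply,
    Module.Basis.toMatrix_apply, Function.comp_apply, hf.basis_repr]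

/-- Sections which give a basis at every point form a basis. -/
theorem IsFibreFamily.basis_of_fibre (hf : IsFibreFamily ev val f) (m : Fin k → M)
    (h : ∀ x, LinearIndependent ℂ⟦X⟧ (val x ∘ m) ∧
      Submodule.span ℂ⟦X⟧ (Set.range (val x ∘ m)) = ⊤) :
    LinearIndependent R⟦X⟧ m ∧ Submodule.span R⟦X⟧ (Set.range m) = ⊤ := by
  rw [Module.Basis.is_basis_iff_det f]
  refine hf.isUnit_series fun x => ?_
  rw [hf.map_det, ← Module.Basis.is_basis_iff_det (hf.basis x)]
  exact h x

variable {lam₁ : ℚ} {p : ℕ → ℕ} {Sb : Pt → ℕ → ℂ⟦X⟧} {eb : ∀ x, ℕ → N x}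

theorem lamInv_succ_cast (lam₁ : ℚ) (p : ℕ → ℕ) {j : ℕ} (hj : 1 ≤ j) :
    ((lamInv lam₁ p (j + 1) : ℚ) : ℂ) = ((lamInv lam₁ p j : ℚ) : ℂ) + p j - 1 := by
  rw [lamInv_succ lam₁ p hj]; push_cast; ring

/-- The frames of the fibres are chosen without any regularity in x, so w is a priori arbitrary. But
up to a constant it is the solution of a differential equation with coefficients in R[[b]], and its
normalised solution is given by a recursion in R. -/
theorem IsFibreFamily.exists_normalisation (hf : IsFibreFamily ev val f)
    (hb : ∀ x, IsThemeFrame lam₁ p k (Sb x) (eb x)) {j : ℕ} (hj1 : 1 ≤ j) (hjk : j ≤ k)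
    (h : ℕ → M) (hh : ∀ i, j < i → i ≤ k → ∀ x, ∃ c : ℂ, c ≠ 0 ∧ val x (h i) = C c • eb x i)
    (u : M) (w : Pt → ℂ⟦X⟧) (hw : ∀ x, IsUnit (w x)) (hu : ∀ x, val x u = w x • eb x j) :
    ∃ T : R⟦X⟧, IsUnit T ∧ ∀ x, ∃ c : ℂ, c ≠ 0 ∧
      w x = C c * PowerSeries.map (ev x).toRingHom T := by
  have hfr : ∀ x, IsFrame _ (Sb x) j (eb x) := fun x => (hb x).frame.mono hjk
  have hS : ∀ x i, 1 ≤ i → i < j → IsUnit (Sb x i) :=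
    fun x i hi1 hi => (hb x).isUnit i hi1 (by omega)
  have hval : ∀ x l, val x ((aOp R)^[l] u) = (aOp ℂ)^[l] (w x • eb x j) := by
    intro x l
    have : Function.Semiconj (val x) (aOp R) (aOp ℂ) := hf.val_a x
    rw [(this.iterate_right l) u, hu]
  -- The iterates of u span the lower flag in each fibre and h supplies the upper vectors; a family
  -- that is a basis in every fibre is a basis over R[[b]], so a^j u has coordinates d_l in R[[b]].
  let m : ℕ → M := fun i => if i < j then (aOp R)^[i] u else h (i + 1)
  have hspan : ∀ x, Submodule.span ℂ⟦X⟧ (Set.range fun i : Fin k => val x (m i.1)) = ⊤ := by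
    intro x
    rw [eq_top_iff, ← (hb x).span, topSpan_self]
    refine Submodule.span_le.2 ?_
    rintro _ ⟨i, rfl⟩
    simp only [SetLike.mem_coe]
    by_cases hi : i.1 < j
    · have h1 : eb x (i.1 + 1) ∈ topSpan ℂ (eb x) j j := mem_topSpan_self (by omega) (by omega)
      rw [← (hfr x).orbitSpan_eq le_rfl (hS x) (hw x) j le_rfl, orbitSpan_eq_span] at h1
      refine Submodule.span_le.2 ?_ h1
      rintro _ ⟨l, rfl⟩
      refine Submodule.subset_span ⟨⟨l.1, by omega⟩, ?_⟩
      simp only [m, if_pos l.2, hval]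
    · obtain ⟨c, hc, hce⟩ := hh (i.1 + 1) (by omega) (by omega) x
      have h1 : val x (m i.1) ∈ Submodule.span ℂ⟦X⟧ (Set.range fun i : Fin k => val x (m i.1)) :=
        Submodule.subset_span ⟨i, rfl⟩
      simp only [m, if_neg hi, hce] at h1
      have h2 := Submodule.smul_mem _ (C c⁻¹ : ℂ⟦X⟧) h1
      rwa [smul_smul, ← map_mul, inv_mul_cancel₀ hc, map_one, one_smul] at h2
  have hind : ∀ x, LinearIndependent ℂ⟦X⟧ fun i : Fin k => val x (m i.1) := fun x =>
    linearIndependent_of_span_eq (hb x).ind (by rw [hspan, ← topSpan_self, (hb x).span])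
  obtain ⟨hmi, hms⟩ := hf.basis_of_fibre (fun i : Fin k => m i.1) fun x => ⟨hind x, hspan x⟩
  let b := Module.Basis.mk hmi hms.ge
  let d : ℕ → R⟦X⟧ := fun l => if hl : l < k then b.repr ((aOp R)^[j] u) ⟨l, hl⟩ else 0
  have hd : (aOp R)^[j] u = ∑ l ∈ Finset.range k, d l • m l := by
    conv_lhs => rw [← b.sum_repr ((aOp R)^[j] u)]
    rw [Finset.sum_range]
    refine Finset.sum_congr rfl fun l _ => ?_
    simp [d, b]
  -- In each fibre a^j u stays in the lower flag, so only the coordinates with l < j occur there.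
  have hdx : ∀ x, (aOp ℂ)^[j] (w x • eb x j) = ∑ l ∈ Finset.range j,
      PowerSeries.map (ev x).toRingHom (d l) • (aOp ℂ)^[l] (w x • eb x j) := by
    intro x
    have h1 : (aOp ℂ)^[j] (w x • eb x j) ∈ orbitSpan ℂ (w x • eb x j) j := by
      rw [(hfr x).orbitSpan_eq le_rfl (hS x) (hw x) j le_rfl]
      exact (hfr x).topSpan_le j _ ((hfr x).iterate_mem le_rfl (w x) j)
    rw [orbitSpan_eq_span, Submodule.mem_span_range_iff_exists_fun] at h1
    obtain ⟨c, hc⟩ := h1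
    let c' : ℕ → ℂ⟦X⟧ := fun l => if hl : l < j then c ⟨l, hl⟩ else 0
    have hc' : ∑ l ∈ Finset.range j, c' l • (aOp ℂ)^[l] (w x • eb x j) =
        (aOp ℂ)^[j] (w x • eb x j) := by
      rw [← hc, Finset.sum_range]
      refine Finset.sum_congr rfl fun l _ => ?_
      simp [c']
    have hc2 : ∑ l ∈ Finset.range k, c' l • val x (m l) = (aOp ℂ)^[j] (w x • eb x j) := by
      rw [← hc', ← Finset.sum_subset (Finset.range_mono hjk)]
      · refine Finset.sum_congr rfl fun l hl => ?_
        simp only [m, if_pos (Finset.mem_range.1 hl), hval]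
      · intro l _ hl
        have : ¬ l < j := by simpa using hl
        simp only [c', dif_neg this, zero_smul]
    have hc3 : ∑ l ∈ Finset.range k, PowerSeries.map (ev x).toRingHom (d l) • val x (m l) =
        (aOp ℂ)^[j] (w x • eb x j) := by
      rw [← hval, hd, hf.val_sum]
    have hz := (linearIndependent_iff_sum_range (f := fun i => val x (m i))).1 (hind x)
      (fun l => PowerSeries.map (ev x).toRingHom (d l) - c' l) (by
        simp only [sub_smul, Finset.sum_sub_distrib]
        rw [hc2, hc3, sub_self])
    rw [← hc']
    refine Finset.sum_congr rfl fun l hl => ?_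
    rw [sub_eq_zero.1 (hz l (by have := Finset.mem_range.1 hl; omega))]
  have hext : ∀ x, ∀ t : ℕ → ℂ⟦X⟧, ∃ π : N x →ₗ[ℂ⟦X⟧] ℂ⟦X⟧,
      ∀ l < j, π ((aOp ℂ)^[l] (w x • eb x j)) = t l := by
    intro x t
    let bx := Module.Basis.mk (hind x) (hspan x).ge
    refine ⟨bx.constr ℂ⟦X⟧ fun i => t i.1, fun l hl => ?_⟩
    have h1 : (aOp ℂ)^[l] (w x • eb x j) = bx ⟨l, by omega⟩ := by
      rw [Module.Basis.mk_apply, ← hval]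
      simp only [m, if_pos hl]
    rw [h1, Module.Basis.constr_basis]
  set c₀ : ℂ := ((lamInv lam₁ p j : ℚ) : ℂ)
  have hprops := fun x => (hfr x).recOp_props hj1 (hS x) (hw x) (hdx x) (hext x) (p := p)
    (fun i hi1 _ => lamInv_succ_cast lam₁ p hi1)
  have hw0 : ∀ x, coeff 0 (w x) ≠ 0 := fun x => (isUnit_series_iff.1 (hw x)).ne_zero
  have hevL : ∀ x n (T : R⟦X⟧), ev x (coeff n (recOp (algebraMap ℂ R c₀) j d T)) =
      coeff n (recOp c₀ j (fun l => PowerSeries.map (ev x).toRingHom (d l))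
        (PowerSeries.map (ev x).toRingHom T)) := by
    intro x n T
    have := congrArg (coeff n) (map_recOp (ev x).toRingHom (algebraMap ℂ R c₀) j d T)
    rw [coeff_map] at this
    have h2 : (ev x).toRingHom (algebraMap ℂ R c₀) = c₀ := (ev x).commutes c₀
    rw [h2] at this
    exact this
  -- Since L raises the order by j, the coefficient of b^{n+j} in L(w(x)/w(x)(0)) = 0 involves only
  -- the first n + 1 coefficients of the series, the last one with a nowhere vanishing factor when n
  -- ≥ 1.
  obtain ⟨T, hT⟩ := exists_series_of_recursion hf.unit
    (fun n => recOp (algebraMap ℂ R c₀) j d (X ^ n))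
    (fun x => (coeff 0 (w x))⁻¹ • w x) j
    (fun x => by rw [coeff_smul, smul_eq_mul, inv_mul_cancel₀ (hw0 x)])
    (fun x n hn => by
      rw [hevL, map_pow, map_X]
      exact (hprops x).2.2 n hn)
    (fun x n => by
      set Tx : ℂ⟦X⟧ := (coeff 0 (w x))⁻¹ • w x with hTx
      set L := recOp c₀ j (fun l => PowerSeries.map (ev x).toRingHom (d l)) with hL
      have h2 : L Tx = 0 := by
        rw [hTx, map_smul, (hprops x).1, smul_zero]
      clear_value Tx
      have h1 : ∑ i ∈ Finset.range (n + 1), coeff i Tx *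
          ev x (coeff (n + j) (recOp (algebraMap ℂ R c₀) j d (X ^ i))) =
          coeff (n + j) (L (∑ i ∈ Finset.range (n + 1), coeff i Tx • (X : ℂ⟦X⟧) ^ i)) := by
        rw [map_sum, map_sum]
        refine Finset.sum_congr rfl fun i _ => ?_
        rw [hevL, map_pow, map_X, map_smul, coeff_smul, smul_eq_mul]
      have h3 : X ^ (n + 1) ∣ Tx - ∑ i ∈ Finset.range (n + 1), coeff i Tx • (X : ℂ⟦X⟧) ^ i := by
        rw [X_pow_dvd_iff]
        intro l hl
        rw [map_sub, map_sum, Finset.sum_eq_single l]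
        · rw [coeff_smul, coeff_X_pow_self, smul_eq_mul, mul_one, sub_self]
        · intro i _ hi
          rw [coeff_smul, coeff_X_pow, if_neg (Ne.symm hi), smul_zero]
        · intro hl'
          exact absurd (Finset.mem_range.2 hl) hl'
      have h4 := (hprops x).2.1 _ _ h3
      rw [map_sub, h2, zero_sub, X_pow_dvd_iff] at h4
      have h5 := h4 (n + j) (by omega)
      rw [map_neg, neg_eq_zero] at h5
      rw [h1]
      exact h5)
  have hT' : ∀ x, w x = C (coeff 0 (w x)) * PowerSeries.map (ev x).toRingHom T := by
    intro x
    rw [hT, ← smul_eq_C_mul, smul_smul, mul_inv_cancel₀ (hw0 x), one_smul]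
  refine ⟨T, hf.isUnit_series fun x => ?_, fun x => ⟨_, hw0 x, hT' x⟩⟩
  rw [hT, isUnit_series_iff, coeff_smul, smul_eq_mul, inv_mul_cancel₀ (hw0 x)]
  exact isUnit_one

/-- Descent along the flag: dividing u by T gives e_j, with values constant multiples of the fibre
vectors, and (a - λ_j b) e_j takes values c(x) S_{j-1}(x) e_{j-1}(x), the input for the next level.
The vectors found so far are carried in h, because the normalisation needs them to complete a basis.
-/
theorem IsFibreFamily.exists_partial_frame (hf : IsFibreFamily ev val f)
    (hb : ∀ x, IsThemeFrame lam₁ p k (Sb x) (eb x)) (j : ℕ) (hjk : j ≤ k)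
    (h : ℕ → M) (hh : ∀ i, j < i → i ≤ k → ∀ x, ∃ c : ℂ, c ≠ 0 ∧ val x (h i) = C c • eb x i)
    (u : M) (w : Pt → ℂ⟦X⟧) (hw : ∀ x, IsUnit (w x)) (hu : ∀ x, val x u = w x • eb x j) :
    ∃ (e : ℕ → M) (S : ℕ → R⟦X⟧), IsFrame (fun j => ((lamInv lam₁ p j : ℚ) : ℂ)) S j e ∧
      (∀ i, 1 ≤ i → i < j → IsUnit (S i)) ∧ (∃ T : R⟦X⟧, IsUnit T ∧ u = T • e j) ∧
      ∀ i ≤ j, ∀ x, ∃ c : ℂ, c ≠ 0 ∧ val x (e i) = C c • eb x i := by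
  induction j generalizing h u w with
  | zero =>
    have hu0 : u = 0 := hf.ext fun x => by
      rw [hu, (hb x).frame.zero, smul_zero, map_zero]
    refine ⟨fun _ => 0, fun _ => 1, ⟨rfl, by simp⟩, by simp, ⟨1, isUnit_one, by simp [hu0]⟩, ?_⟩
    intro i hi x
    obtain rfl : i = 0 := by omega
    exact ⟨1, one_ne_zero, by rw [(hb x).frame.zero, smul_zero, map_zero]⟩
  | succ j ih =>
    obtain ⟨T, hTu, hT⟩ := hf.exists_normalisation hb (by omega) hjk h hh u w hw hu
    obtain ⟨T, rfl⟩ := hTu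
    choose c hc hwc using hT
    set e' : M := (↑T⁻¹ : R⟦X⟧) • u with he'
    have hue : u = (T : R⟦X⟧) • e' := by
      rw [he', smul_smul, Units.mul_inv, one_smul]
    have hve : ∀ x, val x e' = (C (c x) : ℂ⟦X⟧) • eb x (j + 1) := by
      intro x
      rw [he', hf.val_smul, hu, hwc, smul_smul, mul_left_comm, ← map_mul, Units.inv_mul, map_one,
        mul_one]
    clear_value e'
    set μ : ℂ := ((lamInv lam₁ p (j + 1) : ℚ) : ℂ) with hμ
    set u' : M := aOp R e' - (C (algebraMap ℂ R μ) * X : R⟦X⟧) • e' with hu'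
    have hvu' : ∀ x, val x u' = (C (c x) * Sb x j : ℂ⟦X⟧) • eb x j := by
      intro x
      have hCc : (X : ℂ⟦X⟧) ^ 2 * derivative ℂ (C (c x) : ℂ⟦X⟧) = 0 := by simp
      have h2 : (ev x).toRingHom (algebraMap ℂ R μ) = μ := (ev x).commutes μ
      rw [hu', map_sub, hf.val_a, hf.val_smul, hve, aOp_smul, hCc, zero_smul, add_zero,
        (hb x).frame.step j (by omega), map_mul, map_X, map_C, h2]
      simp only [Algebra.algebraMap_self, RingHom.id_apply, smul_add, smul_smul]
      rw [mul_comm (C μ * X : ℂ⟦X⟧), add_sub_cancel_left]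
    -- At j = 0 the series S_0 need not be a unit, but e_0 = 0, so the factor 1 serves instead.
    obtain ⟨e, S, hfr, hS, ⟨T₁, hT₁, hT₁e⟩, hec⟩ := ih (by omega)
      (fun i => if i = j + 1 then e' else h i)
      (fun i hi hik x => by
        by_cases hij : i = j + 1
        · simp only [if_pos hij]
          exact ⟨c x, hc x, by rw [hve, hij]⟩
        · simp only [if_neg hij]
          exact hh i (by omega) hik x) u' (fun x => if j = 0 then 1 else C (c x) * Sb x j)
      (fun x => by
        split_ifs with hj0
        · exact isUnit_one
        · exact ((IsUnit.mk0 _ (hc x)).map C).mul ((hb x).isUnit j (by omega) (by omega)))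
      (fun x => by
        split_ifs with hj0
        · rw [hvu', hj0, (hb x).frame.zero, smul_zero, smul_zero]
        · exact hvu' x)
    have hlt : ∀ i ≤ j, (if i = j + 1 then e' else e i) = e i := by
      intro i hi
      rw [if_neg (by omega)]
    refine ⟨fun i => if i = j + 1 then e' else e i, fun i => if i = j then T₁ else S i,
      ⟨?_, ?_⟩, ?_, ⟨T, T.isUnit, ?_⟩, ?_⟩
    · rw [hlt 0 (by omega)]; exact hfr.zero
    · intro i hi
      rcases Nat.lt_succ_iff_lt_or_eq.1 hi with hi | rfl
      · rw [hlt (i + 1) (by omega), hlt i (by omega), if_neg (by omega)]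
        exact hfr.step i hi
      · rw [hlt i le_rfl]
        simp only [if_true]
        rw [← hT₁e, hu']
        abel
    · intro i hi1 hi2
      simp only
      split_ifs with h
      · exact hT₁
      · exact hS i hi1 (by omega)
    · simp only [if_true]; exact hue
    · intro i hi x
      rcases Nat.le_succ_iff.1 hi with hi | rfl
      · simp only [hlt i hi]
        exact hec i hi x
      · simp only [if_true]
        exact ⟨c x, hc x, hve x⟩

/-- A family of themes with constant fundamental invariants has a holomorphic frame. -/
theorem IsFibreFamily.exists_themeFrame (hf : IsFibreFamily ev val f)
    (hb : ∀ x, IsThemeFrame lam₁ p k (Sb x) (eb x)) (g : M)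
    (hg : ∀ x, ∃ w : ℂ⟦X⟧, IsUnit w ∧ val x g = w • eb x k) :
    ∃ (S : ℕ → R⟦X⟧) (e : ℕ → M), IsThemeFrame lam₁ p k S e ∧
      ∀ x, IsThemeFrame lam₁ p k (fun i => PowerSeries.map (ev x).toRingHom (S i))
        (fun i => val x (e i)) := by
  choose w hw hgw using hg
  obtain ⟨e, S, hfr, hS, -, hec⟩ := hf.exists_partial_frame hb k le_rfl (fun _ => 0)
    (fun i hi hik => absurd hi (by omega)) g w hw hgw
  choose! c hc hce using hec
  have hcu : ∀ i ≤ k, ∀ x, IsUnit (C (c i x) : ℂ⟦X⟧) :=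
    fun i hi x => (IsUnit.mk0 _ (hc i hi x)).map C
  have hspan : ∀ x, topSpan ℂ (fun i => val x (e i)) k k = ⊤ := by
    intro x
    rw [eq_top_iff, ← (hb x).span, topSpan_self (e := eb x)]
    refine Submodule.span_le.2 ?_
    rintro _ ⟨i, rfl⟩
    have h1 : val x (e (i.1 + 1)) ∈ topSpan ℂ (fun i => val x (e i)) k k :=
      mem_topSpan_self (e := fun i => val x (e i)) (by omega) (by omega)
    rw [hce _ (by omega)] at h1
    have h2 := Submodule.smul_mem _ (C (c (i.1 + 1) x)⁻¹ : ℂ⟦X⟧) h1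
    rwa [smul_smul, ← map_mul, inv_mul_cancel₀ (hc _ (by omega) x), map_one, one_smul] at h2
  have hind : ∀ x, LinearIndependent ℂ⟦X⟧ fun i : Fin k => val x (e (i.1 + 1)) := fun x =>
    linearIndependent_of_span_eq (hb x).ind (by
      rw [← topSpan_self (fun i => val x (e i)), ← topSpan_self, hspan, (hb x).span])
  have hfrx : ∀ x, IsFrame (fun j => ((lamInv lam₁ p j : ℚ) : ℂ))
      (fun i => PowerSeries.map (ev x).toRingHom (S i)) k (fun i => val x (e i)) := by
    intro x
    refine ⟨by simp only [hfr.zero, map_zero], fun i hi => ?_⟩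
    have h2 : ∀ z : ℂ, (ev x).toRingHom (algebraMap ℂ R z) = z := (ev x).commutes
    rw [← hf.val_a, hfr.step i hi, map_add, hf.val_smul, hf.val_smul, map_mul, map_X, map_C, h2]
    rfl
  -- The values of e_i are nonzero constant multiples of the fibre vectors, so S_i(x) is a nonzero
  -- constant multiple of the series of the fibre frame.
  have hcoef : ∀ x i, 1 ≤ i → i < k → coeff (p i) (PowerSeries.map (ev x).toRingHom (S i)) ≠ 0 := by
    intro x i hi1 hi
    obtain ⟨l, rfl⟩ : ∃ l, i = l + 1 := ⟨i - 1, by omega⟩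
    have h1 := (hfrx x).step (l + 1) hi
    have hCc : (X : ℂ⟦X⟧) ^ 2 * derivative ℂ (C (c (l + 2) x) : ℂ⟦X⟧) = 0 := by simp
    simp only [hce (l + 1) (by omega) x, hce (l + 1 + 1) (by omega) x] at h1
    rw [aOp_smul, hCc, zero_smul, add_zero, (hb x).frame.step (l + 1) hi, smul_add, smul_comm,
      add_right_inj, smul_smul, smul_smul] at h1
    have h2 := (linearIndependent_iff_sum_range (f := fun i => eb x (i + 1))).1 (hb x).ind
      (fun i => if i = l then C (c (l + 2) x) * Sb x (l + 1) -
        PowerSeries.map (ev x).toRingHom (S (l + 1)) * C (c (l + 1) x) else 0) (by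
        rw [Finset.sum_eq_single l]
        · rw [if_pos rfl, sub_smul, h1, sub_self]
        · intro i _ hi; rw [if_neg hi, zero_smul]
        · intro hl; exact absurd (Finset.mem_range.2 (by omega)) hl) l (by omega)
    rw [if_pos rfl, sub_eq_zero] at h2
    have h3 := congrArg (coeff (p (l + 1))) h2
    rw [coeff_C_mul, coeff_mul_C] at h3
    intro h0
    rw [h0, zero_mul] at h3
    exact mul_ne_zero (hc _ (by omega) x) ((hb x).isUnit_coeff (l + 1) hi1 hi).ne_zero h3
  obtain ⟨h1, h2⟩ := hf.basis_of_fibre (fun i : Fin k => e (i.1 + 1)) fun x => ⟨hind x, by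
    have := hspan x
    rwa [topSpan_self] at this⟩
  refine ⟨S, e, ⟨hfr, hS, ?_, by rw [topSpan_self]; exact h2, h1⟩, fun x => ⟨hfrx x,
    fun i hi1 hi => (hS i hi1 hi).map _, fun i hi1 hi => isUnit_iff_ne_zero.2 (hcoef x i hi1 hi),
    hspan x, hind x⟩⟩
  intro i hi1 hi
  refine hf.unit _ fun x => ?_
  have := hcoef x i hi1 hi
  rwa [coeff_map] at this

end Family

/-! ### Solving the frame relations inside Ξ. -/

section XiFrame

variable {R : Type*} [CommRing R] [Algebra ℂ R]

/-- On coefficients the system is (n - m) w_l[n] + w_{l+1}[n] = r_l[n+1]. For n ≠ m it is solved by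
back substitution from large l, a finite sum as r_l = 0 for l ≥ j. For n = m it fixes w_{l+1}[m]
instead: the resonance raises the log degree by one, and yields the top component w_j. -/
theorem exists_euler_solution {r : ℕ → R⟦X⟧} {j : ℕ} (hj : 1 ≤ j) (hr : ∀ l ≥ j, r l = 0) {D : ℕ}
    (hD : ∀ l, X ^ (D + 1) ∣ r l) (m : ℕ) :
    ∃ w : ℕ → R⟦X⟧, (∀ l, euler (-(m : R)) (w l) + X * w (l + 1) = r l) ∧
      (∀ l ≥ j + 1, w l = 0) ∧ (∀ l, X ^ D ∣ w l) ∧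
      w j = C (coeff (m + 1) (r (j - 1))) * X ^ m := by
  -- The inverse of n - m exists in R because R is a ℂ-algebra; the default value at n = m is never
  -- used.
  let κ : ℕ → R := fun n => algebraMap ℂ R ((n : ℂ) - m)⁻¹
  have hκ : ∀ n, n ≠ m → ((n : R) - m) * κ n = 1 := by
    intro n hn
    have h1 : ((n : R) - m) = algebraMap ℂ R ((n : ℂ) - m) := by simp
    have h2 : ((n : ℂ) - m) ≠ 0 := sub_ne_zero.2 (by exact_mod_cast hn)
    rw [h1, ← map_mul, mul_inv_cancel₀ h2, map_one]
  let w : ℕ → R⟦X⟧ := fun l => PowerSeries.mk fun n =>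
    if n = m then (if l = 0 then 0 else coeff (m + 1) (r (l - 1)))
    else ∑ t ∈ Finset.range j, (-κ n) ^ t * κ n * coeff (n + 1) (r (l + t))
  have hw : ∀ l n, coeff n (w l) = if n = m then (if l = 0 then 0 else coeff (m + 1) (r (l - 1)))
      else ∑ t ∈ Finset.range j, (-κ n) ^ t * κ n * coeff (n + 1) (r (l + t)) :=
    fun l n => coeff_mk _ _
  refine ⟨w, fun l => ?_, fun l hl => ?_, fun l => ?_, ?_⟩
  · ext n
    cases n with
    | zero =>
      rw [map_add, coeff_zero_euler, coeff_zero_X_mul, add_zero,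
        X_pow_dvd_iff.1 (hD l) 0 (by omega)]
    | succ n =>
      rw [map_add, coeff_succ_euler, coeff_succ_X_mul, hw, hw]
      by_cases hn : n = m
      · rw [if_pos hn, if_pos hn, hn, add_neg_cancel, zero_mul, zero_add,
          if_neg (Nat.succ_ne_zero l), Nat.add_sub_cancel]
      · rw [if_neg hn, if_neg hn, ← sub_eq_add_neg, Finset.mul_sum, ← Finset.sum_add_distrib]
        have h1 : ∀ t ∈ Finset.range j, ((n : R) - m) * ((-κ n) ^ t * κ n *
            coeff (n + 1) (r (l + t))) + (-κ n) ^ t * κ n * coeff (n + 1) (r (l + 1 + t)) =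
            (-κ n) ^ t * coeff (n + 1) (r (l + t)) -
              (-κ n) ^ (t + 1) * coeff (n + 1) (r (l + (t + 1))) := by
          intro t _
          rw [show l + 1 + t = l + (t + 1) by omega]
          linear_combination (-κ n) ^ t * coeff (n + 1) (r (l + t)) * hκ n hn
        rw [Finset.sum_congr rfl h1, Finset.sum_range_sub', hr (l + j) (by omega)]
        simp
  · ext n
    rw [hw, map_zero]
    split_ifs with h1 h2
    · rfl
    · rw [hr (l - 1) (by omega), map_zero]
    · refine Finset.sum_eq_zero fun t _ => ?_
      rw [hr (l + t) (by omega), map_zero, mul_zero]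
  · rw [X_pow_dvd_iff]
    intro n hn
    rw [hw]
    split_ifs with h1 h2
    · rfl
    · exact X_pow_dvd_iff.1 (hD (l - 1)) (m + 1) (by omega)
    · refine Finset.sum_eq_zero fun t _ => ?_
      rw [X_pow_dvd_iff.1 (hD (l + t)) (n + 1) (by omega), mul_zero]
  · ext n
    rw [hw, coeff_C_mul, coeff_X_pow]
    split_ifs with h1 h2
    · omega
    · rw [mul_one]
    · rw [mul_zero]
      refine Finset.sum_eq_zero fun t _ => ?_
      rw [hr (j + t) (by omega), map_zero, mul_zero]

/-- Solve successively for v_1, v_2, …, starting from the monomial b^{m₁} in log degree 0. Each step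
costs one power of b, so divisibility by b^{k-(i+1)} is carried along; the bound k - 1 ≤ m₁ is what
this requires at the start. The new top coefficient is the old one times the coefficient of b^{p_i}
in S_i, hence remains a unit. -/
theorem exists_log_frame {lam lam₁ : ℚ} {p : ℕ → ℕ} {k : ℕ} {S : ℕ → R⟦X⟧}
    (hS : ∀ i, 1 ≤ i → i < k → IsUnit (coeff (p i) (S i))) {m₁ : ℕ} (hm₁ : lam₁ = lam + m₁)
    (hkm : k - 1 ≤ m₁) (j : ℕ) (hj : j ≤ k) :
    ∃ v : ℕ → ℕ → R⟦X⟧, (∀ l, v 0 l = 0) ∧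
      (∀ i < j, ∀ l, euler (algebraMap ℂ R (lam : ℂ)) (v (i + 1) l) + X * v (i + 1) (l + 1) =
        C (algebraMap ℂ R ((lamInv lam₁ p (i + 1) : ℚ) : ℂ)) * X * v (i + 1) l + S i * v i l) ∧
      (∀ i < j, ∀ l ≥ i + 1, v (i + 1) l = 0) ∧
      (∀ i < j, ∀ l, X ^ (k - (i + 1)) ∣ v (i + 1) l) ∧
      ∀ i < j, ∃ (m : ℕ) (c : R), IsUnit c ∧ k - (i + 1) ≤ m ∧ lamInv lam₁ p (i + 1) = lam + m ∧
        v (i + 1) i = C c * X ^ m := by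
  induction j with
  | zero => exact ⟨fun _ _ => 0, by simp, by simp, by simp, by simp, by simp⟩
  | succ j ih =>
    obtain ⟨v, h0, hstep, hz, hdvd, htop⟩ := ih (by omega)
    suffices h : ∃ w : ℕ → R⟦X⟧,
        (∀ l, euler (algebraMap ℂ R (lam : ℂ)) (w l) + X * w (l + 1) =
          C (algebraMap ℂ R ((lamInv lam₁ p (j + 1) : ℚ) : ℂ)) * X * w l + S j * v j l) ∧
        (∀ l ≥ j + 1, w l = 0) ∧ (∀ l, X ^ (k - (j + 1)) ∣ w l) ∧
        ∃ (m : ℕ) (c : R), IsUnit c ∧ k - (j + 1) ≤ m ∧ lamInv lam₁ p (j + 1) = lam + m ∧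
          w j = C c * X ^ m by
      obtain ⟨w, hw1, hw2, hw3, hw4⟩ := h
      have hlt : ∀ i ≤ j, (if i = j + 1 then w else v i) = v i := fun i hi => if_neg (by omega)
      refine ⟨fun i => if i = j + 1 then w else v i, ?_, ?_, ?_, ?_, ?_⟩
      · simp only [hlt 0 (by omega)]; exact h0
      all_goals
        intro i hi
        rcases Nat.lt_succ_iff_lt_or_eq.1 hi with hi | rfl
        · simp only [hlt (i + 1) (by omega), hlt i hi.le]
          first
          | exact hstep i hi
          | exact hz i hi
          | exact hdvd i hi
          | exact htop i hi
        · simp only [if_true, hlt i le_rfl]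
          first
          | exact hw1
          | exact hw2
          | exact hw3
          | exact hw4
    have heq : ∀ (m : ℕ) (w : R⟦X⟧), lamInv lam₁ p (j + 1) = lam + m →
        euler (algebraMap ℂ R (lam : ℂ)) w = euler (-(m : R)) w +
          C (algebraMap ℂ R ((lamInv lam₁ p (j + 1) : ℚ) : ℂ)) * X * w := by
      intro m w hm
      rw [← sub_eq_iff_eq_add, euler_sub]
      congr 2
      rw [hm, Rat.cast_add, Rat.cast_natCast, map_add, map_natCast]
      ring
    rcases Nat.eq_zero_or_pos j with rfl | hj0
    · have hm : lamInv lam₁ p (0 + 1) = lam + m₁ := by rw [lamInv_one, hm₁]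
      refine ⟨fun l => if l = 0 then X ^ m₁ else 0, fun l => ?_, fun l hl => if_neg (by omega),
        fun l => ?_, m₁, 1, isUnit_one, by omega, hm, by simp⟩
      · rw [heq m₁ _ hm, h0, mul_zero, add_zero]
        simp only [if_neg (Nat.succ_ne_zero l), mul_zero, add_zero]
        split_ifs
        · have : euler (-(m₁ : R)) (X ^ m₁) = 0 := by
            ext n
            cases n with
            | zero => rw [coeff_zero_euler, map_zero]
            | succ n =>
              rw [coeff_succ_euler, coeff_X_pow, map_zero]
              split_ifs with hn
              · rw [hn, add_neg_cancel, zero_mul]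
              · rw [mul_zero]
          rw [this, zero_add]
        · simp
      · simp only
        split_ifs
        · exact pow_dvd_pow _ (by omega)
        · exact dvd_zero _
    · obtain ⟨i, rfl⟩ : ∃ i, j = i + 1 := ⟨j - 1, by omega⟩
      obtain ⟨m, c, hc, hkm', hm, hmc⟩ := htop i (by omega)
      -- The natural subtraction is genuine because m ≥ k - (i + 1) ≥ 1.
      have hm' : lamInv lam₁ p (i + 1 + 1) = lam + ((m + p (i + 1) - 1 : ℕ) : ℚ) := by
        rw [lamInv_succ lam₁ p (by omega), hm, Nat.cast_sub (by omega)]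
        push_cast; ring
      obtain ⟨w, hw1, hw2, hw3, hw4⟩ := exists_euler_solution (r := fun l => S (i + 1) * v (i + 1) l)
        (j := i + 1) (by omega) (fun l hl => by rw [hz i (by omega) l hl, mul_zero])
        (D := k - (i + 1 + 1)) (fun l => by
          rw [show k - (i + 1 + 1) + 1 = k - (i + 1) by omega]
          exact Dvd.dvd.mul_left (hdvd i (by omega) l) _) (m + p (i + 1) - 1)
      refine ⟨w, fun l => ?_, hw2, hw3, _, _, ?_, ?_, hm', hw4⟩
      · rw [heq _ _ hm', ← hw1 l]; ring
      · rw [show m + p (i + 1) - 1 + 1 = p (i + 1) + m by omega, Nat.add_sub_cancel, hmc,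
          mul_left_comm, coeff_C_mul, coeff_mul_X_pow]
        exact hc.mul (hS (i + 1) (by omega) (by omega))
      · omega

/-- The components of `v (j + 1)` vanish beyond the `j`-th one, which is a unit times a power
of `b`. -/
def IsTriangular {lam : ℚ} {N : ℕ} (k : ℕ) (v : ℕ → Xi R {lam} N) : Prop :=
  ∀ j < k, (∀ i ≥ j + 1, Xi.comp i (v (j + 1)) = 0) ∧
    ∃ (m : ℕ) (c : R), IsUnit c ∧ Xi.comp j (v (j + 1)) = C c * X ^ m

theorem exists_xi_frame {lam lam₁ : ℚ} {p : ℕ → ℕ} {k : ℕ} (hk : 1 ≤ k) {S : ℕ → R⟦X⟧}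
    (hS : ∀ i, 1 ≤ i → i < k → IsUnit (coeff (p i) (S i))) {m₁ : ℕ} (hm₁ : lam₁ = lam + m₁)
    (hkm : k - 1 ≤ m₁) :
    ∃ v : ℕ → Xi R {lam} (k - 1), IsFrame (fun j => ((lamInv lam₁ p j : ℚ) : ℂ)) S k v ∧
      IsTriangular k v := by
  obtain ⟨v, h0, hstep, hz, -, htop⟩ := exists_log_frame hS hm₁ hkm k le_rfl
  let V : ℕ → Xi R {lam} (k - 1) := fun j _ i => v j i.1
  have hV : ∀ j ≤ k, ∀ i, Xi.comp i (V j) = v j i := by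
    intro j hj i
    by_cases hi : i < k - 1 + 1
    · have : Xi.comp i (V j) = V j ⟨lam, Finset.mem_singleton_self lam⟩ ⟨i, hi⟩ := dif_pos hi
      rw [this]
    · rw [Xi.comp_eq_zero _ (by omega)]
      cases j with
      | zero => rw [h0]
      | succ j => rw [hz j (by omega) i (by omega)]
  refine ⟨V, ⟨?_, fun i hi => ?_⟩, fun j hj => ⟨fun i hi => ?_, ?_⟩⟩
  · refine Xi.comp_ext fun i _ => ?_
    rw [hV 0 (by omega), h0, map_zero]
  · refine Xi.comp_ext fun l _ => ?_
    rw [Xi.comp_a, map_add, map_smul, map_smul, hV _ (by omega), hV _ (by omega),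
      hV _ (by omega), hstep i hi l]
    rfl
  · rw [hV _ (by omega), hz j hj i hi]
  · obtain ⟨m, c, hc, -, -, h⟩ := htop j hj
    exact ⟨m, c, hc, by rw [hV _ (by omega), h]⟩

/-- Downward elimination: component i of a relation sees only the coefficient g_i, the lower vectors
having no such component and the higher coefficients being zero already. A unit times a power of b
is not a zero divisor in R[[b]], even if R has zero divisors. -/
theorem IsTriangular.linearIndependent {lam : ℚ} {N k : ℕ} {v : ℕ → Xi R {lam} N}
    (h : IsTriangular k v) : LinearIndependent R⟦X⟧ fun i : Fin k => v (i.1 + 1) := by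
  refine (linearIndependent_iff_sum_range (f := fun i => v (i + 1))).2 fun g hg => ?_
  have key : ∀ n i, i < k → i + n + 1 ≥ k → g i = 0 := by
    intro n
    induction n using Nat.strong_induction_on with
    | _ n ih =>
      intro i hi hin
      obtain ⟨-, m, c, hc, hm⟩ := h i hi
      have h1 := congrArg (Xi.comp i) hg
      rw [map_sum, map_zero, Finset.sum_eq_single i] at h1
      · rw [map_smul, hm, smul_eq_mul, ← mul_assoc] at h1
        have h2 : g i * C c = 0 := by
          ext l
          rw [← coeff_mul_X_pow (g i * C c) m l, h1, map_zero, map_zero]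
        exact (hc.map C).mul_left_eq_zero.1 h2
      · intro l hl hli
        have hl := Finset.mem_range.1 hl
        rw [map_smul]
        rcases lt_or_gt_of_ne hli with hli | hli
        · rw [(h l hl).1 i (by omega), smul_zero]
        · rw [ih (k - l - 1) (by omega) l hl (by omega), zero_smul]
      · intro hi'
        exact absurd (Finset.mem_range.2 hi) hi'
  intro i hi
  exact key k i hi (by omega)

theorem Xi.comp_map {R' : Type*} [CommRing R'] [Algebra ℂ R'] (f : R →ₐ[ℂ] R') {lam : ℚ} {N : ℕ}
    (i : ℕ) (s : Xi R {lam} N) :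
    Xi.comp i (Xi.map f s) = PowerSeries.map f.toRingHom (Xi.comp i s) := by
  by_cases hi : i < N + 1
  · have h1 : Xi.comp i (Xi.map f s) =
      Xi.map f s ⟨lam, Finset.mem_singleton_self lam⟩ ⟨i, hi⟩ := dif_pos hi
    have h2 : Xi.comp i s = s ⟨lam, Finset.mem_singleton_self lam⟩ ⟨i, hi⟩ := dif_pos hi
    rw [h1, h2]; rfl
  · rw [Xi.comp_eq_zero _ (by omega), Xi.comp_eq_zero _ (by omega), map_zero]

theorem IsTriangular.map {R' : Type*} [CommRing R'] [Algebra ℂ R'] (f : R →ₐ[ℂ] R') {lam : ℚ}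
    {N k : ℕ} {v : ℕ → Xi R {lam} N} (h : IsTriangular k v) :
    IsTriangular k fun i => Xi.map f (v i) := by
  intro j hj
  obtain ⟨h1, m, c, hc, hm⟩ := h j hj
  refine ⟨fun i hi => by rw [Xi.comp_map, h1 i hi, map_zero], m, f c, hc.map f, ?_⟩
  rw [Xi.comp_map, hm, map_mul, map_pow, map_X, map_C]
  rfl

theorem Xi.map_add {R' : Type*} [CommRing R'] [Algebra ℂ R'] (f : R →ₐ[ℂ] R') {Λ : Finset ℚ}
    {N : ℕ} (s t : Xi R Λ N) : Xi.map f (s + t) = Xi.map f s + Xi.map f t := by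
  funext l j
  exact _root_.map_add (PowerSeries.map f.toRingHom) (s l j) (t l j)

theorem Xi.map_smul {R' : Type*} [CommRing R'] [Algebra ℂ R'] (f : R →ₐ[ℂ] R') {Λ : Finset ℚ}
    {N : ℕ} (S : R⟦X⟧) (s : Xi R Λ N) :
    Xi.map f (S • s) = PowerSeries.map f.toRingHom S • Xi.map f s := by
  funext l j
  exact map_mul (PowerSeries.map f.toRingHom) S (s l j)

theorem Xi.map_sum_smul {R' : Type*} [CommRing R'] [Algebra ℂ R'] (f : R →ₐ[ℂ] R') {Λ : Finset ℚ}
    {N n : ℕ} (c : Fin n → R⟦X⟧) (s : Fin n → Xi R Λ N) :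
    Xi.map f (∑ i, c i • s i) = ∑ i, PowerSeries.map f.toRingHom (c i) • Xi.map f (s i) := by
  let F : Xi R Λ N →+ Xi R' Λ N := AddMonoidHom.mk' (Xi.map f) (Xi.map_add f)
  change F _ = ∑ i, _ • F _
  rw [map_sum]
  exact Finset.sum_congr rfl fun i _ => Xi.map_smul f _ _

end XiFrame

/-! ### Invertibility, open loci and evaluation of holomorphic functions. -/

section HolFunctions

variable {X : Type u} [TopologicalSpace X] [ReducedComplexSpace X]

/-- Near each point there is a continuous map to some `ℂⁿ` such that the holomorphic functions are
the functions which are locally pullbacks of holomorphic functions. -/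
theorem exists_local_embedding {U : Opens X} {x : X} (hx : x ∈ U) :
    ∃ V : Opens X, V ≤ U ∧ x ∈ V ∧ ∃ (n : ℕ) (ε : V → Fin n → ℂ), Continuous ε ∧
      ∀ f : V → ℂ, f ∈ ReducedComplexSpace.hol V ↔
        ∀ y : V, ∃ (B : Set (Fin n → ℂ)) (g : (Fin n → ℂ) → ℂ), IsOpen B ∧ ε y ∈ B ∧
          DifferentiableOn ℂ g B ∧ ∀ y' : V, ε y' ∈ B → f y' = g (ε y') := by
  obtain ⟨W, hxW, n, D, A, -, e, he⟩ := ReducedComplexSpace.local_model x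
  refine ⟨U ⊓ W, inf_le_left, ⟨hx, hxW⟩, n, fun y => e ⟨y.1, y.2.2⟩, ?_,
    fun f => he (U ⊓ W) inf_le_right f⟩
  exact continuous_subtype_val.comp
    (e.continuous.comp (continuous_subtype_val.subtype_mk fun y : (U ⊓ W : Opens X) => y.2.2))

theorem HolFun.isUnit {U : Opens X} (f : HolFun U)
    (hf : ∀ (x : X) (hx : x ∈ U), HolFun.eval hx f ≠ 0) : IsUnit f := by
  have hinv : (fun y : U => (f.1 y)⁻¹) ∈ ReducedComplexSpace.hol U := by
    refine ReducedComplexSpace.hol_glue U _ fun x hx => ?_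
    obtain ⟨V, hVU, hxV, n, ε, hε, hol⟩ := exists_local_embedding hx
    refine ⟨V, hVU, hxV, (hol _).2 fun y => ?_⟩
    obtain ⟨B, g, hB, hyB, hg, hfg⟩ := (hol _).1 (ReducedComplexSpace.hol_res hVU f.1 f.2) y
    refine ⟨B ∩ g ⁻¹' {0}ᶜ, fun z => (g z)⁻¹,
      hg.continuousOn.isOpen_inter_preimage hB isOpen_compl_singleton, ⟨hyB, ?_⟩, ?_, ?_⟩
    · have := hfg y hyB
      simp only [Set.mem_preimage, Set.mem_compl_iff, Set.mem_singleton_iff]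
      rw [← this]
      exact hf y.1 (hVU y.2)
    · exact (hg.mono Set.inter_subset_left).inv fun z hz => hz.2
    · intro y' hy'
      exact congrArg (·⁻¹) (hfg y' hy'.1)
  refine IsUnit.of_mul_eq_one ⟨_, hinv⟩ (Subtype.ext (funext fun y => ?_))
  exact mul_inv_cancel₀ (hf y.1 y.2)

theorem HolFun.isOpen_ne {U : Opens X} (f : HolFun U) :
    IsOpen {x : X | ∃ hx : x ∈ U, HolFun.eval hx f ≠ 0} := by
  rw [isOpen_iff_forall_mem_open]
  rintro x ⟨hx, hfx⟩
  obtain ⟨V, hVU, hxV, n, ε, hε, hol⟩ := exists_local_embedding hx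
  obtain ⟨B, g, hB, hyB, hg, hfg⟩ := (hol _).1 (ReducedComplexSpace.hol_res hVU f.1 f.2) ⟨x, hxV⟩
  have hB' : IsOpen (B ∩ g ⁻¹' {0}ᶜ) :=
    hg.continuousOn.isOpen_inter_preimage hB isOpen_compl_singleton
  refine ⟨Subtype.val '' (ε ⁻¹' (B ∩ g ⁻¹' {0}ᶜ)), ?_,
    V.isOpen.isOpenMap_subtype_val _ (hB'.preimage hε), ⟨⟨x, hxV⟩, ⟨hyB, ?_⟩, rfl⟩⟩
  · rintro _ ⟨y, hy, rfl⟩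
    refine ⟨hVU y.2, ?_⟩
    have h1 := hfg y hy.1
    have h2 := hy.2
    simp only [Set.mem_preimage, Set.mem_compl_iff, Set.mem_singleton_iff] at h2
    rw [← h1] at h2
    exact h2
  · simp only [Set.mem_preimage, Set.mem_compl_iff, Set.mem_singleton_iff]
    rw [← hfg ⟨x, hxV⟩ hyB]
    exact hfx

theorem HolFun.ext_eval {U : Opens X} (f : HolFun U)
    (hf : ∀ x : U, HolFun.eval x.2 f = 0) : f = 0 :=
  Subtype.ext (funext fun y => hf y)

/-- The value at `x` of a power series with holomorphic coefficients. -/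
def evalSeries {U : Opens X} {x : X} (hx : x ∈ U) : (HolFun U)⟦X⟧ →+* ℂ⟦X⟧ :=
  PowerSeries.map (HolFun.eval hx).toRingHom

theorem evalSeries_res {U V : Opens X} (h : V ≤ U) {x : X} (hx : x ∈ V) (S : (HolFun U)⟦X⟧) :
    evalSeries hx (PowerSeries.map (HolFun.res h).toRingHom S) = evalSeries (h hx) S := by
  ext n
  simp only [evalSeries, coeff_map]
  rfl

theorem evalSeries_const {U : Opens X} {x : X} (hx : x ∈ U) (S : ℂ⟦X⟧) :
    evalSeries hx (ABSheaf.constSeries U S) = S := by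
  ext n
  simp only [evalSeries, ABSheaf.constSeries, coeff_map]
  rfl

end HolFunctions

/-! ### Local bases and their values in the fibres. -/

namespace ABSheaf

variable {X : Type u} [TopologicalSpace X] [ReducedComplexSpace X] (E : ABSheaf.{u, v} X)

theorem germ_res {x : X} {U V : Opens X} (h : V ≤ U) (hx : x ∈ V) (s : E.sec U) :
    E.germ hx (E.res h s) = E.germ (h hx) s :=
  (DirectLimit.eq_of_le (f := E.nhdRes x) (⟨⟨U, h hx⟩, s⟩ : Σ A : Nhd x, E.nhdSec x A)
    (⟨V, hx⟩ : Nhd x) h).symm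

theorem value_res {x : X} {U V : Opens X} (h : V ≤ U) (hx : x ∈ V) (s : E.sec U) :
    E.value hx (E.res h s) = E.value (h hx) s := by
  rw [value, germ_res]; rfl

/-- The value at `x`, as an additive map. -/
def valueHom {x : X} {U : Opens X} (hx : x ∈ U) : E.sec U →+ E.Fibre x :=
  AddMonoidHom.mk' (E.value hx) fun s t => by
    rw [value, germ_add]; rfl

theorem valueHom_apply {x : X} {U : Opens X} (hx : x ∈ U) (s : E.sec U) :
    E.valueHom hx s = E.value hx s := rfl

theorem value_smul_const {x : X} {U : Opens X} (hx : x ∈ U) (S : ℂ⟦X⟧) (s : E.sec U) :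
    E.value hx (S • s) = S • E.value hx s := rfl

/-- The series S differs from the constant series S(x) by one whose coefficients vanish at x, which
acts as zero on the fibre. -/
theorem value_smul {x : X} {U : Opens X} (hx : x ∈ U) (S : (HolFun U)⟦X⟧) (s : E.sec U) :
    E.value hx (S • s) = evalSeries hx S • E.value hx s := by
  rw [← value_smul_const]
  refine (Submodule.Quotient.eq _).2 (Submodule.subset_span ⟨U, hx,
    S - constSeries U (evalSeries hx S), s, fun n => ?_, ?_⟩)
  · rw [map_sub, map_sub, sub_eq_zero]
    have := congrArg (coeff n) (evalSeries_const hx (evalSeries hx S))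
    rw [evalSeries, coeff_map, coeff_map] at this
    exact this.symm
  · rw [sub_smul, ← modC_smul, sub_eq_iff_eq_add, ← germ_add, sub_add_cancel]

theorem value_a {x : X} {U : Opens X} (hx : x ∈ U) (s : E.sec U) :
    E.value hx (aOp (HolFun U) s) = aOp ℂ (E.value hx s) := rfl

theorem exists_value {x : X} (z : E.Fibre x) :
    ∃ (U : Opens X) (hx : x ∈ U) (s : E.sec U), z = E.value hx s := by
  obtain ⟨z, rfl⟩ := Submodule.Quotient.mk_surjective _ z
  obtain ⟨U, hx, s, rfl⟩ := E.exists_germ z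
  exact ⟨U, hx, s, rfl⟩

variable {E} {U : Opens X} {n : ℕ} {e : Fin n → E.sec U}

/-- The sections `e` form a basis of the restriction of `E` to `U`. -/
def IsLocalBasis (E : ABSheaf.{u, v} X) {U : Opens X} {n : ℕ} (e : Fin n → E.sec U) : Prop :=
  ∀ (V : Opens X) (h : V ≤ U) (s : E.sec V), ∃! c : Fin n → (HolFun V)⟦X⟧,
    s = ∑ i, c i • E.res h (e i)

/-- The basis of `E(V)` given by a local basis over `U ≥ V`. -/
def IsLocalBasis.basis (he : E.IsLocalBasis e) {V : Opens X} (h : V ≤ U) :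
    Module.Basis (Fin n) (HolFun V)⟦X⟧ (E.sec V) :=
  Module.Basis.mk (v := fun i => E.res h (e i))
    (by
      rw [Fintype.linearIndependent_iff]
      intro g hg i
      obtain ⟨c, -, hc⟩ := he V h 0
      rw [hc g hg.symm, ← hc 0 (by simp)]; rfl)
    (by
      rintro s -
      obtain ⟨c, hc, -⟩ := he V h s
      rw [hc]
      exact Submodule.sum_mem _ fun i _ => Submodule.smul_mem _ _ (Submodule.subset_span ⟨i, rfl⟩))

theorem IsLocalBasis.basis_apply (he : E.IsLocalBasis e) {V : Opens X} (h : V ≤ U) (i : Fin n) :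
    he.basis h i = E.res h (e i) := Module.Basis.mk_apply _ _ _

theorem IsLocalBasis.of_basis (h : ∀ (V : Opens X) (h : V ≤ U),
    LinearIndependent (HolFun V)⟦X⟧ (fun i => E.res h (e i)) ∧
    Submodule.span (HolFun V)⟦X⟧ (Set.range fun i => E.res h (e i)) = ⊤) : E.IsLocalBasis e := by
  intro V hV s
  obtain ⟨h1, h2⟩ := h V hV
  let b := Module.Basis.mk h1 h2.ge
  refine ⟨b.repr s, ?_, fun c hc => ?_⟩
  · simp only
    conv_lhs => rw [← b.sum_repr s]
    refine Finset.sum_congr rfl fun i _ => ?_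
    rw [Module.Basis.mk_apply]
  · have : s = ∑ i, c i • b i := by
      rw [hc]
      refine Finset.sum_congr rfl fun i _ => ?_
      rw [Module.Basis.mk_apply]
    rw [this, Module.Basis.repr_sum_self]

theorem IsLocalBasis.repr_res (he : E.IsLocalBasis e) {V W : Opens X} (h : V ≤ U) (h' : W ≤ V)
    (s : E.sec V) (i : Fin n) : (he.basis (h'.trans h)).repr (E.res h' s) i =
      PowerSeries.map (HolFun.res h').toRingHom ((he.basis h).repr s i) := by
  have h1 : E.res h' s = ∑ i, PowerSeries.map (HolFun.res h').toRingHom ((he.basis h).repr s i) •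
      he.basis (h'.trans h) i := by
    conv_lhs => rw [← (he.basis h).sum_repr s]
    rw [map_sum]
    refine Finset.sum_congr rfl fun i _ => ?_
    rw [E.res_smul, basis_apply, basis_apply, E.res_res]
  rw [h1, Module.Basis.repr_sum_self]

/-- The coordinates at `x` of a section over a neighbourhood of `x`. -/
def IsLocalBasis.coordAt (he : E.IsLocalBasis e) {x : X} (hx : x ∈ U) (A : Nhd x)
    (s : E.sec A.U) (i : Fin n) : ℂ⟦X⟧ :=
  evalSeries (⟨A.mem, hx⟩ : x ∈ A.U ⊓ U)
    ((he.basis (inf_le_right : A.U ⊓ U ≤ U)).repr (E.res inf_le_left s) i)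

theorem IsLocalBasis.coordAt_eq (he : E.IsLocalBasis e) {x : X} (hx : x ∈ U) (A : Nhd x)
    (s : E.sec A.U) (i : Fin n) {W : Opens X} (hxW : x ∈ W) (hA : W ≤ A.U) (hU : W ≤ U) :
    he.coordAt hx A s i = evalSeries hxW ((he.basis hU).repr (E.res hA s) i) := by
  have h1 : W ≤ A.U ⊓ U := le_inf hA hU
  rw [coordAt, ← evalSeries_res h1 hxW, ← he.repr_res, E.res_res]

/-- The coordinates of a germ. -/
def IsLocalBasis.stalkCoord (he : E.IsLocalBasis e) {x : X} (hx : x ∈ U) :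
    E.Stalk x →ₗ[ℂ⟦X⟧] (Fin n → ℂ⟦X⟧) where
  toFun := DirectLimit.lift (E.nhdRes x) (fun A s => he.coordAt hx A s) fun A B h s => by
    funext i
    have hBA : B.U ≤ A.U := h
    rw [he.coordAt_eq hx A s i (W := B.U ⊓ U) ⟨B.mem, hx⟩ (inf_le_left.trans hBA) inf_le_right,
      he.coordAt_eq hx B _ i (W := B.U ⊓ U) ⟨B.mem, hx⟩ inf_le_left inf_le_right]
    congr 3
    exact (E.res_res hBA inf_le_left s).symm
  map_add' z z' := by
    obtain ⟨V, hxV, s, s', rfl, rfl⟩ := E.exists_germ₂ z z'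
    rw [← germ_add]
    funext i
    change evalSeries _ _ = evalSeries _ _ + evalSeries _ _
    rw [map_add, map_add, Finsupp.add_apply, map_add]
  map_smul' S z := by
    obtain ⟨V, hxV, s, rfl⟩ := E.exists_germ z
    rw [← germ_smul]
    funext i
    have hm : x ∈ V ⊓ U := ⟨hxV, hx⟩
    change he.coordAt hx ⟨V, hxV⟩ (S • s) i = S * he.coordAt hx ⟨V, hxV⟩ s i
    rw [he.coordAt_eq hx ⟨V, hxV⟩ _ i hm inf_le_left inf_le_right,
      he.coordAt_eq hx ⟨V, hxV⟩ _ i hm inf_le_left inf_le_right, modC_smul, E.res_smul, map_smul, Finsupp.smul_apply, smul_eq_mul, map_mul, evalSeries_res,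
      evalSeries_const]

theorem IsLocalBasis.stalkCoord_germ (he : E.IsLocalBasis e) {x : X} {V : Opens X} (hx : x ∈ V)
    (h : V ≤ U) (s : E.sec V) (i : Fin n) :
    he.stalkCoord (h hx) (E.germ hx s) i = evalSeries hx ((he.basis h).repr s i) := by
  change he.coordAt (h hx) ⟨V, hx⟩ s i = _
  rw [he.coordAt_eq (h hx) ⟨V, hx⟩ s i hx le_rfl h]
  congr 3
  exact E.res_self s

theorem IsLocalBasis.maxIdealMul_le (he : E.IsLocalBasis e) {x : X} (hx : x ∈ U) :
    (E.maxIdealMul x).toSubmodule ≤ LinearMap.ker (he.stalkCoord hx) := by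
  refine Submodule.span_le.2 ?_
  rintro _ ⟨V, hxV, S, s, hS, rfl⟩
  rw [SetLike.mem_coe, LinearMap.mem_ker]
  funext i
  have hm : x ∈ V ⊓ U := ⟨hxV, hx⟩
  change he.coordAt hx ⟨V, hxV⟩ (S • s) i = 0
  have h0 : evalSeries hxV S = 0 := by
    ext n
    rw [evalSeries, coeff_map]
    exact hS n
  rw [he.coordAt_eq hx ⟨V, hxV⟩ _ i hm inf_le_left inf_le_right, E.res_smul, map_smul,
    Finsupp.smul_apply, smul_eq_mul, map_mul, evalSeries_res, h0, zero_mul]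

/-- The coordinates of a germ, evaluated at x, kill ℳ_x[[b]] E and so descend to the fibre, where
they send the values of the basis to the standard basis. -/
theorem IsLocalBasis.linearIndependent_value (he : E.IsLocalBasis e) {x : X} (hx : x ∈ U) :
    LinearIndependent ℂ⟦X⟧ fun i => E.value hx (e i) := by
  have h1 : LinearIndependent ℂ⟦X⟧ (fun i => (E.maxIdealMul x).toSubmodule.liftQ
      (he.stalkCoord hx) (he.maxIdealMul_le hx) (E.value hx (e i))) := by
    have : (fun i => (E.maxIdealMul x).toSubmodule.liftQ
      (he.stalkCoord hx) (he.maxIdealMul_le hx) (E.value hx (e i))) =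
        fun i => Pi.single i (1 : ℂ⟦X⟧) := by
      funext i j
      change he.stalkCoord hx (E.germ hx (e i)) j = _
      have h2 : e i = he.basis le_rfl i := by rw [basis_apply, E.res_self]
      rw [he.stalkCoord_germ hx le_rfl, h2, Module.Basis.repr_self, Finsupp.single_apply,
        Pi.single_apply]
      simp only [eq_comm (a := j)]
      split_ifs
      · exact map_one _
      · exact map_zero _
    rw [this]
    exact Pi.linearIndependent_single_one _ _
  exact LinearIndependent.of_comp _ h1

theorem IsLocalBasis.value_eq (he : E.IsLocalBasis e) {x : X} {V : Opens X} (hx : x ∈ V)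
    (h : V ≤ U) (s : E.sec V) : E.value hx s =
      ∑ i, evalSeries hx ((he.basis h).repr s i) • E.value (h hx) (e i) := by
  conv_lhs => rw [← (he.basis h).sum_repr s, ← valueHom_apply, map_sum]
  refine Finset.sum_congr rfl fun i _ => ?_
  rw [valueHom_apply, value_smul, basis_apply, value_res]

theorem IsLocalBasis.span_value (he : E.IsLocalBasis e) {x : X} (hx : x ∈ U) :
    Submodule.span ℂ⟦X⟧ (Set.range fun i => E.value hx (e i)) = ⊤ := by
  rw [eq_top_iff]
  rintro z -
  obtain ⟨V, hxV, s, rfl⟩ := E.exists_value z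
  have hm : x ∈ V ⊓ U := ⟨hxV, hx⟩
  rw [← E.value_res (inf_le_left : V ⊓ U ≤ V) hm, he.value_eq hm inf_le_right]
  exact Submodule.sum_mem _ fun i _ => Submodule.smul_mem _ _ (Submodule.subset_span ⟨i, rfl⟩)

theorem IsLocalBasis.finrank_fibre (he : E.IsLocalBasis e) {x : X} (hx : x ∈ U) :
    Module.finrank ℂ⟦X⟧ (E.Fibre x) = n := by
  rw [Module.finrank_eq_card_basis
    (Module.Basis.mk (he.linearIndependent_value hx) (he.span_value hx).ge), Fintype.card_fin]

theorem IsLocalBasis.isFibreFamily (he : E.IsLocalBasis e) {V : Opens X} (h : V ≤ U) :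
    IsFibreFamily (Pt := V) (fun x => HolFun.eval x.2) (N := fun x => E.Fibre x.1)
      (fun x => E.valueHom x.2) (he.basis h) where
  sep r hr := HolFun.ext_eval r hr
  unit r hr := HolFun.isUnit r fun x hx => hr ⟨x, hx⟩
  val_smul x S m := E.value_smul x.2 S m
  val_a x m := E.value_a x.2 m
  ind x := by
    have h1 : (E.valueHom x.2 ∘ he.basis h : Fin n → E.Fibre x.1) =
        fun i => E.value (h x.2) (e i) := funext fun i => by
      rw [Function.comp_apply, basis_apply]
      exact E.value_res h x.2 (e i)
    rw [h1]
    exact he.linearIndependent_value (h x.2)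
  span x := by
    have h1 : (E.valueHom x.2 ∘ he.basis h : Fin n → E.Fibre x.1) =
        fun i => E.value (h x.2) (e i) := funext fun i => by
      rw [Function.comp_apply, basis_apply]
      exact E.value_res h x.2 (e i)
    rw [h1]
    exact he.span_value (h x.2)

end ABSheaf

/-! ### Transport of frames along maps. -/

section FrameMaps

variable {R : Type*} [CommRing R] [Algebra ℂ R] {M : Type*} [AddCommGroup M] [Module R⟦X⟧ M]
  [ABAction R M]

theorem IsFrame.map {R' : Type*} [CommRing R'] [Algebra ℂ R'] {M' : Type*} [AddCommGroup M']
    [Module R'⟦X⟧ M'] [ABAction R' M'] {lam : ℕ → ℂ} {S : ℕ → R⟦X⟧} {k : ℕ} {e : ℕ → M}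
    (h : IsFrame lam S k e) (f : R →ₐ[ℂ] R') (g : M →+ M')
    (hg : ∀ (T : R⟦X⟧) m, g (T • m) = PowerSeries.map f.toRingHom T • g m)
    (ha : ∀ m, g (aOp R m) = aOp R' (g m)) :
    IsFrame lam (fun i => PowerSeries.map f.toRingHom (S i)) k fun i => g (e i) where
  zero := by rw [h.zero, map_zero]
  step i hi := by
    rw [← ha, h.step i hi, map_add, hg, hg, map_mul, map_X, map_C]
    congr 4
    exact f.commutes _

/-- Both frames obey the same relations, so θ and `a` commute on the generators; the common Leibniz
rule extends this to their span. -/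
theorem IsFrame.map_aOp {M' : Type*} [AddCommGroup M'] [Module R⟦X⟧ M'] [ABAction R M']
    {lam : ℕ → ℂ} {S : ℕ → R⟦X⟧} {k : ℕ} {e : ℕ → M} {v : ℕ → M'}
    (h : IsFrame lam S k e) (h' : IsFrame lam S k v) (htop : topSpan R e k k = ⊤)
    (θ : M →ₗ[R⟦X⟧] M') (hθ : ∀ i < k, θ (e (i + 1)) = v (i + 1)) (m : M) :
    θ (aOp R m) = aOp R (θ m) := by
  have hθ' : ∀ i ≤ k, θ (e i) = v i := by
    rintro (_ | i) hi
    · rw [h.zero, h'.zero, map_zero]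
    · exact hθ i hi
  have hm : m ∈ topSpan R e k k := htop ▸ Submodule.mem_top
  rw [topSpan_self] at hm
  induction hm using Submodule.span_induction with
  | mem m hm =>
    obtain ⟨i, rfl⟩ := hm
    simp only
    rw [h.step i i.2, θ.map_add, θ.map_smul, θ.map_smul, hθ' _ i.2, hθ' _ i.2.le, h'.step i i.2]
  | zero => simp only [map_zero]
  | add x y _ _ hx hy => rw [map_add, θ.map_add, hx, hy, θ.map_add, map_add]
  | smul T y _ hy => rw [aOp_smul, θ.map_add, θ.map_smul, θ.map_smul, θ.map_smul, hy, aOp_smul]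

end FrameMaps

/-! ### Thematic maps built from triangular frames. -/

section SheafGen

variable {X : Type u} [TopologicalSpace X] [ReducedComplexSpace X]

theorem Xi.map_eval_res {Λ : Finset ℚ} {N : ℕ} {U V : Opens X} (h : V ≤ U) {x : X} (hx : x ∈ V)
    (s : Xi (HolFun U) Λ N) :
    Xi.map (HolFun.eval hx) (Xi.res h s) = Xi.map (HolFun.eval (h hx)) s := by
  funext l j
  exact evalSeries_res h hx (s l j)

theorem Xi.ext_eval {Λ : Finset ℚ} {N : ℕ} {U : Opens X} {s t : Xi (HolFun U) Λ N}
    (h : ∀ x : U, Xi.map (HolFun.eval x.2) s = Xi.map (HolFun.eval x.2) t) : s = t := by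
  funext l j
  refine PowerSeries.ext fun n => ?_
  refine sub_eq_zero.1 (HolFun.ext_eval (coeff n (s l j) - coeff n (t l j)) fun x => ?_)
  have h1 : PowerSeries.map (HolFun.eval x.2).toRingHom (s l j) =
    PowerSeries.map (HolFun.eval x.2).toRingHom (t l j) := congrFun (congrFun (h x) l) j
  have h2 := congrArg (coeff n) h1
  rw [coeff_map, coeff_map] at h2
  rw [_root_.map_sub, sub_eq_zero]
  exact h2

variable {lam : ℚ} {N k : ℕ} {U : Opens X} {v : ℕ → Xi (HolFun U) {lam} N}

/-- A section of `Ξ` which is locally a combination of a triangular family is globally one. -/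
theorem IsTriangular.exists_glue (hv : IsTriangular k v) (s : Xi (HolFun U) {lam} N)
    (hs : ∀ x ∈ U, ∃ (W : Opens X) (h : W ≤ U), x ∈ W ∧ ∃ c : Fin k → (HolFun W)⟦X⟧,
      Xi.res h s = ∑ i, c i • Xi.res h (v (i.1 + 1))) :
    ∃ c : Fin k → (HolFun U)⟦X⟧, s = ∑ i, c i • v (i.1 + 1) := by
  have hpt : ∀ x : U, ∃ d : Fin k → ℂ⟦X⟧, Xi.map (HolFun.eval x.2) s =
      ∑ i, d i • Xi.map (HolFun.eval x.2) (v (i.1 + 1)) := by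
    intro x
    obtain ⟨W, h, hx, c, hc⟩ := hs x.1 x.2
    refine ⟨fun i => evalSeries hx (c i), ?_⟩
    rw [← Xi.map_eval_res h hx, hc, Xi.map_sum_smul]
    simp only [Xi.map_eval_res]
    rfl
  choose d hd using hpt
  -- A triangular family remains independent at each point, so the pointwise coefficients d are
  -- unique and agree with every local choice c. This makes their coefficients holomorphic.
  have hloc : ∀ (W : Opens X) (h : W ≤ U) (c : Fin k → (HolFun W)⟦X⟧),
      Xi.res h s = ∑ i, c i • Xi.res h (v (i.1 + 1)) → ∀ (y : W) i,
        d ⟨y.1, h y.2⟩ i = evalSeries y.2 (c i) := by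
    intro W h c hc y i
    have h1 := hd ⟨y.1, h y.2⟩
    rw [← Xi.map_eval_res h y.2, hc, Xi.map_sum_smul] at h1
    simp only [Xi.map_eval_res] at h1
    have hind := ((hv.map (HolFun.eval (h y.2))).linearIndependent)
    rw [Fintype.linearIndependent_iff] at hind
    have h2 := hind (fun i => d ⟨y.1, h y.2⟩ i - evalSeries y.2 (c i)) (by
      simp only [sub_smul, Finset.sum_sub_distrib]
      exact sub_eq_zero.2 h1.symm) i
    exact sub_eq_zero.1 h2
  have hhol : ∀ (i : Fin k) (n : ℕ),
      (fun y : U => coeff n (d y i)) ∈ ReducedComplexSpace.hol U := by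
    intro i n
    refine ReducedComplexSpace.hol_glue U _ fun x hx => ?_
    obtain ⟨W, h, hxW, c, hc⟩ := hs x hx
    refine ⟨W, h, hxW, ?_⟩
    convert (coeff n (c i)).2 using 1
    funext y
    rw [hloc W h c hc y i, evalSeries, coeff_map]
    rfl
  refine ⟨fun i => PowerSeries.mk fun n => ⟨_, hhol i n⟩, Xi.ext_eval fun x => ?_⟩
  rw [Xi.map_sum_smul, hd x]
  refine Finset.sum_congr rfl fun i _ => ?_
  congr 1
  ext n
  rw [coeff_map, coeff_mk]
  rfl

variable {mu : ℕ → ℂ} {S : ℕ → (HolFun U)⟦X⟧}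

theorem IsFrame.xi_res (h : IsFrame mu S k v) {V : Opens X} (hV : V ≤ U) :
    IsFrame mu (fun i => PowerSeries.map (HolFun.res hV).toRingHom (S i)) k
      fun i => Xi.res hV (v i) :=
  h.map (HolFun.res hV) (AddMonoidHom.mk' (Xi.res hV) (Xi.res_add hV)) (Xi.res_smul hV)
    (Xi.res_a hV)

/-- On each open set the iterates of v_k generate the span of the frame, and these spans already
form a sheaf by uniqueness of the coefficients at each point. -/
theorem IsFrame.sheafGen_eq (h : IsFrame mu S k v) (hS : ∀ i, 1 ≤ i → i < k → IsUnit (S i))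
    (hv : IsTriangular k v) {V : Opens X} (hV : V ≤ U) :
    sheafGen (v k) hV = topSpan (HolFun V) (fun i => Xi.res hV (v i)) k k := by
  have hgen : ∀ {W : Opens X} (hW : W ≤ U),
      (ABSubmodule.gen (R := HolFun W) (Xi.res hW (v k))).toSubmodule =
        topSpan (HolFun W) (fun i => Xi.res hW (v i)) k k := by
    intro W hW
    have := (h.xi_res hW).gen_eq (fun i h1 hi => (hS i h1 hi).map _) isUnit_one
    rwa [one_smul] at this
  apply le_antisymm
  · intro s hs
    have hres : ∀ {W : Opens X} (h' : W ≤ V) (i : ℕ),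
        Xi.res h' (Xi.res hV (v i)) = Xi.res (h'.trans hV) (v i) := fun h' i => Xi.res_res hV h' _
    obtain ⟨c, hc⟩ := (hv.map (HolFun.res hV)).exists_glue s fun x hx => by
      obtain ⟨W, h', hxW, hsW⟩ := hs x hx
      rw [hgen, topSpan_self, Submodule.mem_span_range_iff_exists_fun] at hsW
      obtain ⟨c, hc⟩ := hsW
      refine ⟨W, h', hxW, c, ?_⟩
      rw [← hc]
      exact Finset.sum_congr rfl fun i _ => by rw [← hres h']; rfl
    rw [topSpan_self, Submodule.mem_span_range_iff_exists_fun]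
    exact ⟨c, hc.symm⟩
  · intro s hs x hx
    refine ⟨V, le_rfl, hx, ?_⟩
    rw [hgen hV]
    have : Xi.res le_rfl s = s := by
      funext l j
      rw [show Xi.res le_rfl s l j = PowerSeries.map (HolFun.res le_rfl).toRingHom (s l j) from rfl]
      refine PowerSeries.ext fun n => ?_
      rw [coeff_map]
      rfl
    rwa [this]

theorem IsFrame.isThematic (h : IsFrame mu S k v) (hS : ∀ i, 1 ≤ i → i < k → IsUnit (S i))
    (hv : IsTriangular k v) : IsThematic k (v k) := by
  intro V hV
  have hS' : ∀ i, 1 ≤ i → i < k → IsUnit (PowerSeries.map (HolFun.res hV).toRingHom (S i)) :=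
    fun i h1 hi => (hS i h1 hi).map _
  have hind := (h.xi_res hV).linearIndependent_iterate hS' isUnit_one
    (hv.map (HolFun.res hV)).linearIndependent
  have hsp := (h.xi_res hV).orbitSpan_eq le_rfl hS' isUnit_one k le_rfl
  rw [orbitSpan_eq_span, ← h.sheafGen_eq hS hv hV] at hsp
  simp only [one_smul] at hind hsp
  exact ⟨hind, hsp⟩

/-- Send e_i to v_i: both are bases over every smaller open set, they restrict compatibly, and the
identical series S make the map commute with `a`. -/
theorem ABSheaf.isoSheafGen (E : ABSheaf.{u, w} X) {e : ℕ → E.sec U} (he : IsFrame mu S k e)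
    (hb : E.IsLocalBasis fun i : Fin k => e (i.1 + 1)) (h : IsFrame mu S k v)
    (hS : ∀ i, 1 ≤ i → i < k → IsUnit (S i)) (hv : IsTriangular k v) :
    IsoSheafGen E (v k) := by
  have hspan : ∀ {V : Opens X} (hV : V ≤ U),
      Submodule.span (HolFun V)⟦X⟧ (Set.range fun i : Fin k => Xi.res hV (v (i.1 + 1))) =
        sheafGen (v k) hV := fun hV => by
    rw [h.sheafGen_eq hS hv hV, topSpan_self]
  have hlin : ∀ {V : Opens X} (hV : V ≤ U), LinearIndependent (HolFun V)⟦X⟧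
      fun i : Fin k => Xi.res hV (v (i.1 + 1)) := fun hV =>
    (hv.map (HolFun.res hV)).linearIndependent
  let b : ∀ (V : Opens X) (hV : V ≤ U), Module.Basis (Fin k) (HolFun V)⟦X⟧ (sheafGen (v k) hV) :=
    fun V hV => (Module.Basis.span (hlin hV)).map
      (LinearEquiv.ofEq _ _ (hspan hV))
  have hbv : ∀ (V : Opens X) (hV : V ≤ U) i,
      ((b V hV i : sheafGen (v k) hV) : Xi (HolFun V) {lam} N) = Xi.res hV (v (i.1 + 1)) := by
    intro V hV i
    rw [Module.Basis.map_apply, LinearEquiv.coe_ofEq_apply, Module.Basis.span_apply]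
  let θ : ∀ (V : Opens X) (hV : V ≤ U), E.sec V ≃ₗ[(HolFun V)⟦X⟧] sheafGen (v k) hV :=
    fun V hV => (hb.basis hV).equiv (b V hV) (Equiv.refl _)
  have hθ : ∀ (V : Opens X) (hV : V ≤ U) (s : E.sec V),
      ((θ V hV s : sheafGen (v k) hV) : Xi (HolFun V) {lam} N) =
        ∑ i, (hb.basis hV).repr s i • Xi.res hV (v (i.1 + 1)) := by
    intro V hV s
    have h1 : θ V hV s = ∑ i, (hb.basis hV).repr s i • b V hV i := by
      conv_lhs => rw [← (hb.basis hV).sum_repr s]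
      rw [_root_.map_sum]
      refine Finset.sum_congr rfl fun i _ => ?_
      rw [_root_.map_smul, Module.Basis.equiv_apply, Equiv.refl_apply]
    rw [h1, Submodule.coe_sum]
    exact Finset.sum_congr rfl fun i _ => by rw [Submodule.coe_smul, hbv]
  refine ⟨θ, fun V hV s => ?_, fun V W hV h' s => ?_⟩
  · have he' := he.map (HolFun.res hV) (E.res hV) (E.res_smul hV) (E.res_a hV)
    refine he'.map_aOp (h.xi_res hV) ?_
      ((sheafGen (v k) hV).subtype ∘ₗ (θ V hV).toLinearMap) ?_ s
    · rw [topSpan_self, ← (hb.basis hV).span_eq]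
      congr 2
      funext i
      rw [ABSheaf.IsLocalBasis.basis_apply]
    · intro i hi
      have h1 : E.res hV (e (i + 1)) = hb.basis hV ⟨i, hi⟩ := by
        rw [ABSheaf.IsLocalBasis.basis_apply]
      rw [h1, LinearMap.comp_apply, LinearEquiv.coe_coe, Module.Basis.equiv_apply,
        Equiv.refl_apply]
      exact hbv V hV ⟨i, hi⟩
  · rw [hθ, hθ]
    refine Eq.trans ?_ (Xi.map_sum_smul (HolFun.res h') _ _).symm
    refine Finset.sum_congr rfl fun i _ => ?_
    rw [hb.repr_res hV h' s i]
    exact congrArg _ (Xi.res_res hV h' _).symm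

theorem ABSheaf.isHolomorphicFamily_of_frames (E : ABSheaf.{u, w} X) {lam₁ : ℚ} {p : ℕ → ℕ}
    (hlam : 0 < lam ∧ lam ≤ 1) (hk : 1 ≤ k)
    (hm : Nonempty X → ∃ m : ℕ, lam₁ = lam + m ∧ k - 1 ≤ m)
    (hE : ∀ x : X, ∃ U : Opens X, x ∈ U ∧ ∃ (S : ℕ → (HolFun U)⟦X⟧) (e : ℕ → E.sec U),
      IsFrame (fun j => ((lamInv lam₁ p j : ℚ) : ℂ)) S k e ∧
      (∀ i, 1 ≤ i → i < k → IsUnit (S i)) ∧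
      (∀ i, 1 ≤ i → i < k → IsUnit (coeff (p i) (S i))) ∧
      E.IsLocalBasis fun i : Fin k => e (i.1 + 1)) : IsHolomorphicFamily E k := by
  intro x
  obtain ⟨U, hx, S, e, he, hS, hSp, hb⟩ := hE x
  obtain ⟨m₁, hm₁, hkm⟩ := hm ⟨x⟩
  obtain ⟨v, hv, ht⟩ := exists_xi_frame hk hSp hm₁ hkm
  refine ⟨U, hx, {lam}, fun l hl => ?_, v k, hv.isThematic hS ht, E.isoSheafGen he hb hv hS ht⟩
  rw [Finset.mem_singleton.1 hl]
  exact hlam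

end SheafGen

/-! ### Local holomorphic frames of a family with constant invariants. -/

namespace ABSheaf

variable {X : Type u} [TopologicalSpace X] [ReducedComplexSpace X] {E : ABSheaf.{u, v} X}
  {lam lam₁ : ℚ} {p : ℕ → ℕ} {k : ℕ}

theorem value_iterate {x : X} {U : Opens X} (hx : x ∈ U) (s : E.sec U) (n : ℕ) :
    E.value hx ((aOp (HolFun U))^[n] s) = (aOp ℂ)^[n] (E.value hx s) := by
  have h : Function.Semiconj (E.value hx) (aOp (HolFun U)) (aOp ℂ) := E.value_a hx
  exact (h.iterate_right n) s

/-- A family of themes with constant fundamental invariants has, near every point, a frame which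
induces a frame of every fibre. -/
theorem exists_local_frame (hk : 1 ≤ k)
    (hE : ∀ x : X, IsPrimitiveTheme (E.Fibre x) lam k ∧ HasInvariants (E.Fibre x) k lam₁ p)
    (x₀ : X) : ∃ U : Opens X, x₀ ∈ U ∧ ∃ (S : ℕ → (HolFun U)⟦X⟧) (e : ℕ → E.sec U),
      (E.IsLocalBasis fun i : Fin k => e (i.1 + 1)) ∧ IsThemeFrame lam₁ p k S e ∧
      ∀ (x : X) (hx : x ∈ U), IsThemeFrame lam₁ p k (fun i => evalSeries hx (S i))
        (fun i => E.value hx (e i)) := by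
  obtain ⟨U₀, hx₀, n, b, hb⟩ := E.locally_free x₀
  replace hb : E.IsLocalBasis b := hb
  obtain rfl : n = k := (hb.finrank_fibre hx₀).symm.trans (hE x₀).1.1
  obtain ⟨g₀, hg₀⟩ := (hE x₀).1.exists_generator
  have hg₀m : g₀ ∈ Submodule.span ℂ⟦X⟧ (Set.range fun i => E.value hx₀ (b i)) := by
    rw [hb.span_value hx₀]; trivial
  obtain ⟨c, hc⟩ := (Submodule.mem_span_range_iff_exists_fun ℂ⟦X⟧).1 hg₀m
  -- A generator of the fibre at x₀ is extended with constant coefficients; being a generator is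
  -- then an open condition.
  let g : E.sec U₀ := ∑ i, c i • b i
  have hg : E.value hx₀ g = g₀ := by
    rw [← valueHom_apply, map_sum, ← hc]
    rfl
  -- A power series is a unit when its constant term is, so the iterates of g form a basis of the
  -- fibre exactly where the holomorphic function `coeff 0 D` is nonzero.
  let D := (hb.basis le_rfl).det fun l : Fin n => (aOp (HolFun U₀))^[l.1] g
  have hD : ∀ (x : X) (hx : x ∈ U₀), HolFun.eval hx (coeff 0 D) ≠ 0 ↔
      LinearIndependent ℂ⟦X⟧ (fun l : Fin n => (aOp ℂ)^[l.1] (E.value hx g)) ∧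
      Submodule.span ℂ⟦X⟧ (Set.range fun l : Fin n => (aOp ℂ)^[l.1] (E.value hx g)) = ⊤ := by
    intro x hx
    have h1 := (hb.isFibreFamily le_rfl).map_det
      (fun l : Fin n => (aOp (HolFun U₀))^[l.1] g) ⟨x, hx⟩
    have h2 : (E.valueHom hx ∘ fun l : Fin n => (aOp (HolFun U₀))^[l.1] g) =
        fun l : Fin n => (aOp ℂ)^[l.1] (E.value hx g) :=
      funext fun l => E.value_iterate hx g l
    rw [Module.Basis.is_basis_iff_det ((hb.isFibreFamily le_rfl).basis ⟨x, hx⟩), ← h2]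
    refine Iff.trans ?_ (iff_of_eq (congrArg IsUnit h1))
    rw [isUnit_series_iff, coeff_map, isUnit_iff_ne_zero]
    rfl
  let U : Opens X := ⟨_, HolFun.isOpen_ne (coeff 0 D)⟩
  have hU : U ≤ U₀ := fun x hx => hx.1
  have hmem : x₀ ∈ U := by
    refine ⟨hx₀, (hD x₀ hx₀).2 ?_⟩
    obtain ⟨-, S, e, he, w, hw, hgw⟩ := exists_themeFrame hk (hE x₀).1 (hE x₀).2 hg₀
    rw [hg, hgw]
    refine ⟨he.frame.linearIndependent_iterate he.isUnit hw he.ind, ?_⟩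
    rw [← orbitSpan_eq_span, he.frame.orbitSpan_eq le_rfl he.isUnit hw n le_rfl, he.span]
  have hfib : ∀ x : U, ∃ (S : ℕ → ℂ⟦X⟧) (e : ℕ → E.Fibre x.1), IsThemeFrame lam₁ p n S e ∧
      ∃ w : ℂ⟦X⟧, IsUnit w ∧ E.valueHom x.2 (E.res hU g) = w • e n := by
    intro x
    have hgen : (ABSubmodule.gen (R := ℂ) (E.value (hU x.2) g)).toSubmodule = ⊤ := by
      rw [eq_top_iff, ← ((hD x.1 (hU x.2)).1 x.2.2).2]
      refine Submodule.span_mono ?_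
      rintro _ ⟨l, rfl⟩
      exact ⟨l.1, rfl⟩
    obtain ⟨-, S, e, he, w, hw, hgw⟩ := exists_themeFrame hk (hE x.1).1 (hE x.1).2 hgen
    refine ⟨S, e, he, w, hw, ?_⟩
    rw [valueHom_apply, value_res, hgw]
  choose Sb eb hbf hw using hfib
  obtain ⟨S, e, he, hev⟩ := (hb.isFibreFamily hU).exists_themeFrame hbf (E.res hU g) hw
  refine ⟨U, hmem, S, e, IsLocalBasis.of_basis fun V hV => ?_, he, fun x hx => hev ⟨x, hx⟩⟩
  refine (hb.isFibreFamily (hV.trans hU)).basis_of_fibre _ fun x => ?_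
  have h1 : (E.valueHom x.2 ∘ fun i : Fin n => E.res hV (e (i.1 + 1))) =
      fun i : Fin n => E.value (hV x.2) (e (i.1 + 1)) :=
    funext fun i => E.value_res hV x.2 _
  rw [h1]
  have h2 := hev ⟨x.1, hV x.2⟩
  refine ⟨h2.ind, ?_⟩
  rw [← h2.span, topSpan_self]
  rfl

theorem topSpan_eq_span_image {R : Type*} [CommRing R] {M : Type*} [AddCommGroup M]
    [Module R⟦X⟧ M] (b : Module.Basis (Fin k) R⟦X⟧ M) {e : ℕ → M}
    (hb : ∀ i, b i = e (i.1 + 1)) {j : ℕ} (hj : j ≤ k) :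
    topSpan R e j j = Submodule.span R⟦X⟧ (b '' {i | i.1 < j}) := by
  rw [topSpan_self]
  congr 1
  ext m
  constructor
  · rintro ⟨i, rfl⟩
    exact ⟨Fin.castLE hj i, i.2, hb _⟩
  · rintro ⟨i, hi, rfl⟩
    exact ⟨⟨i.1, hi⟩, (hb i).symm⟩

/-- Membership means that the coordinates of index at least j vanish, and holomorphic functions on a
reduced space vanish as soon as all their values do. -/
theorem IsLocalBasis.mem_topSpan_iff {U : Opens X} {e : ℕ → E.sec U}
    (he : E.IsLocalBasis fun i : Fin k => e (i.1 + 1)) {j : ℕ} (hj : j ≤ k) {V : Opens X}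
    (hV : V ≤ U) (s : E.sec V) : s ∈ topSpan (HolFun V) (fun i => E.res hV (e i)) j j ↔
      ∀ (x : X) (hx : x ∈ V), E.value hx s ∈ topSpan ℂ (fun i => E.value (hV hx) (e i)) j j := by
  have hbx : ∀ (x : X) (hx : x ∈ V) (i : Fin k), Module.Basis.mk
      (he.linearIndependent_value (hV hx)) (he.span_value (hV hx)).ge i =
        E.value (hV hx) (e (i.1 + 1)) := fun x hx i => Module.Basis.mk_apply _ _ _
  have key : ∀ (x : X) (hx : x ∈ V) (i : Fin k), (Module.Basis.mk
      (he.linearIndependent_value (hV hx)) (he.span_value (hV hx)).ge).repr (E.value hx s) i =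
        evalSeries hx ((he.basis hV).repr s i) := by
    intro x hx i
    have h1 : E.value hx s = ∑ i, evalSeries hx ((he.basis hV).repr s i) • Module.Basis.mk
        (he.linearIndependent_value (hV hx)) (he.span_value (hV hx)).ge i := by
      rw [he.value_eq hx hV s]
      exact Finset.sum_congr rfl fun i _ => by rw [hbx x hx]
    rw [h1, Module.Basis.repr_sum_self]
  rw [topSpan_eq_span_image (he.basis hV) (fun i => he.basis_apply hV i) hj,
    Module.Basis.mem_span_image]
  have hpt : ∀ (x : X) (hx : x ∈ V),
      E.value hx s ∈ topSpan ℂ (fun i => E.value (hV hx) (e i)) j j ↔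
        ∀ i : Fin k, evalSeries hx ((he.basis hV).repr s i) ≠ 0 → i.1 < j := by
    intro x hx
    rw [topSpan_eq_span_image _ (hbx x hx) hj, Module.Basis.mem_span_image]
    simp only [Set.subset_def, Finset.mem_coe, Finsupp.mem_support_iff, key, Set.mem_ofPred_eq]
  simp only [hpt, Set.subset_def, Finset.mem_coe, Finsupp.mem_support_iff, Set.mem_ofPred_eq]
  constructor
  · intro h x hx i hi
    refine h i fun h0 => hi ?_
    rw [h0, map_zero]
  · intro h i hi
    by_contra hij
    refine hi ?_
    refine PowerSeries.ext fun n => HolFun.ext_eval _ fun x => ?_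
    by_contra hne
    refine hij (h x.1 x.2 i fun h0 => hne ?_)
    have := congrArg (coeff n) h0
    rwa [evalSeries, coeff_map, map_zero] at this

end ABSheaf

/-! ### Subsheaves cut out by submodules of the fibres. -/

namespace ABSheaf

variable {X : Type u} [TopologicalSpace X] [ReducedComplexSpace X] {E : ABSheaf.{u, v} X}
  {lam lam₁ : ℚ} {p : ℕ → ℕ} {k : ℕ}

/-- The sections whose values belong to given submodules of the fibres. -/
def sectionsIn (E : ABSheaf.{u, v} X) (G : ∀ x, ABSubmodule ℂ (E.Fibre x)) (V : Opens X) :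
    ABSubmodule (HolFun V) (E.sec V) where
  carrier := {s | ∀ (x : X) (hx : x ∈ V), E.value hx s ∈ (G x).toSubmodule}
  zero_mem' x hx := by
    rw [← valueHom_apply, map_zero]
    exact Submodule.zero_mem _
  add_mem' {s t} hs ht x hx := by
    rw [← valueHom_apply, map_add]
    exact Submodule.add_mem _ (hs x hx) (ht x hx)
  smul_mem' S s hs x hx := by
    rw [value_smul]
    exact Submodule.smul_mem _ _ (hs x hx)
  a_mem s hs x hx := (G x).a_mem _ (hs x hx)

/-- The sections `e 1, …, e j` form a local basis of the sheaf of sections with values in `G`. -/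
theorem existsUnique_of_mem_sectionsIn {G : ∀ x, ABSubmodule ℂ (E.Fibre x)} {U : Opens X}
    {e : ℕ → E.sec U} (he : E.IsLocalBasis fun i : Fin k => e (i.1 + 1)) {j : ℕ} (hj : j ≤ k)
    (hG : ∀ (x : X) (hx : x ∈ U), (G x).toSubmodule = topSpan ℂ (fun i => E.value hx (e i)) j j)
    {V : Opens X} (hV : V ≤ U) (s : E.sec V) (hs : s ∈ (E.sectionsIn G V).toSubmodule) :
    ∃! c : Fin j → (HolFun V)⟦X⟧, s = ∑ i, c i • E.res hV (e (i.1 + 1)) := by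
  have hs' := (he.mem_topSpan_iff hj hV s).2 fun x hx => by
    rw [← hG x (hV hx)]; exact hs x hx
  rw [topSpan_self, Submodule.mem_span_range_iff_exists_fun] at hs'
  obtain ⟨c, hc⟩ := hs'
  refine ⟨c, hc.symm, fun c' hc' => ?_⟩
  have hind := (he.basis hV).linearIndependent.comp (Fin.castLE hj) (Fin.castLE_injective hj)
  have h1 : (he.basis hV ∘ Fin.castLE hj) = fun i : Fin j => E.res hV (e (i.1 + 1)) :=
    funext fun i => he.basis_apply hV _
  rw [h1, Fintype.linearIndependent_iff] at hind
  funext i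
  refine sub_eq_zero.1 (hind (fun i => c' i - c i) ?_ i)
  simp only [sub_smul, Finset.sum_sub_distrib]
  rw [← hc', hc, sub_self]

theorem mem_sectionsIn_of_frame {G : ∀ x, ABSubmodule ℂ (E.Fibre x)} {U : Opens X}
    {e : ℕ → E.sec U} (h0 : e 0 = 0) {j : ℕ}
    (hG : ∀ (x : X) (hx : x ∈ U), (G x).toSubmodule = topSpan ℂ (fun i => E.value hx (e i)) j j)
    {i : ℕ} (hi : i ≤ j) : e i ∈ (E.sectionsIn G U).toSubmodule := by
  intro x hx
  rcases Nat.eq_zero_or_pos i with rfl | hi0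
  · rw [h0, ← valueHom_apply, map_zero]
    exact Submodule.zero_mem _
  · rw [hG x hx]
    exact mem_topSpan_self (e := fun i => E.value hx (e i)) hi0 hi

/-- The subsheaf of the sections with values in `G`, when it is locally spanned by a part of a
local basis. -/
def subOfFrames (G : ∀ x, ABSubmodule ℂ (E.Fibre x)) (j : ℕ) (hj : j ≤ k)
    (hG : ∀ x : X, ∃ U : Opens X, x ∈ U ∧ ∃ e : ℕ → E.sec U, e 0 = 0 ∧
      (E.IsLocalBasis fun i : Fin k => e (i.1 + 1)) ∧ ∀ (x : X) (hx : x ∈ U),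
        (G x).toSubmodule = topSpan ℂ (fun i => E.value hx (e i)) j j) : E.Sub where
  carrier := E.sectionsIn G
  res_mem h s hs x hx := by
    rw [value_res]
    exact hs x (h hx)
  mem_of_local s hs x hx := by
    obtain ⟨V, h, hxV, hV⟩ := hs x hx
    rw [← E.value_res h hxV]
    exact hV x hxV
  locally_free x := by
    obtain ⟨U, hx, e, h0, he, hGe⟩ := hG x
    exact ⟨U, hx, j, fun i => ⟨e (i.1 + 1), mem_sectionsIn_of_frame h0 hGe i.2⟩,
      fun V h s hs => existsUnique_of_mem_sectionsIn he hj hGe h s hs⟩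

theorem Sub.coe_sum_smul (F : E.Sub) {V : Opens X} {n : ℕ} (c : Fin n → (HolFun V)⟦X⟧)
    (s : Fin n → F.toABSheaf.sec V) :
    ((∑ i, c i • s i : F.toABSheaf.sec V) : (F.carrier V).toSubmodule).1 =
      ∑ i, c i • (s i : (F.carrier V).toSubmodule).1 := by
  exact map_sum ((F.carrier V).toSubmodule.subtype) (fun i => c i • s i) Finset.univ

theorem Sub.isLocalBasis (F : E.Sub) {U : Opens X} {n : ℕ} (e : Fin n → F.toABSheaf.sec U)
    (h : ∀ (V : Opens X) (h : V ≤ U), ∀ s ∈ (F.carrier V).toSubmodule,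
      ∃! c : Fin n → (HolFun V)⟦X⟧, s = ∑ i, c i • E.res h (e i).1) :
    F.toABSheaf.IsLocalBasis e := by
  intro V hV s
  obtain ⟨c, hc, huniq⟩ := h V hV s.1 s.2
  have key : ∀ c : Fin n → (HolFun V)⟦X⟧, (∑ i, c i • F.toABSheaf.res hV (e i)).1 =
      ∑ i, c i • E.res hV (e i).1 := fun c => F.coe_sum_smul c _
  exact ⟨c, Subtype.ext (hc.trans (key c).symm),
    fun c' hc' => huniq c' ((congrArg Subtype.val hc').trans (key c'))⟩

/-- A section of F and its image in E have the same coordinates on the basis e. Independence of the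
values in E(x) gives injectivity of the fibre map, and their span is its image. -/
theorem Sub.takesValue_of_basis (F : E.Sub) {x : X} {U : Opens X} (hx : x ∈ U) {n : ℕ}
    {e : Fin n → F.toABSheaf.sec U} (he : F.toABSheaf.IsLocalBasis e)
    (G : ABSubmodule ℂ (E.Fibre x))
    (hind : LinearIndependent ℂ⟦X⟧ fun i => E.value hx (e i).1)
    (hspan : G.toSubmodule = Submodule.span ℂ⟦X⟧ (Set.range fun i => E.value hx (e i).1)) :
    F.TakesValue x G := by
  have hval : ∀ {V : Opens X} (hxV : x ∈ V) (hV : V ≤ U) (s : F.toABSheaf.sec V),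
      E.value hxV s.1 = ∑ i, evalSeries hxV ((he.basis hV).repr s i) • E.value hx (e i).1 := by
    intro V hxV hV s
    have h1 : s.1 = ∑ i, (he.basis hV).repr s i • E.res hV (e i).1 := by
      conv_lhs => rw [← (he.basis hV).sum_repr s]
      rw [F.coe_sum_smul]
      exact Finset.sum_congr rfl fun i _ => by rw [he.basis_apply hV]; rfl
    rw [h1, ← valueHom_apply, map_sum]
    refine Finset.sum_congr rfl fun i _ => ?_
    rw [valueHom_apply, value_smul, value_res]
  refine ⟨fun V hxV s hs => ?_, fun z => ⟨fun hz => ?_, ?_⟩⟩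
  · have hm : x ∈ V ⊓ U := ⟨hxV, hx⟩
    rw [← F.toABSheaf.value_res (inf_le_left : V ⊓ U ≤ V) hm, he.value_eq hm inf_le_right]
    have h1 := hval hm inf_le_right (F.toABSheaf.res inf_le_left s)
    have h2 : E.value hm (F.toABSheaf.res (inf_le_left : V ⊓ U ≤ V) s).1 = 0 := by
      rw [← hs]
      exact E.value_res inf_le_left hm s.1
    rw [h2] at h1
    have h3 := (Fintype.linearIndependent_iff.1 hind) _ h1.symm
    exact Finset.sum_eq_zero fun i _ => by rw [h3 i, zero_smul]
  · rw [hspan] at hz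
    obtain ⟨c, rfl⟩ := (Submodule.mem_span_range_iff_exists_fun ℂ⟦X⟧).1 hz
    refine ⟨U, hx, ∑ i, constSeries U (c i) • e i, ?_⟩
    rw [F.coe_sum_smul, ← valueHom_apply, map_sum]
    rfl
  · rintro ⟨V, hxV, s, rfl⟩
    have hm : x ∈ V ⊓ U := ⟨hxV, hx⟩
    have h1 := hval hm inf_le_right (F.toABSheaf.res inf_le_left s)
    have h2 : E.value hm (F.toABSheaf.res (inf_le_left : V ⊓ U ≤ V) s).1 = E.value hxV s.1 :=
      E.value_res inf_le_left hm s.1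
    rw [← h2, h1, hspan]
    exact Submodule.sum_mem _ fun i _ => Submodule.smul_mem _ _ (Submodule.subset_span ⟨i, rfl⟩)

end ABSheaf

/-! ### Global consequences: the family, its normal submodules and the parameter. -/

section Families

variable {X : Type u} [TopologicalSpace X] [ReducedComplexSpace X] {E : ABSheaf.{u, v} X}
  {lam lam₁ : ℚ} {p : ℕ → ℕ} {k : ℕ}

open ABSheaf

theorem exists_shift (hk : 1 ≤ k)
    (hE : ∀ x : X, IsPrimitiveTheme (E.Fibre x) lam k ∧ HasInvariants (E.Fibre x) k lam₁ p) :
    Nonempty X → ∃ m : ℕ, lam₁ = lam + m ∧ k - 1 ≤ m := by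
  rintro ⟨x⟩
  obtain ⟨g, hg⟩ := (hE x).1.exists_generator
  exact (exists_themeFrame hk (hE x).1 (hE x).2 hg).1

/-- Constancy of the fundamental invariants makes the ranks of the linear systems which define the
flags `F_j(x)` constant, so a family of primitive themes with constant invariants is holomorphic. -/
theorem isHolomorphicFamily_of_invariants (hlam : 0 < lam ∧ lam ≤ 1) (hk : 1 ≤ k)
    (hE : ∀ x : X, IsPrimitiveTheme (E.Fibre x) lam k ∧ HasInvariants (E.Fibre x) k lam₁ p) :
    IsHolomorphicFamily E k := by
  refine E.isHolomorphicFamily_of_frames (p := p) hlam hk (exists_shift hk hE) fun x => ?_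
  obtain ⟨U, hx, S, e, hb, he, -⟩ := exists_local_frame hk hE x
  exact ⟨U, hx, S, e, he.frame, he.isUnit, he.isUnit_coeff, hb⟩

/-- The normal submodules of given rank of a family with constant invariants are holomorphic. -/
theorem holomorphicNormalSub_of_invariants (hlam : 0 < lam ∧ lam ≤ 1) {j : ℕ} (hj1 : 1 ≤ j)
    (hj : j ≤ k)
    (hE : ∀ x : X, IsPrimitiveTheme (E.Fibre x) lam k ∧ HasInvariants (E.Fibre x) k lam₁ p) :
    HolomorphicNormalSub E j := by
  have hk := hj1.trans hj
  have hG : ∀ x : X, ∃ G : ABSubmodule ℂ (E.Fibre x), G.IsNormalOfRank j := fun x => by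
    obtain ⟨F, hF, -⟩ := (hE x).2
    exact ⟨F j, hF j hj⟩
  choose G hG using hG
  choose! U hxU S e hb he hev using exists_local_frame hk hE
  have hGe : ∀ (x₀ x : X) (hx : x ∈ U x₀),
      (G x).toSubmodule = topSpan ℂ (fun i => E.value hx (e x₀ i)) j j :=
    fun x₀ x hx => (hev x₀ x hx).eq_topSpan (hG x)
  let F : E.Sub := subOfFrames G j hj fun x =>
    ⟨U x, hxU x, e x, (he x).frame.zero, hb x, hGe x⟩
  -- Frames are indexed by all of ℕ, while only e_0, …, e_j are known to be sections of F;
  -- truncating the index at j gives a total sequence in F without altering the relevant vectors.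
  let f : ∀ x : X, ℕ → F.toABSheaf.sec (U x) := fun x i =>
    ⟨e x (min i j), mem_sectionsIn_of_frame (he x).frame.zero (hGe x) (min_le_right i j)⟩
  have hf : ∀ x i, i ≤ j → (f x i).1 = e x i := fun x i hi => by
    change e x (min i j) = e x i
    rw [min_eq_left hi]
  have hfb : ∀ x, F.toABSheaf.IsLocalBasis fun i : Fin j => f x (i.1 + 1) := by
    intro x
    refine F.isLocalBasis _ fun V hV s hs => ?_
    have h1 := existsUnique_of_mem_sectionsIn (hb x) hj (hGe x) hV s hs
    have h2 : ∀ i : Fin j, (f x (i.1 + 1)).1 = e x (i.1 + 1) := fun i => hf x _ i.2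
    simpa only [h2] using h1
  refine ⟨F, F.toABSheaf.isHolomorphicFamily_of_frames (lam₁ := lam₁) (p := p) hlam hj1 (fun hX => ?_)
    fun x => ⟨U x, hxU x, S x, f x, ⟨Subtype.ext ?_, fun i hi => Subtype.ext ?_⟩,
      fun i h1 hi => (he x).isUnit i h1 (hi.trans_le hj),
      fun i h1 hi => (he x).isUnit_coeff i h1 (hi.trans_le hj), hfb x⟩,
    fun x => ⟨G x, hG x, F.takesValue_of_basis (hxU x) (hfb x) (G x) ?_ ?_⟩⟩
  · obtain ⟨m, hm, hkm⟩ := exists_shift hk hE hX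
    exact ⟨m, hm, (Nat.sub_le_sub_right hj 1).trans hkm⟩
  · rw [hf x 0 (Nat.zero_le j), (he x).frame.zero]
    rfl
  · have h1 := (he x).frame.step i (hi.trans_le hj)
    rw [← hf x (i + 1) hi, ← hf x i hi.le] at h1
    exact h1
  · have h1 := (hev x x (hxU x)).ind.comp (Fin.castLE hj) (Fin.castLE_injective hj)
    have h2 : (fun i : Fin j => E.value (hxU x) (f x (i.1 + 1)).1) =
        (fun i : Fin k => E.value (hxU x) (e x (i.1 + 1))) ∘ Fin.castLE hj :=
      funext fun i => by rw [hf x _ i.2]; rfl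
    rw [h2]
    exact h1
  · rw [hGe x x (hxU x), topSpan_self]
    congr 2
    funext i
    rw [hf x _ i.2]

/-- The parameter is the ratio of two coefficients of a holomorphic frame. -/
theorem exists_holomorphic_parameter (hk : 2 ≤ k) (hp : 1 ≤ p (k - 1))
    (hE : ∀ x : X, IsPrimitiveTheme (E.Fibre x) lam k ∧ HasInvariants (E.Fibre x) k lam₁ p) :
    ∃ α : X → ℂ, (∀ (x : X) (F : ABSubmodule ℂ (E.Fibre x)), F.IsNormalOfRank (k - 2) →
      ∀ β : ℂ, IsParameter (E.Fibre x ⧸ F.toSubmodule) (lamInv lam₁ p (k - 1)) (p (k - 1)) β ↔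
        β = α x) ∧ IsHolomorphicFun α := by
  obtain ⟨k, rfl⟩ : ∃ n, k = n + 2 := ⟨k - 2, by omega⟩
  simp only [show k + 2 - 1 = k + 1 by omega, show k + 2 - 2 = k by omega] at hp ⊢
  have hpar : ∀ (x : X) (S : ℕ → ℂ⟦X⟧) (e : ℕ → E.Fibre x), IsThemeFrame lam₁ p (k + 2) S e →
      ∀ F : ABSubmodule ℂ (E.Fibre x), F.IsNormalOfRank k → ∀ β : ℂ,
        IsParameter (E.Fibre x ⧸ F.toSubmodule) (lamInv lam₁ p (k + 1)) (p (k + 1)) β ↔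
          β = coeff (p (k + 1)) (S (k + 1)) / coeff 0 (S (k + 1)) := by
    intro x S e he F hF β
    refine he.frame.isParameter_iff he.span he.ind (he.eq_topSpan hF) hp rfl ?_ ?_ ?_ β
    · rw [lamInv_succ lam₁ p (by omega : 1 ≤ k + 1)]
    · exact (isUnit_series_iff.1 (he.isUnit (k + 1) (by omega) (by omega))).ne_zero
    · exact (he.isUnit_coeff (k + 1) (by omega) (by omega)).ne_zero
  choose! U hxU S e hb he hev using exists_local_frame (by omega : 1 ≤ k + 2) hE
  let α : X → ℂ := fun x => coeff (p (k + 1)) (evalSeries (hxU x) (S x (k + 1))) /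
    coeff 0 (evalSeries (hxU x) (S x (k + 1)))
  -- The ratio does not depend on the local frame, since in any frame it is the unique parameter of
  -- the same quotient. Hence near x₀ it is given by one holomorphic frame.
  have hα : ∀ (x₀ x : X) (hx : x ∈ U x₀), α x =
      coeff (p (k + 1)) (evalSeries hx (S x₀ (k + 1))) /
        coeff 0 (evalSeries hx (S x₀ (k + 1))) := by
    intro x₀ x hx
    obtain ⟨F, hF, -⟩ := (hE x).2
    exact (hpar x _ _ (hev x₀ x hx) (F k) (hF k (by omega)) _).1
      ((hpar x _ _ (hev x x (hxU x)) (F k) (hF k (by omega)) _).2 rfl)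
  refine ⟨α, fun x => hpar x _ _ (hev x x (hxU x)), ReducedComplexSpace.hol_glue _ _ fun x _ =>
    ⟨U x, le_top, hxU x, ?_⟩⟩
  obtain ⟨c, hc⟩ := isUnit_series_iff.1 ((he x).isUnit (k + 1) (by omega) (by omega))
  convert (coeff (p (k + 1)) (S x (k + 1)) * ((c⁻¹ : (HolFun (U x))ˣ) : HolFun (U x))).2 using 1
  funext y
  have h1 : HolFun.eval y.2 (coeff 0 (S x (k + 1))) *
      HolFun.eval y.2 ((c⁻¹ : (HolFun (U x))ˣ) : HolFun (U x)) = 1 := by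
    rw [← map_mul, ← hc, Units.mul_inv, map_one]
  change α y.1 = HolFun.eval y.2 (coeff (p (k + 1)) (S x (k + 1))) *
    HolFun.eval y.2 ((c⁻¹ : (HolFun (U x))ˣ) : HolFun (U x))
  rw [hα x y.1 y.2, evalSeries, coeff_map, coeff_map]
  exact (div_eq_iff (left_ne_zero_of_mul_eq_one h1)).2
    (by rw [mul_assoc, mul_comm _ (HolFun.eval y.2 (coeff 0 _))]; exact (h1 ▸ (mul_one _).symm))

end Families

end

theorem theorem1p4p2 {X : Type u} [TopologicalSpace X] [T2Space X] [ReducedComplexSpace X]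
    (E : ABSheaf.{u, v} X) (lam : ℚ) (hlam : 0 < lam ∧ lam ≤ 1) (k : ℕ) (hk : 2 ≤ k)
    (lam₁ : ℚ) (p : ℕ → ℕ)
    (hE : ∀ x : X, IsPrimitiveTheme (E.Fibre x) lam k ∧ HasInvariants (E.Fibre x) k lam₁ p) :
    (1 ≤ p (k - 1) → ∃ α : X → ℂ,
      (∀ (x : X) (F : ABSubmodule ℂ (E.Fibre x)), F.IsNormalOfRank (k - 2) →
        ∀ β : ℂ, IsParameter (E.Fibre x ⧸ F.toSubmodule) (lamInv lam₁ p (k - 1)) (p (k - 1)) β ↔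
          β = α x) ∧
      (IsHolomorphicFamily E k ↔ HolomorphicNormalSub E (k - 1) ∧ IsHolomorphicFun α)) ∧
    (p (k - 1) = 0 → (IsHolomorphicFamily E k ↔ HolomorphicNormalSub E (k - 1))) := by
  have hk1 : 1 ≤ k := (by omega : 1 ≤ 2).trans hk
  have hfam := isHolomorphicFamily_of_invariants hlam hk1 hE
  have hsub := holomorphicNormalSub_of_invariants hlam (by omega : 1 ≤ k - 1) (Nat.sub_le k 1) hE
  -- Both sides of each equivalence hold outright, so each reduces to an equivalence of true
  -- statements.
  refine ⟨fun hp => ?_, fun _ => iff_of_true hfam hsub⟩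
  obtain ⟨α, hα, hhol⟩ := exists_holomorphic_parameter hk hp hE
  exact ⟨α, hα, iff_of_true hfam ⟨hsub, hhol⟩⟩
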